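/- Let $\mathbf P=BO(1)$ be the one-object groupoid with automorphism group $\{\pm1\}$. A groupoid is finite if it has finitely many components and finite sets of arrows. Let $\mathcal Z$ be the $2$-category of finite groupoids $f:S\to\mathbf P$ with parity structure (the weak slice over $\mathbf P$: a $1$-cell is a functor $u:S\to T$ with a natural transformation $\theta:f\Rightarrow g\circ u$, a $2$-cell is a natural transformation compatible with the $\theta$'s). Let $\mathrm{lin}^{\pm}$ have as objects the slices $\mathcal Z_{/S}$, one for each $S\in\mathcal Z$, and as morphisms $\mathcal Z_{/S}\to\mathcal Z_{/T}$ the spans $S\leftarrow M\to T$ in $\mathcal Z$, up to equivalence of spans, composed by homotopy pullback; functors from $\mathrm{lin}^\pm$ to an ordinary category are functors on this category of equivalence classes. A finite homotopy sum in $\mathrm{lin}^\pm$ is a homotopy colimit of a homotopy-coherent diagram indexed by a finite groupoid $I$. Explicitly, such a diagram is a pseudofunctor $D:I\to\mathcal Z$; a coherent cocone with vertex $X$ is a span of pseudofunctors $D\Leftarrow M\Rightarrow \mathrm{const}_X$; and it is a homotopy sum if every coherent cocone under $D$ factors through it by a span which is unique up to equivalence. A functor $F:\mathrm{lin}^\pm\to\mathrm{vect}_{\mathbb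 Q}$ (rational vector spaces) preserves finite homotopy sums if it sends these cocones to colimits of $I$-indexed diagrams in $\mathrm{vect}_{\mathbb Q}$. A scalar is a span $1\leftarrow M\to 1$ over $\mathsf e:1\to\mathbf P$. Each of its points has a sign, the ratio of the two $2$-cells, and its cardinality is $|M|:=|M_\oplus|-|M_\ominus|$, where $|G|=\sum_{x\in\pi_0G}1/|\mathrm{Aut}(x)|$ for a finite groupoid $G$ and $M_\oplus$, $M_\ominus$ are the positive and negative parts. A point of $S$ is orientable if it has no odd automorphisms (automorphisms sent to $-1$); $S^\circ\subseteq S$ is the full subgroupoid of orientable points. Fix a base point in each component of each $S^\circ$. The cardinality assignment sends $\mathcal Z_{/S}$ to the vector space $\mathbb Q_{\pi_0S^\circ}$ with basis $\pi_0S^\circ$, and a span $S\leftarrow M\to T$ to the linear map whose coefficient from $i\in\pi_0S^\circ$ to $j\in\pi_0T^\circ$ is $|{}_iM_j|/|\mathrm{Aut}(j)|$, where the scalar ${}_iM_j$ is the two-sided homotopy fibre of $M$ over the base points. Let $\mathbf P\to\mathrm{lin}^\pm$ be the functor sending the point to $\mathcal Z_{/\mathsf e}$ and $\pm1$ to the span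 $1\leftarrow1\to1$ with $2$-cell $\pm1$, and let $\mathbf P\to\mathrm{vect}_{\mathbb Q}$ be the functor sending the point to $\mathbb Q$ and $\pm1$ to $\pm\mathrm{Id}$. Then the cardinality assignment is a well-defined functor $|\cdot|:\mathrm{lin}^\pm\to\mathrm{vect}_{\mathbb Q}$; it preserves finite homotopy sums; its composite with $\mathbf P\to\mathrm{lin}^\pm$ is isomorphic to $\mathbf P\to\mathrm{vect}_{\mathbb Q}$; and it is the unique such functor: if $F:\mathrm{lin}^\pm\to\mathrm{vect}_{\mathbb Q}$ preserves finite homotopy sums, then for all natural isomorphisms $\alpha:F|_{\mathbf P}\cong(\mathbf P\to\mathrm{vect}_{\mathbb Q})$ and $\gamma:|\cdot|\,\big|_{\mathbf P}\cong(\mathbf P\to\mathrm{vect}_{\mathbb Q})$ there is exactly one natural isomorphism $\varphi:F\cong|\cdot|$ with $\gamma\circ\varphi|_{\mathbf P}=\alpha$. -/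

import Mathlib

open CategoryTheory
open scoped Bicategory Pseudofunctor.StrongTrans

namespace SignedLinAlg

noncomputable section

/-- The groupoid `BO(1)` of parities: one object, whose arrows are the signs `±1`. -/
abbrev ParityGroupoid : Type := SingleObj ℤˣ

/-- The set of isomorphism classes (for a groupoid: connected components) of a category. -/
abbrev Pi0 (C : Type) [Category.{0} C] : Type := Quotient (isIsomorphicSetoid C)

/-- A groupoid is finite if it has finitely many components and finite sets of arrows. -/
class FiniteGroupoid (G : Type) [Groupoid.{0} G] : Prop where
  finite_pi0 : Finite (Pi0 G)
  finite_hom : ∀ x y : G, Finite (x ⟶ y)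

/-- A finite groupoid with parity structure, that is, a finite groupoid over `BO(1)`. -/
structure ParGrpd where
  carrier : Type
  [groupoid : Groupoid.{0} carrier]
  [finite : FiniteGroupoid carrier]
  par : carrier ⥤ ParityGroupoid

namespace ParGrpd

instance : CoeSort ParGrpd Type := ⟨ParGrpd.carrier⟩

instance (S : ParGrpd) : Groupoid.{0} S := S.groupoid
instance (S : ParGrpd) : FiniteGroupoid S := S.finite

/-- The parity of an arrow. -/
def parity (S : ParGrpd) {x y : S} (a : x ⟶ y) : ℤˣ := S.par.map a

@[simp] lemma parity_id (S : ParGrpd) (x : S) : S.parity (𝟙 x) = 1 := S.par.map_id x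

@[simp] lemma parity_comp (S : ParGrpd) {x y z : S} (a : x ⟶ y) (b : y ⟶ z) :
    S.parity (a ≫ b) = S.parity a * S.parity b :=
  (S.par.map_comp a b).trans (mul_comm (S.parity b) (S.parity a))

@[simp] lemma parity_inv (S : ParGrpd) {x y : S} (a : x ⟶ y) :
    S.parity (inv a) = (S.parity a)⁻¹ := by
  rw [eq_inv_iff_mul_eq_one, ← parity_comp]; simp

/-- A morphism of parity structures: a functor `u` together with a homotopy (natural
transformation, automatically invertible) filling the triangle over `BO(1)`. -/
@[ext]
structure Hom (S T : ParGrpd) where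
  functor : S ⥤ T
  tri : S.par ⟶ functor ⋙ T.par

/-- A 2-cell between morphisms of parity structures: a natural transformation (automatically
invertible) compatible with the homotopies over `BO(1)`. -/
@[ext]
structure Hom₂ {S T : ParGrpd} (u v : Hom S T) where
  nat : u.functor ⟶ v.functor
  comp_tri : u.tri ≫ Functor.whiskerRight nat T.par = v.tri

/-- The component at `x` of the homotopy of a morphism of parity structures. -/
def Hom.sgn {S T : ParGrpd} (u : Hom S T) (x : S) : ℤˣ := u.tri.app x

lemma Hom.sgn_nat {S T : ParGrpd} (u : Hom S T) {x y : S} (a : x ⟶ y) :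
    S.parity a * u.sgn y = u.sgn x * T.parity (u.functor.map a) :=
  (mul_comm _ _).trans
    ((u.tri.naturality a).trans (mul_comm (T.parity (u.functor.map a)) (u.sgn x)))

lemma Hom₂.sgn_eq {S T : ParGrpd} {u v : Hom S T} (α : Hom₂ u v) (x : S) :
    v.sgn x = u.sgn x * T.parity (α.nat.app x) :=
  (congrArg (fun t => t.app x) α.comp_tri).symm.trans
    (mul_comm (T.parity (α.nat.app x)) (u.sgn x))

/-- Build a morphism of parity structures from the components of the homotopy. -/
def Hom.mk' {S T : ParGrpd} (F : S ⥤ T) (θ : S → ℤˣ)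
    (h : ∀ {x y : S} (a : x ⟶ y), S.parity a * θ y = θ x * T.parity (F.map a)) : Hom S T where
  functor := F
  tri := { app := fun x => θ x
           naturality := fun _ _ a => (mul_comm _ _).trans ((h a).trans (mul_comm _ _)) }

@[simp] lemma Hom.mk'_functor {S T : ParGrpd} (F : S ⥤ T) (θ : S → ℤˣ) (h) :
    (Hom.mk' (S := S) (T := T) F θ h).functor = F := rfl

@[simp] lemma Hom.mk'_sgn {S T : ParGrpd} (F : S ⥤ T) (θ : S → ℤˣ) (h) (x : S) :
    (Hom.mk' (S := S) (T := T) F θ h).sgn x = θ x := rfl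

/-- Build a 2-cell, checking compatibility on components. -/
def Hom₂.mk' {S T : ParGrpd} {u v : Hom S T} (α : u.functor ⟶ v.functor)
    (h : ∀ x, v.sgn x = u.sgn x * T.parity (α.app x)) : Hom₂ u v where
  nat := α
  comp_tri := by
    ext x
    exact (mul_comm _ _).trans (h x).symm

instance : CategoryStruct ParGrpd where
  Hom := Hom
  id S := { functor := 𝟭 S, tri := 𝟙 S.par }
  comp u v := { functor := u.functor ⋙ v.functor
                tri := u.tri ≫ Functor.whiskerLeft u.functor v.tri }

@[simp] lemma id_functor (S : ParGrpd) : Hom.functor (𝟙 S) = 𝟭 S := rfl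
@[simp] lemma comp_functor {S T V : ParGrpd} (u : S ⟶ T) (v : T ⟶ V) :
    Hom.functor (u ≫ v) = u.functor ⋙ v.functor := rfl
@[simp] lemma id_sgn (S : ParGrpd) (x : S) : Hom.sgn (𝟙 S) x = 1 := rfl
@[simp] lemma comp_sgn {S T V : ParGrpd} (u : S ⟶ T) (v : T ⟶ V) (x : S) :
    Hom.sgn (u ≫ v) x = u.sgn x * v.sgn (u.functor.obj x) := mul_comm _ _

instance (S T : ParGrpd) : Category (S ⟶ T) where
  Hom u v := Hom₂ u v
  id u := Hom₂.mk' (𝟙 _) (by intro x; simp)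
  comp α β := Hom₂.mk' (α.nat ≫ β.nat) (by
    intro x; rw [β.sgn_eq, α.sgn_eq]; simp [mul_assoc])
  id_comp _ := Hom₂.ext (Category.id_comp _)
  comp_id _ := Hom₂.ext (Category.comp_id _)
  assoc _ _ _ := Hom₂.ext (Category.assoc _ _ _)

@[ext] lemma hom₂_ext {S T : ParGrpd} {u v : S ⟶ T} {α β : u ⟶ v}
    (h : ∀ x, α.nat.app x = β.nat.app x) : α = β :=
  Hom₂.ext (NatTrans.ext (funext h))

@[simp] lemma mk'_nat {S T : ParGrpd} {u v : Hom S T} (α : u.functor ⟶ v.functor) (h) :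
    (Hom₂.mk' α h).nat = α := rfl
@[simp] lemma id_nat {S T : ParGrpd} (u : S ⟶ T) : Hom₂.nat (𝟙 u) = 𝟙 _ := rfl
@[simp] lemma comp_nat {S T : ParGrpd} {u v w : S ⟶ T} (α : u ⟶ v) (β : v ⟶ w) :
    Hom₂.nat (α ≫ β) = α.nat ≫ β.nat := rfl

/-- Build an invertible 2-cell; every natural transformation between functors of groupoids is
invertible. -/
def isoMk {S T : ParGrpd} {u v : S ⟶ T} (α : u.functor ≅ v.functor)
    (h : ∀ x, v.sgn x = u.sgn x * T.parity (α.hom.app x)) : u ≅ v where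
  hom := Hom₂.mk' α.hom h
  inv := Hom₂.mk' α.inv (by
    intro x
    have h1 : T.parity (α.hom.app x) * T.parity (α.inv.app x) = 1 := by
      rw [← parity_comp]; simp
    rw [h x, mul_assoc, h1, mul_one])
  hom_inv_id := Hom₂.ext α.hom_inv_id
  inv_hom_id := Hom₂.ext α.inv_hom_id

@[simp] lemma isoMk_hom_nat {S T : ParGrpd} {u v : S ⟶ T} (α : u.functor ≅ v.functor) (h) :
    (isoMk α h : u ≅ v).hom.nat = α.hom := rfl
@[simp] lemma isoMk_inv_nat {S T : ParGrpd} {u v : S ⟶ T} (α : u.functor ≅ v.functor) (h) :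
    (isoMk α h : u ≅ v).inv.nat = α.inv := rfl

/-- Whiskering of a 2-cell by a morphism on the left. -/
def whiskerL {S T V : ParGrpd} (u : S ⟶ T) {v w : T ⟶ V} (α : v ⟶ w) : u ≫ v ⟶ u ≫ w :=
  Hom₂.mk' (u := u ≫ v) (v := u ≫ w) (Functor.whiskerLeft u.functor (Hom₂.nat α)) (by
    intro x
    simp only [comp_sgn, Hom₂.sgn_eq α, Functor.whiskerLeft_app, mul_assoc])

/-- Whiskering of a 2-cell by a morphism on the right. -/
def whiskerR {S T V : ParGrpd} {u v : S ⟶ T} (α : u ⟶ v) (w : T ⟶ V) : u ≫ w ⟶ v ≫ w :=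
  Hom₂.mk' (u := u ≫ w) (v := v ≫ w) (Functor.whiskerRight (Hom₂.nat α) w.functor) (by
    intro x
    have h := w.sgn_nat ((Hom₂.nat α).app x)
    simp only [comp_sgn, Hom₂.sgn_eq α, Functor.whiskerRight_app, mul_assoc, h])

/-- Every arrow of a groupoid is invertible. -/
def isoOf {S : ParGrpd} {x y : S} (a : x ⟶ y) : x ≅ y := (Groupoid.isoEquivHom x y).symm a

/-- The 2-category of finite groupoids with parity structure (the weak slice of finite groupoids
over `BO(1)`). -/
instance : Bicategory ParGrpd where
  whiskerLeft u _ _ α := whiskerL u α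
  whiskerRight α w := whiskerR α w
  associator u v w := isoMk (u := (u ≫ v) ≫ w) (v := u ≫ v ≫ w) (Functor.associator _ _ _)
    (by intro x; simp [mul_assoc])
  leftUnitor u := isoMk (u := 𝟙 _ ≫ u) (v := u) (Functor.leftUnitor _) (by intro x; simp)
  rightUnitor u := isoMk (u := u ≫ 𝟙 _) (v := u) (Functor.rightUnitor _) (by intro x; simp)
  whiskerLeft_id _ _ := by ext x; simp [whiskerL]
  whiskerLeft_comp _ _ _ _ _ _ := by ext x; simp [whiskerL]
  id_whiskerLeft _ := by ext x; simp [whiskerL]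
  comp_whiskerLeft _ _ _ _ _ := by ext x; simp [whiskerL]
  id_whiskerRight _ _ := by ext x; simp [whiskerR]
  comp_whiskerRight _ _ _ := by ext x; simp [whiskerR]
  whiskerRight_id _ := by ext x; simp [whiskerR]
  whiskerRight_comp _ _ _ := by ext x; simp [whiskerR]
  whisker_assoc _ _ _ _ _ := by ext x; simp [whiskerL, whiskerR]
  whisker_exchange α β := by ext x; simp [whiskerL, whiskerR]
  pentagon _ _ _ _ := by ext x; simp [whiskerL, whiskerR]
  triangle _ _ := by ext x; simp [whiskerL, whiskerR]

@[simp] lemma whiskerLeft_nat_app {S T V : ParGrpd} (u : S ⟶ T) {v w : T ⟶ V} (α : v ⟶ w) (x : S) :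
    (Hom₂.nat (u ◁ α)).app x = (Hom₂.nat α).app (u.functor.obj x) := rfl
@[simp] lemma whiskerRight_nat_app {S T V : ParGrpd} {u v : S ⟶ T} (α : u ⟶ v) (w : T ⟶ V)
    (x : S) : (Hom₂.nat (α ▷ w)).app x = w.functor.map ((Hom₂.nat α).app x) := rfl
@[simp] lemma associator_hom_nat_app {S T V W : ParGrpd} (u : S ⟶ T) (v : T ⟶ V) (w : V ⟶ W)
    (x : S) : (Hom₂.nat (α_ u v w).hom).app x = 𝟙 _ := rfl
@[simp] lemma associator_inv_nat_app {S T V W : ParGrpd} (u : S ⟶ T) (v : T ⟶ V) (w : V ⟶ W)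
    (x : S) : (Hom₂.nat (α_ u v w).inv).app x = 𝟙 _ := rfl

end ParGrpd

open CategoryTheory.Limits

/-- A span in a bicategory. -/
structure HSpan {B : Type*} [Bicategory B] (X Y : B) where
  apex : B
  left : apex ⟶ X
  right : apex ⟶ Y

/-- Two spans between parity groupoids over `BO(1)` are equivalent if there is an equivalence
between their apices (over `BO(1)`) compatible with the legs up to (invertible) 2-cells. -/
def HSpan.Equivalent {S T : ParGrpd} (M N : HSpan S T) : Prop :=
  ∃ u : M.apex ⟶ N.apex, u.functor.IsEquivalence ∧
    Nonempty (M.left ≅ u ≫ N.left) ∧ Nonempty (M.right ≅ u ≫ N.right)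

namespace ParGrpd

lemma parity_mul_parity {T : ParGrpd} {x y : T} (f : x ≅ y) :
    T.parity f.hom * T.parity f.inv = 1 := by
  rw [← parity_comp]; simp

/-- An equivalence over `BO(1)` has an inverse over `BO(1)`. -/
lemma exists_inverse {S T : ParGrpd} (u : S ⟶ T) [u.functor.IsEquivalence] :
    ∃ v : T ⟶ S, v.functor.IsEquivalence ∧ Nonempty (v ≫ u ≅ 𝟙 T) := by
  let e := u.functor.asEquivalence
  let v : T ⟶ S := Hom.mk' (S := T) (T := S) e.inverse
    (fun y => T.parity (e.counit.app y) * u.sgn (e.inverse.obj y)) (by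
      intro x y a
      have h1 := u.sgn_nat (e.inverse.map a)
      have h2 := congrArg T.parity (e.counit.naturality a)
      simp only [parity_comp] at h2
      have h3 : T.parity (u.functor.map (e.inverse.map a)) * T.parity (e.counit.app y)
        = T.parity (e.counit.app x) * T.parity a := h2
      have h4 : S.parity (e.inverse.map a) = u.sgn (e.inverse.obj x) *
          T.parity (u.functor.map (e.inverse.map a)) * u.sgn (e.inverse.obj y) := by
        rw [← h1, mul_assoc, Int.units_mul_self, mul_one]
      have h5 : T.parity (u.functor.map (e.inverse.map a)) =
          T.parity (e.counit.app x) * T.parity a * T.parity (e.counit.app y) := by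
        rw [← h3, mul_assoc, Int.units_mul_self, mul_one]
      rw [h4, h5]
      have k1 := Int.units_mul_self (T.parity (e.counit.app x))
      have k2 := Int.units_mul_self (u.sgn (e.inverse.obj x))
      calc T.parity a * (T.parity (e.counit.app y) * u.sgn (e.inverse.obj y))
          = (T.parity (e.counit.app x) * T.parity (e.counit.app x)) *
            (u.sgn (e.inverse.obj x) * u.sgn (e.inverse.obj x)) *
            (T.parity a * (T.parity (e.counit.app y) * u.sgn (e.inverse.obj y))) := by
              rw [k1, k2]; simp
        _ = _ := by
              simp only [mul_assoc, mul_comm, mul_left_comm])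
  refine ⟨v, inferInstanceAs e.inverse.IsEquivalence, ⟨isoMk (u := v ≫ u) (v := 𝟙 T) e.counitIso ?_⟩⟩
  intro x
  have k2 := Int.units_mul_self (u.sgn (e.inverse.obj x))
  have k1 := Int.units_mul_self (T.parity (e.counit.app x))
  have : (v ≫ u).sgn x = T.parity (e.counit.app x) := by
    simp only [comp_sgn]
    change T.parity (e.counit.app x) * u.sgn (e.inverse.obj x) * u.sgn (e.inverse.obj x) = _
    rw [mul_assoc, k2, mul_one]
  rw [this]
  exact k1.symm

end ParGrpd

namespace HSpan

variable {S T V W : ParGrpd}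

lemma Equivalent.refl (M : HSpan S T) : M.Equivalent M :=
  ⟨𝟙 _, inferInstanceAs (𝟭 _).IsEquivalence, ⟨(λ_ _).symm⟩, ⟨(λ_ _).symm⟩⟩

lemma Equivalent.symm {M N : HSpan S T} : M.Equivalent N → N.Equivalent M := by
  rintro ⟨u, hu, ⟨l⟩, ⟨r⟩⟩
  obtain ⟨v, hv, ⟨e⟩⟩ := ParGrpd.exists_inverse u
  exact ⟨v, hv,
    ⟨(λ_ _).symm ≪≫ Bicategory.whiskerRightIso e.symm _ ≪≫ α_ _ _ _ ≪≫
      Bicategory.whiskerLeftIso v l.symm⟩,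
    ⟨(λ_ _).symm ≪≫ Bicategory.whiskerRightIso e.symm _ ≪≫ α_ _ _ _ ≪≫
      Bicategory.whiskerLeftIso v r.symm⟩⟩

lemma Equivalent.trans {M N K : HSpan S T} :
    M.Equivalent N → N.Equivalent K → M.Equivalent K := by
  rintro ⟨u, hu, ⟨l⟩, ⟨r⟩⟩ ⟨v, hv, ⟨l'⟩, ⟨r'⟩⟩
  exact ⟨u ≫ v, inferInstanceAs (u.functor ⋙ v.functor).IsEquivalence,
    ⟨l ≪≫ Bicategory.whiskerLeftIso u l' ≪≫ (α_ _ _ _).symm⟩,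
    ⟨r ≪≫ Bicategory.whiskerLeftIso u r' ≪≫ (α_ _ _ _).symm⟩⟩

lemma Equivalent.of_iso {R S T : ParGrpd} {l l' : R ⟶ S} {r r' : R ⟶ T} (a : l ≅ l')
    (b : r ≅ r') : (⟨R, l, r⟩ : HSpan S T).Equivalent ⟨R, l', r'⟩ :=
  ⟨𝟙 _, inferInstanceAs (𝟭 _).IsEquivalence, ⟨a ≪≫ (λ_ _).symm⟩, ⟨b ≪≫ (λ_ _).symm⟩⟩

/-- The identity span. -/
def ident (S : ParGrpd) : HSpan S S := ⟨S, 𝟙 S, 𝟙 S⟩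

/-- The span `S = S → T` associated to a morphism of parity structures. -/
def graph (u : S ⟶ T) : HSpan S T := ⟨S, 𝟙 S, u⟩

end HSpan

section Pullback

variable {A B C : Type} [Groupoid.{0} A] [Groupoid.{0} B] [Groupoid.{0} C]
  (f : A ⥤ C) (g : B ⥤ C)

instance : Groupoid.{0} (CategoricalPullback f g) where
  inv {x y} a :=
    { fst := inv a.fst
      snd := inv a.snd
      w := by
        have h := a.w
        simp only [Functor.map_inv]
        rw [IsIso.inv_comp_eq, ← Category.assoc, h, Category.assoc, IsIso.hom_inv_id,
          Category.comp_id] }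
  inv_comp _ := by ext <;> simp
  comp_inv _ := by ext <;> simp

instance [hA : FiniteGroupoid A] [hB : FiniteGroupoid B] [hC : FiniteGroupoid C] :
    FiniteGroupoid (CategoricalPullback f g) where
  finite_pi0 := by
    let := isIsomorphicSetoid A
    let := isIsomorphicSetoid B
    have := hA.finite_pi0
    have := hB.finite_pi0
    have := hC.finite_hom
    let φ : (Σ (a : Pi0 A) (b : Pi0 B), f.obj a.out ⟶ g.obj b.out) →
        Pi0 (CategoricalPullback f g) :=
      fun t => Quotient.mk _ ⟨t.1.out, t.2.1.out, asIso t.2.2⟩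
    refine Finite.of_surjective φ ?_
    intro q
    induction q using Quotient.inductionOn with
    | h x =>
      obtain ⟨i⟩ := Quotient.mk_out (s := isIsomorphicSetoid A) x.fst
      obtain ⟨j⟩ := Quotient.mk_out (s := isIsomorphicSetoid B) x.snd
      refine ⟨⟨Quotient.mk _ x.fst, Quotient.mk _ x.snd,
        f.map i.hom ≫ x.iso.hom ≫ g.map j.inv⟩, Quotient.sound ⟨?_⟩⟩
      exact CategoricalPullback.mkIso i j (by simp [← Functor.map_comp])
  finite_hom x y := by
    have := hA.finite_hom x.fst y.fst
    have := hB.finite_hom x.snd y.snd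
    refine Finite.of_injective (β := (x.fst ⟶ y.fst) × (x.snd ⟶ y.snd))
      (fun a => (a.fst, a.snd)) ?_
    intro a b h
    simp only [Prod.mk.injEq] at h
    exact CategoricalPullback.hom_ext h.1 h.2

end Pullback

namespace ParGrpd

variable {A B C R : ParGrpd}

/-- The homotopy pullback of parity groupoids; its parity structure is inherited from the first
factor. -/
def hpullback (f : A ⟶ C) (g : B ⟶ C) : ParGrpd where
  carrier := CategoricalPullback f.functor g.functor
  par := CategoricalPullback.π₁ f.functor g.functor ⋙ A.par

/-- The first projection. -/
def hfst (f : A ⟶ C) (g : B ⟶ C) : hpullback f g ⟶ A :=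
  Hom.mk' (S := hpullback f g) (T := A) (CategoricalPullback.π₁ f.functor g.functor)
    (fun _ => 1) (by intro x y a; rw [mul_one, one_mul]; rfl)

/-- The second projection, with the homotopy over `BO(1)` obtained by passing along the
structural isomorphisms of the homotopy pullback. -/
def hsnd (f : A ⟶ C) (g : B ⟶ C) : hpullback f g ⟶ B :=
  Hom.mk' (S := hpullback f g) (T := B) (CategoricalPullback.π₂ f.functor g.functor)
    (fun x => f.sgn x.fst * C.parity x.iso.hom * (g.sgn x.snd)⁻¹) (by
      intro x y a
      have h1 := f.sgn_nat a.fst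
      have h2 := g.sgn_nat a.snd
      have h3 := congrArg C.parity a.w
      simp only [parity_comp] at h3
      change A.parity a.fst * _ = _ * B.parity a.snd
      rw [← mul_assoc, ← mul_assoc, h1, mul_assoc (f.sgn x.fst), h3, mul_inv_eq_iff_eq_mul]
      have k := Int.units_mul_self (g.sgn x.snd)
      rw [mul_assoc (_ * _), h2, Int.units_inv_eq_self]
      rw [mul_assoc (_ * _) (g.sgn x.snd), ← mul_assoc (g.sgn x.snd) (g.sgn x.snd), k, one_mul,
        mul_assoc])

/-- The canonical 2-cell of the homotopy pullback square. -/
def hcell (f : A ⟶ C) (g : B ⟶ C) : hfst f g ≫ f ≅ hsnd f g ≫ g :=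
  isoMk (u := hfst f g ≫ f) (v := hsnd f g ≫ g)
    (NatIso.ofComponents (fun x => CategoricalPullback.iso x) (fun a => CategoricalPullback.Hom.w a))
    (by
      intro x
      rw [comp_sgn, comp_sgn]
      change f.sgn x.fst * C.parity x.iso.hom * (g.sgn x.snd)⁻¹ * g.sgn x.snd =
        1 * f.sgn x.fst * C.parity x.iso.hom
      rw [inv_mul_cancel_right, one_mul])

/-- The comparison functor from the corner of a square commuting up to a 2-cell to the
homotopy pullback. -/
def comparison {f : A ⟶ C} {g : B ⟶ C} {p : R ⟶ A} {q : R ⟶ B} (κ : p ≫ f ≅ q ≫ g) :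
    R ⥤ CategoricalPullback f.functor g.functor where
  obj x := ⟨p.functor.obj x, q.functor.obj x,
    { hom := (Hom₂.nat κ.hom).app x
      inv := (Hom₂.nat κ.inv).app x
      hom_inv_id := congrArg (fun t => (Hom₂.nat t).app x) κ.hom_inv_id
      inv_hom_id := congrArg (fun t => (Hom₂.nat t).app x) κ.inv_hom_id }⟩
  map a := ⟨p.functor.map a, q.functor.map a, (Hom₂.nat κ.hom).naturality a⟩

/-- The morphism to the homotopy pullback induced by a square commuting up to a 2-cell. -/
def hlift {f : A ⟶ C} {g : B ⟶ C} {p : R ⟶ A} {q : R ⟶ B} (κ : p ≫ f ≅ q ≫ g) :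
    R ⟶ hpullback f g :=
  Hom.mk' (S := R) (T := hpullback f g) (comparison κ) p.sgn (fun a => p.sgn_nat a)

def hlift_fst {f : A ⟶ C} {g : B ⟶ C} {p : R ⟶ A} {q : R ⟶ B} (κ : p ≫ f ≅ q ≫ g) :
    hlift κ ≫ hfst f g ≅ p :=
  isoMk (u := hlift κ ≫ hfst f g) (v := p) (Iso.refl _) (by
    intro x
    rw [comp_sgn]
    change p.sgn x = p.sgn x * 1 * A.parity (𝟙 _)
    rw [parity_id, mul_one, mul_one])

def hlift_snd {f : A ⟶ C} {g : B ⟶ C} {p : R ⟶ A} {q : R ⟶ B} (κ : p ≫ f ≅ q ≫ g) :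
    hlift κ ≫ hsnd f g ≅ q :=
  isoMk (u := hlift κ ≫ hsnd f g) (v := q) (Iso.refl _) (by
    intro x
    have h := Hom₂.sgn_eq κ.hom x
    rw [comp_sgn, comp_sgn] at h
    rw [comp_sgn]
    change q.sgn x = p.sgn x * (f.sgn (p.functor.obj x) *
      C.parity ((Hom₂.nat κ.hom).app x) * (g.sgn (q.functor.obj x))⁻¹) * B.parity (𝟙 _)
    rw [parity_id, mul_one, ← mul_assoc, eq_mul_inv_iff_mul_eq, h, mul_assoc])

/-- A square commuting up to an invertible 2-cell is a homotopy pullback. -/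
def IsHPullback {f : A ⟶ C} {g : B ⟶ C} {p : R ⟶ A} {q : R ⟶ B} (κ : p ≫ f ≅ q ≫ g) : Prop :=
  (comparison κ).IsEquivalence

lemma IsHPullback.intro {f : A ⟶ C} {g : B ⟶ C} {p : R ⟶ A} {q : R ⟶ B} (κ : p ≫ f ≅ q ≫ g)
    (K : ∀ x : R, f.functor.obj (p.functor.obj x) ⟶ g.functor.obj (q.functor.obj x))
    (hK : ∀ x, (Hom₂.nat κ.hom).app x = K x)
    (faithful : ∀ (x y : R) (a b : x ⟶ y), p.functor.map a = p.functor.map b →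
      q.functor.map a = q.functor.map b → a = b)
    (full : ∀ (x y : R) (s : p.functor.obj x ⟶ p.functor.obj y)
      (t : q.functor.obj x ⟶ q.functor.obj y),
      f.functor.map s ≫ K y = K x ≫ g.functor.map t →
        ∃ a : x ⟶ y, p.functor.map a = s ∧ q.functor.map a = t)
    (essSurj : ∀ (m : A) (n : B) (φ : f.functor.obj m ⟶ g.functor.obj n),
      ∃ (x : R) (i : p.functor.obj x ⟶ m) (j : q.functor.obj x ⟶ n),
        f.functor.map i ≫ φ = K x ≫ g.functor.map j) : IsHPullback κ := by
  refine @Functor.IsEquivalence.mk _ _ _ _ _ ⟨?_⟩ ⟨?_⟩ ⟨?_⟩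
  · intro x y a b hab
    exact faithful x y a b (congrArg CategoricalPullback.Hom.fst hab)
      (congrArg CategoricalPullback.Hom.snd hab)
  · intro x y a
    have w : f.functor.map a.fst ≫ (Hom₂.nat κ.hom).app y =
      (Hom₂.nat κ.hom).app x ≫ g.functor.map a.snd := a.w
    have w' : f.functor.map a.fst ≫ K y = K x ≫ g.functor.map a.snd :=
      (congrArg (fun t => f.functor.map a.fst ≫ t) (hK y)).symm.trans
        (w.trans (congrArg (fun t => t ≫ g.functor.map a.snd) (hK x)))
    obtain ⟨b, h1, h2⟩ := full x y a.fst a.snd w'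
    exact ⟨b, CategoricalPullback.hom_ext h1 h2⟩
  · intro y
    obtain ⟨x, i, j, h⟩ := essSurj y.fst y.snd y.iso.hom
    exact ⟨x, ⟨CategoricalPullback.mkIso (isoOf i) (isoOf j)
      (h.trans (congrArg (fun t => t ≫ g.functor.map j) (hK x)).symm)⟩⟩

end ParGrpd

open ParGrpd

namespace HSpan

variable {S T V W : ParGrpd}

/-- Composition of spans by homotopy pullback. -/
def comp (M : HSpan S T) (N : HSpan T V) : HSpan S V where
  apex := hpullback M.right N.left
  left := hfst M.right N.left ≫ M.left
  right := hsnd M.right N.left ≫ N.right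

lemma comp_unique (M : HSpan S T) (N : HSpan T V) {R : ParGrpd} (p : R ⟶ M.apex)
    (q : R ⟶ N.apex) (κ : p ≫ M.right ≅ q ≫ N.left) (h : IsHPullback κ) :
    (⟨R, p ≫ M.left, q ≫ N.right⟩ : HSpan S V).Equivalent (M.comp N) :=
  ⟨hlift κ, h,
    ⟨Bicategory.whiskerRightIso (hlift_fst κ).symm _ ≪≫ α_ _ _ _⟩,
    ⟨Bicategory.whiskerRightIso (hlift_snd κ).symm _ ≪≫ α_ _ _ _⟩⟩

lemma comp_congr {M M' : HSpan S T} {N N' : HSpan T V} :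
    M.Equivalent M' → N.Equivalent N' → (M.comp N).Equivalent (M'.comp N') := by
  rintro ⟨u, hu, ⟨l⟩, ⟨r⟩⟩ ⟨v, hv, ⟨l'⟩, ⟨r'⟩⟩
  let κ : (hfst M.right N.left ≫ u) ≫ M'.right ≅ (hsnd M.right N.left ≫ v) ≫ N'.left :=
    α_ _ _ _ ≪≫ Bicategory.whiskerLeftIso _ r.symm ≪≫ hcell _ _ ≪≫
      Bicategory.whiskerLeftIso _ l' ≪≫ (α_ _ _ _).symm
  have hκ : ∀ x, (Hom₂.nat κ.hom).app x = (Hom₂.nat r.inv).app x.fst ≫ x.iso.hom ≫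
      (Hom₂.nat l'.hom).app x.snd := by
    intro x; simp [κ]; rfl
  have full : ∀ (x y : CategoricalPullback M.right.functor N.left.functor)
      (s : u.functor.obj x.fst ⟶ u.functor.obj y.fst)
      (t : v.functor.obj x.snd ⟶ v.functor.obj y.snd),
      M'.right.functor.map s ≫ (Hom₂.nat r.inv).app y.fst ≫ y.iso.hom ≫
          (Hom₂.nat l'.hom).app y.snd =
        ((Hom₂.nat r.inv).app x.fst ≫ x.iso.hom ≫ (Hom₂.nat l'.hom).app x.snd) ≫
          N'.left.functor.map t →
      ∃ a : x ⟶ y, u.functor.map a.fst = s ∧ v.functor.map a.snd = t := by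
    intro x y s t w
    obtain ⟨a1, rfl⟩ := u.functor.map_surjective s
    obtain ⟨a2, rfl⟩ := v.functor.map_surjective t
    have n1 : M'.right.functor.map (u.functor.map a1) ≫ (Hom₂.nat r.inv).app y.fst =
      (Hom₂.nat r.inv).app x.fst ≫ M.right.functor.map a1 := (Hom₂.nat r.inv).naturality a1
    have n2 : N.left.functor.map a2 ≫ (Hom₂.nat l'.hom).app y.snd =
      (Hom₂.nat l'.hom).app x.snd ≫ N'.left.functor.map (v.functor.map a2) :=
        (Hom₂.nat l'.hom).naturality a2
    have w1 : (Hom₂.nat r.inv).app x.fst ≫ (M.right.functor.map a1 ≫ y.iso.hom) ≫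
          (Hom₂.nat l'.hom).app y.snd =
        (Hom₂.nat r.inv).app x.fst ≫ (x.iso.hom ≫ N.left.functor.map a2) ≫
          (Hom₂.nat l'.hom).app y.snd := by
      calc _ = ((Hom₂.nat r.inv).app x.fst ≫ M.right.functor.map a1) ≫ y.iso.hom ≫
          (Hom₂.nat l'.hom).app y.snd := by simp only [Category.assoc]
        _ = _ := by rw [← n1, Category.assoc]
        _ = _ := w
        _ = (Hom₂.nat r.inv).app x.fst ≫ x.iso.hom ≫ ((Hom₂.nat l'.hom).app x.snd ≫
          N'.left.functor.map (v.functor.map a2)) := by simp only [Category.assoc]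
        _ = _ := by rw [← n2]; simp only [Category.assoc]
    have w2 := (cancel_epi _).1 w1
    exact ⟨⟨a1, a2, (cancel_mono _).1 w2⟩, rfl, rfl⟩
  have essSurj : ∀ (m' : M'.apex) (n' : N'.apex)
      (φ : M'.right.functor.obj m' ⟶ N'.left.functor.obj n'),
      ∃ (x : CategoricalPullback M.right.functor N.left.functor)
        (i : u.functor.obj x.fst ⟶ m') (j : v.functor.obj x.snd ⟶ n'),
        M'.right.functor.map i ≫ φ = ((Hom₂.nat r.inv).app x.fst ≫ x.iso.hom ≫
          (Hom₂.nat l'.hom).app x.snd) ≫ N'.left.functor.map j := by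
    intro m' n' φ
    let i := u.functor.objObjPreimageIso m'
    let j := v.functor.objObjPreimageIso n'
    let m := u.functor.objPreimage m'
    let n := v.functor.objPreimage n'
    let A : M.right.functor.obj m ⟶ M'.right.functor.obj (u.functor.obj m) :=
      (Hom₂.nat r.hom).app m
    let A' : M'.right.functor.obj (u.functor.obj m) ⟶ M.right.functor.obj m :=
      (Hom₂.nat r.inv).app m
    let D : N.left.functor.obj n ⟶ N'.left.functor.obj (v.functor.obj n) :=
      (Hom₂.nat l'.hom).app n
    let D' : N'.left.functor.obj (v.functor.obj n) ⟶ N.left.functor.obj n :=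
      (Hom₂.nat l'.inv).app n
    have e1 : A' ≫ A = 𝟙 _ := congrArg (fun t => (Hom₂.nat t).app m) r.inv_hom_id
    have e2 : D' ≫ D = 𝟙 _ := congrArg (fun t => (Hom₂.nat t).app n) l'.inv_hom_id
    refine ⟨⟨m, n, asIso (A ≫ M'.right.functor.map i.hom ≫ φ ≫
          N'.left.functor.map j.inv ≫ D')⟩, i.hom, j.hom, ?_⟩
    change _ = (A' ≫ (A ≫ M'.right.functor.map i.hom ≫ φ ≫ N'.left.functor.map j.inv ≫ D') ≫ D) ≫
      N'.left.functor.map j.hom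
    simp only [Category.assoc]
    rw [reassoc_of% e1, reassoc_of% e2, ← Functor.map_comp, Iso.inv_hom_id,
      CategoryTheory.Functor.map_id, Category.comp_id]
  have h : IsHPullback κ := IsHPullback.intro κ _ hκ
    (fun x y a b h1 h2 => CategoricalPullback.hom_ext (u.functor.map_injective h1)
      (v.functor.map_injective h2)) full essSurj
  exact (Equivalent.of_iso
    (Bicategory.whiskerLeftIso _ l ≪≫ (α_ _ _ _).symm)
    (Bicategory.whiskerLeftIso _ r' ≪≫ (α_ _ _ _).symm)).trans (comp_unique M' N' _ _ κ h)

lemma graph_comp_equiv (u : S ⟶ T) (N : HSpan T V) {R : ParGrpd} (p : R ⟶ S)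
    (q : R ⟶ N.apex) (κ : p ≫ u ≅ q ≫ N.left) (h : IsHPullback κ) :
    (⟨R, p, q ≫ N.right⟩ : HSpan S V).Equivalent ((graph u).comp N) :=
  (Equivalent.of_iso (ρ_ p).symm (Iso.refl _)).trans (comp_unique (graph u) N p q κ h)

lemma isHPullback_of_right {R A C : ParGrpd} {f : A ⟶ C} {q : R ⟶ C}
    {p : R ⟶ A} (κ : p ≫ f ≅ q ≫ 𝟙 C) (hp : p.functor.IsEquivalence) : IsHPullback κ := by
  let K : ∀ x : R, f.functor.obj (p.functor.obj x) ⟶ q.functor.obj x :=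
    fun x => (Hom₂.nat κ.hom).app x
  have nK : ∀ {x y : R} (a : x ⟶ y), f.functor.map (p.functor.map a) ≫ K y =
    K x ≫ q.functor.map a := fun a => (Hom₂.nat κ.hom).naturality a
  refine IsHPullback.intro κ K (fun _ => rfl) (fun x y a b h _ => p.functor.map_injective h) ?_ ?_
  · intro x y s t w
    obtain ⟨a, rfl⟩ := p.functor.map_surjective s
    exact ⟨a, rfl, (cancel_epi _).1 ((nK a).symm.trans w)⟩
  · intro m n φ
    let i := p.functor.objObjPreimageIso m
    refine ⟨p.functor.objPreimage m, i.hom, inv (K _) ≫ f.functor.map i.hom ≫ φ, ?_⟩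
    exact (IsIso.hom_inv_id_assoc (K _) (f.functor.map i.hom ≫ φ)).symm

lemma isHPullback_of_left {R A B C : ParGrpd} {f : A ⟶ C} {g : B ⟶ C} {p : R ⟶ A}
    {q : R ⟶ B} (κ : p ≫ f ≅ q ≫ g) (hf : f.functor.IsEquivalence)
    (hq : q.functor.IsEquivalence) : IsHPullback κ := by
  let K : ∀ x : R, f.functor.obj (p.functor.obj x) ⟶ g.functor.obj (q.functor.obj x) :=
    fun x => (Hom₂.nat κ.hom).app x
  have nK : ∀ {x y : R} (a : x ⟶ y), f.functor.map (p.functor.map a) ≫ K y =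
    K x ≫ g.functor.map (q.functor.map a) := fun a => (Hom₂.nat κ.hom).naturality a
  refine IsHPullback.intro κ K (fun _ => rfl) (fun x y a b _ h => q.functor.map_injective h) ?_ ?_
  · intro x y s t w
    obtain ⟨a, rfl⟩ := q.functor.map_surjective t
    exact ⟨a, f.functor.map_injective ((cancel_mono _).1 ((nK a).trans w.symm)), rfl⟩
  · intro m n φ
    let j := q.functor.objObjPreimageIso n
    obtain ⟨i, hi⟩ := f.functor.map_surjective (K _ ≫ g.functor.map j.hom ≫ inv φ)
    refine ⟨q.functor.objPreimage n, i, j.hom, ?_⟩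
    rw [hi]
    simp only [Category.assoc, IsIso.inv_hom_id, Category.comp_id]

lemma ident_comp (M : HSpan S T) : ((ident S).comp M).Equivalent M := by
  let κ : M.left ≫ (ident S).right ≅ 𝟙 M.apex ≫ M.left := ρ_ _ ≪≫ (λ_ _).symm
  exact ((Equivalent.of_iso (ρ_ _).symm (λ_ _).symm).trans
    (comp_unique (ident S) M M.left (𝟙 _) κ
      (isHPullback_of_left κ (inferInstanceAs (𝟭 _).IsEquivalence)
        (inferInstanceAs (𝟭 _).IsEquivalence)))).symm

lemma comp_ident (M : HSpan S T) : (M.comp (ident T)).Equivalent M := by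
  let κ : 𝟙 M.apex ≫ M.right ≅ M.right ≫ (ident T).left := λ_ _ ≪≫ (ρ_ _).symm
  exact ((Equivalent.of_iso (λ_ _).symm (ρ_ _).symm).trans
    (comp_unique M (ident T) (𝟙 _) M.right κ
      (isHPullback_of_right κ (inferInstanceAs (𝟭 _).IsEquivalence)))).symm

lemma comp_assoc (M : HSpan S T) (N : HSpan T V) (K : HSpan V W) :
    ((M.comp N).comp K).Equivalent (M.comp (N.comp K)) := by
  let a := hfst (M.comp N).right K.left
  let b := hsnd (M.comp N).right K.left
  let c := hfst M.right N.left
  let d := hsnd M.right N.left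
  let κ' : (a ≫ d) ≫ N.right ≅ b ≫ K.left := α_ _ _ _ ≪≫ hcell (M.comp N).right K.left
  let κ : (a ≫ c) ≫ M.right ≅ hlift κ' ≫ (N.comp K).left :=
    α_ _ _ _ ≪≫ Bicategory.whiskerLeftIso a (hcell M.right N.left) ≪≫ (α_ _ _ _).symm ≪≫
      Bicategory.whiskerRightIso (hlift_fst κ').symm _ ≪≫ α_ _ _ _
  have hκ' : ∀ x, (Hom₂.nat κ'.hom).app x = x.iso.hom := fun x => Category.id_comp x.iso.hom
  have hκ : ∀ x, (Hom₂.nat κ.hom).app x = x.fst.iso.hom := by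
    intro x
    have : 𝟙 _ ≫ x.fst.iso.hom ≫ 𝟙 _ ≫ N.left.functor.map (𝟙 x.fst.snd) ≫ 𝟙 _ = x.fst.iso.hom := by
      simp
    exact this
  have h : IsHPullback κ := by
    refine IsHPullback.intro κ _ hκ ?_ ?_ ?_
    · intro x y f g h1 h2
      have h3 := congrArg (fun t : (hlift κ').functor.obj x ⟶ (hlift κ').functor.obj y =>
        CategoricalPullback.Hom.fst t) h2
      have h4 := congrArg (fun t : (hlift κ').functor.obj x ⟶ (hlift κ').functor.obj y =>
        CategoricalPullback.Hom.snd t) h2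
      exact CategoricalPullback.hom_ext (CategoricalPullback.hom_ext h1 h3) h4
    · intro x y s t w1
      have w2 : N.right.functor.map t.fst ≫ (Hom₂.nat κ'.hom).app y =
        (Hom₂.nat κ'.hom).app x ≫ K.left.functor.map t.snd := t.w
      have w3 := (congrArg (fun z => N.right.functor.map t.fst ≫ z) (hκ' y)).symm.trans
        (w2.trans (congrArg (fun z => z ≫ K.left.functor.map t.snd) (hκ' x)))
      exact ⟨⟨⟨s, t.fst, w1⟩, t.snd, w3⟩, rfl, rfl⟩
    · intro m n φ
      let x : CategoricalPullback (M.comp N).right.functor K.left.functor :=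
        ⟨⟨m, n.fst, isoOf φ⟩, n.snd, n.iso⟩
      have hx : N.right.functor.map (𝟙 _) ≫ n.iso.hom =
          (Hom₂.nat κ'.hom).app x ≫ K.left.functor.map (𝟙 _) := by
        refine Eq.trans ?_ (congrArg (fun z => z ≫ K.left.functor.map (𝟙 n.snd)) (hκ' x)).symm
        change N.right.functor.map (𝟙 _) ≫ n.iso.hom = n.iso.hom ≫ K.left.functor.map (𝟙 _)
        rw [CategoryTheory.Functor.map_id, CategoryTheory.Functor.map_id, Category.id_comp,
          Category.comp_id]
      let j : (hlift κ').functor.obj x ⟶ n := CategoricalPullback.Hom.mk (𝟙 n.fst) (𝟙 n.snd) hx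
      refine ⟨x, 𝟙 m, j, ?_⟩
      let φ' : M.right.functor.obj m ⟶ N.left.functor.obj n.fst := φ
      have : M.right.functor.map (𝟙 m) ≫ φ' = φ' ≫ N.left.functor.map (𝟙 n.fst) := by simp
      exact this
  exact (Equivalent.of_iso (α_ _ _ _).symm
    (Bicategory.whiskerRightIso (hlift_snd κ').symm _ ≪≫ α_ _ _ _)).trans
    (comp_unique M (N.comp K) _ _ κ h)

instance setoid (S T : ParGrpd) : Setoid (HSpan S T) where
  r := Equivalent
  iseqv := ⟨Equivalent.refl, Equivalent.symm, Equivalent.trans⟩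

end HSpan

/-- The objects of `lin^±`: the slices of the 2-category of parity groupoids. -/
structure Lin where
  slice ::
  base : ParGrpd

namespace Lin

/-- The category `lin^±`: an object is (the slice over) a parity groupoid, a morphism is an
equivalence class of spans over `BO(1)`, and composition is by homotopy pullback. -/
instance : Category Lin where
  Hom X Y := Quotient (HSpan.setoid X.base Y.base)
  id X := Quotient.mk _ (HSpan.ident X.base)
  comp f g := Quotient.map₂ HSpan.comp (fun _ _ h _ _ h' => HSpan.comp_congr h h') f g
  id_comp f := Quotient.inductionOn f fun M => Quotient.sound (HSpan.ident_comp M)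
  comp_id f := Quotient.inductionOn f fun M => Quotient.sound (HSpan.comp_ident M)
  assoc f g h := Quotient.inductionOn₃ f g h fun M N K => Quotient.sound (HSpan.comp_assoc M N K)

/-- The morphism of `lin^±` represented by a span. -/
def ofSpan {S T : ParGrpd} (M : HSpan S T) : slice S ⟶ slice T := Quotient.mk _ M

lemma ofSpan_comp {S T V : ParGrpd} (M : HSpan S T) (N : HSpan T V) :
    ofSpan (M.comp N) = ofSpan M ≫ ofSpan N := rfl

/-- The morphism of `lin^±` given by a morphism of parity structures `S ⟶ T`, namely the
span `S = S ⟶ T`. -/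
def ofHom {S T : ParGrpd} (u : S ⟶ T) : slice S ⟶ slice T := ofSpan (HSpan.graph u)

lemma ofHom_id (S : ParGrpd) : ofHom (𝟙 S) = 𝟙 (slice S) := rfl

lemma ofHom_congr {S T : ParGrpd} {u v : S ⟶ T} (e : u ≅ v) : ofHom u = ofHom v :=
  Quotient.sound (HSpan.Equivalent.of_iso (Iso.refl _) e)

lemma ofHom_comp {S T V : ParGrpd} (u : S ⟶ T) (v : T ⟶ V) :
    ofHom (u ≫ v) = ofHom u ≫ ofHom v := by
  let κ : 𝟙 S ≫ u ≅ u ≫ 𝟙 T := λ_ _ ≪≫ (ρ_ _).symm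
  exact Quotient.sound (HSpan.graph_comp_equiv u (HSpan.graph v) (𝟙 S) u κ
    (HSpan.isHPullback_of_right κ (inferInstanceAs (𝟭 _).IsEquivalence)))

end Lin

/-! ### Homotopy sums -/

section HomotopySums

/-- The constant pseudofunctor. -/
def constPF (I : Type) [Category.{0} I] {B : Type*} [Bicategory B] (X : B) :
    Pseudofunctor (LocallyDiscrete I) B where
  obj _ := X
  map _ := 𝟙 X
  map₂ _ := 𝟙 _
  mapId _ := Iso.refl _
  mapComp _ _ := (λ_ _).symm

/-- The constant transformation between constant pseudofunctors. -/
def constTrans (I : Type) [Category.{0} I] {B : Type*} [Bicategory B] {X Y : B} (f : X ⟶ Y) :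
    constPF I X ⟶ constPF I Y where
  app _ := f
  naturality _ := λ_ f ≪≫ (ρ_ f).symm
  naturality_naturality _ := by
    have h : 𝟙 (𝟙 X) ▷ f ≫ (λ_ f ≪≫ (ρ_ f).symm).hom =
      (λ_ f ≪≫ (ρ_ f).symm).hom ≫ f ◁ 𝟙 (𝟙 Y) := by simp
    exact h
  naturality_id _ := by
    have h : (λ_ f ≪≫ (ρ_ f).symm).hom ≫ f ◁ 𝟙 (𝟙 Y) =
      𝟙 (𝟙 X) ▷ f ≫ (λ_ f).hom ≫ (ρ_ f).inv := by simp
    exact h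
  naturality_comp _ _ := by
    have h : (λ_ f ≪≫ (ρ_ f).symm).hom ≫ f ◁ (λ_ (𝟙 Y)).inv =
      (λ_ (𝟙 X)).inv ▷ f ≫ (α_ _ _ _).hom ≫ 𝟙 X ◁ (λ_ f ≪≫ (ρ_ f).symm).hom ≫
        (α_ _ _ _).inv ≫ (λ_ f ≪≫ (ρ_ f).symm).hom ▷ 𝟙 Y ≫ (α_ _ _ _).hom := by
      simp [Bicategory.unitors_inv_equal]
    exact h

lemma isEquivalence_map {I : Type} [Groupoid.{0} I]
    (D : Pseudofunctor (LocallyDiscrete I) ParGrpd) {i j : I} (a : i ⟶ j) :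
    (D.map a.toLoc).functor.IsEquivalence := by
  have key : ∀ {i j : I} (a : i ⟶ j) (b : j ⟶ i) (_ : a ≫ b = 𝟙 i),
      Nonempty ((D.map a.toLoc).functor ⋙ (D.map b.toLoc).functor ≅ 𝟭 _) := by
    intro i j a b h
    have e0 : a.toLoc ≫ b.toLoc = 𝟙 (LocallyDiscrete.mk i) := by
      apply Discrete.ext; exact h
    let e : D.map a.toLoc ≫ D.map b.toLoc ≅ 𝟙 (D.obj ⟨i⟩) :=
      (D.mapComp a.toLoc b.toLoc).symm ≪≫ D.map₂Iso (eqToIso e0) ≪≫ D.mapId ⟨i⟩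
    exact ⟨{ hom := Hom₂.nat e.hom
             inv := Hom₂.nat e.inv
             hom_inv_id := congrArg Hom₂.nat e.hom_inv_id
             inv_hom_id := congrArg Hom₂.nat e.inv_hom_id }⟩
  obtain ⟨e1⟩ := key a (inv a) (by simp)
  obtain ⟨e2⟩ := key (inv a) a (by simp)
  exact Functor.IsEquivalence.mk' (D.map (inv a).toLoc).functor e1.symm e2

variable {I : Type} [Groupoid.{0} I]

/-- A homotopy-coherent cocone in `lin^±` with vertex `X` under a diagram `D` indexed by a
groupoid `I`: a span of pseudofunctors from `D` to the constant diagram at `X`.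

A span is invertible exactly when both of its legs are equivalences, so a homotopy-coherent diagram
in `lin^±` indexed by a groupoid is the same as a diagram (pseudofunctor) of parity groupoids; and a
transformation between two such diagrams, with spans as components, is a span of pseudofunctors
(its naturality squares are homotopy pullbacks because the arrows of `I` are invertible). -/
abbrev HCocone (D : Pseudofunctor (LocallyDiscrete I) ParGrpd) (X : ParGrpd) :=
  HSpan D (constPF I X)

/-- The diagram in `lin^±` underlying a diagram of parity groupoids. -/
def linDiagram (D : Pseudofunctor (LocallyDiscrete I) ParGrpd) : I ⥤ Lin where
  obj i := Lin.slice (D.obj ⟨i⟩)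
  map a := Lin.ofHom (D.map a.toLoc)
  map_id i := Lin.ofHom_congr (D.mapId ⟨i⟩)
  map_comp a b := (Lin.ofHom_congr (D.mapComp a.toLoc b.toLoc)).trans (Lin.ofHom_comp _ _)

namespace HCocone

variable {D : Pseudofunctor (LocallyDiscrete I) ParGrpd} {X T : ParGrpd}

/-- The leg of a homotopy-coherent cocone at `i`. -/
def leg (c : HCocone D X) (i : I) : HSpan (D.obj ⟨i⟩) X :=
  ⟨c.apex.obj ⟨i⟩, c.left.app ⟨i⟩, c.right.app ⟨i⟩⟩

lemma leg_nat (c : HCocone D X) {i j : I} (a : i ⟶ j) :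
    Lin.ofHom (D.map a.toLoc) ≫ Lin.ofSpan (c.leg j) = Lin.ofSpan (c.leg i) := by
  let κ : c.left.app ⟨i⟩ ≫ D.map a.toLoc ≅ c.apex.map a.toLoc ≫ (c.leg j).left :=
    (c.left.naturality a.toLoc).symm
  have h : IsHPullback κ := HSpan.isHPullback_of_left κ (isEquivalence_map D a)
    (isEquivalence_map c.apex a)
  let ρ : c.apex.map a.toLoc ≫ (c.leg j).right ≅ c.right.app ⟨i⟩ :=
    c.right.naturality a.toLoc ≪≫ ρ_ (c.right.app ⟨i⟩)
  exact (Quotient.sound ((HSpan.Equivalent.of_iso (Iso.refl _) ρ.symm).trans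
    (HSpan.graph_comp_equiv _ (c.leg j) _ _ κ h))).symm

/-- The cocone in the category `lin^±` underlying a homotopy-coherent cocone. -/
def toCocone (c : HCocone D X) : Cocone (linDiagram D) where
  pt := Lin.slice X
  ι :=
    { app := fun i => Lin.ofSpan (c.leg i)
      naturality := fun _ _ a => (c.leg_nat a).trans (Category.comp_id _).symm }

/-- `IsComposite c N d` says that `d` is the composite of the homotopy-coherent cocone `c` with
vertex `X` and the span `N` from `X` to `T`: there is a square of pseudofunctors which is
pointwise a homotopy pullback and whose outer legs are those of `d`. -/
def IsComposite (c : HCocone D X) (N : HSpan X T) (d : HCocone D T) : Prop :=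
  ∃ (r : d.apex ⟶ c.apex) (s : d.apex ⟶ constPF I N.apex)
    (κ : r ≫ c.right ≅ s ≫ constTrans I N.left),
    Nonempty (r ≫ c.left ≅ d.left) ∧ Nonempty (s ≫ constTrans I N.right ≅ d.right) ∧
    ∀ i : I, IsHPullback (f := c.right.app ⟨i⟩) (g := N.left) (p := r.app ⟨i⟩) (q := s.app ⟨i⟩)
      { hom := κ.hom.as.app ⟨i⟩
        inv := κ.inv.as.app ⟨i⟩
        hom_inv_id := congrArg (fun t => t.as.app ⟨i⟩) κ.hom_inv_id
        inv_hom_id := congrArg (fun t => t.as.app ⟨i⟩) κ.inv_hom_id }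

/-- A homotopy-coherent cocone is a homotopy sum (homotopy colimit over the groupoid `I`) in
`lin^±` if every homotopy-coherent cocone in `lin^±` under the same diagram factors through it by
a span that is unique up to equivalence.

The coherence data (spans, maps of spans and 2-cells) is contained in the notion of cocone, so this
is not a colimit in the category `Lin` of equivalence classes of spans. Since homotopy colimits
over finite groupoids exist in `lin^±`, factorization that is unique up to equivalence determines
the cocone as the homotopy colimit. -/
def IsHomotopySum (c : HCocone D X) : Prop :=
  ∀ (T : ParGrpd) (d : HCocone D T),
    ∃! f : Lin.slice X ⟶ Lin.slice T, ∃ N : HSpan X T, Lin.ofSpan N = f ∧ c.IsComposite N d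

end HCocone

/-- A functor from `lin^±` to rational vector spaces preserves finite homotopy sums if it sends
homotopy sums indexed by finite groupoids to colimits. -/
def PreservesFiniteHomotopySums (F : Lin ⥤ ModuleCat.{0} ℚ) : Prop :=
  ∀ (I : Type) [Groupoid.{0} I] [FiniteGroupoid I]
    (D : Pseudofunctor (LocallyDiscrete I) ParGrpd) (X : ParGrpd) (c : HCocone D X),
    c.IsHomotopySum → Nonempty (IsColimit (F.mapCocone c.toCocone))

end HomotopySums

/-! ### The two functors on `BO(1)` -/

/-- The one-point groupoid. -/
instance : FiniteGroupoid (Discrete PUnit.{1}) where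
  finite_pi0 := inferInstance
  finite_hom _ _ := inferInstance

/-- The parity groupoid `e : 1 → BO(1)`. -/
def unitPar : ParGrpd where
  carrier := Discrete PUnit.{1}
  par := (Functor.const _).obj (SingleObj.star ℤˣ)

/-- The endomorphism of `e` over `BO(1)` whose 2-cell is the sign `t`. -/
def signHom (t : ℤˣ) : unitPar ⟶ unitPar :=
  Hom.mk' (S := unitPar) (T := unitPar) (𝟭 _) (fun _ => t) (by
    intro x y a; exact (one_mul t).trans (mul_one t).symm)

/-- The functor `BO(1) → lin^±` sending the point to the slice over `e` and the sign `±1` to the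
span `1 ← 1 → 1` with 2-cell `±1`. -/
def parityToLin : ParityGroupoid ⥤ Lin where
  obj _ := Lin.slice unitPar
  map t := Lin.ofHom (signHom t)
  map_id _ := rfl
  map_comp := by
    have key : ∀ t t' : ℤˣ, Lin.ofHom (signHom (t' * t)) =
        Lin.ofHom (signHom t) ≫ Lin.ofHom (signHom t') := by
      intro t t'
      rw [← Lin.ofHom_comp]
      apply Lin.ofHom_congr
      exact isoMk (u := signHom (t' * t)) (v := signHom t ≫ signHom t') (Iso.refl _) (by
        intro x
        rw [comp_sgn]
        change t * t' = t' * t * 1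
        rw [mul_one, mul_comm])
    intro _ _ _ t t'
    exact key t t'

/-- Multiplication by a sign on the one-dimensional vector space `ℚ`. -/
def signScalar (t : ℤˣ) : ModuleCat.of ℚ ℚ ⟶ ModuleCat.of ℚ ℚ :=
  ModuleCat.ofHom (((t : ℤ) : ℚ) • (LinearMap.id : ℚ →ₗ[ℚ] ℚ))

/-- The functor `BO(1) → vect` sending the point to `ℚ` and `±1` to `±Id`. -/
def parityToVect : ParityGroupoid ⥤ ModuleCat.{0} ℚ where
  obj _ := ModuleCat.of ℚ ℚ
  map t := signScalar t
  map_id _ := by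
    change signScalar 1 = _
    ext
    simp [signScalar]
  map_comp := by
    have key : ∀ t t' : ℤˣ, signScalar (t' * t) = signScalar t ≫ signScalar t' := by
      intro t t'
      ext
      simp [signScalar]
    intro _ _ _ t t'
    exact key t t'

/-! ### Cardinality -/

/-- The homotopy cardinality of a finite groupoid: the sum over its components of the reciprocals
of the orders of the automorphism groups. -/
def groupoidCard (G : Type) [Category.{0} G] : ℚ :=
  ∑ᶠ c : Pi0 G, (1 : ℚ) / Nat.card (Aut c.out)

/-- The sign of a point of a scalar (a span from `e` to `e`): the ratio of the two 2-cells. -/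
def scalarSign (M : HSpan unitPar unitPar) (x : M.apex) : ℤˣ :=
  (M.left.sgn x)⁻¹ * M.right.sgn x

/-- The cardinality of a scalar: the cardinality of its positive part minus the cardinality of
its negative part. -/
def scalarCard (M : HSpan unitPar unitPar) : ℚ :=
  groupoidCard (ObjectProperty.FullSubcategory fun x : M.apex => scalarSign M x = 1) -
  groupoidCard (ObjectProperty.FullSubcategory fun x : M.apex => scalarSign M x = -1)

/-- The name of a point, as a morphism of parity structures with trivial 2-cell. -/
def nameHom {S : ParGrpd} (s : S) : unitPar ⟶ S :=
  Hom.mk' (S := unitPar) (T := S) ((Functor.const _).obj s) (fun _ => 1) (by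
    intro x y a
    exact (one_mul (1 : ℤˣ)).trans ((one_mul _).trans (S.parity_id s)).symm)

/-- The elementary state `1 = 1 → S` at a point `s`. -/
def nameSpan {S : ParGrpd} (s : S) : HSpan unitPar S := ⟨unitPar, 𝟙 _, nameHom s⟩

/-- The elementary costate `S ← 1 = 1` at a point `s`. -/
def conameSpan {S : ParGrpd} (s : S) : HSpan S unitPar := ⟨unitPar, nameHom s, 𝟙 _⟩

/-- The two-sided fibre of a span, as a scalar. -/
def twoSidedFibre {S T : ParGrpd} (M : HSpan S T) (i : S) (j : T) : HSpan unitPar unitPar :=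
  (nameSpan i).comp (M.comp (conameSpan j))

/-- A point is orientable if it has no odd automorphisms. -/
def IsOrientable {S : ParGrpd} (s : S) : Prop := ∀ g : s ⟶ s, S.parity g = 1

/-- The set of orientable components. -/
def OrComp (S : ParGrpd) : Type :=
  {c : Pi0 S // ∀ s : S, Quotient.mk (isIsomorphicSetoid S) s = c → IsOrientable s}

instance (S : ParGrpd) : Finite (OrComp S) :=
  haveI : Finite (Pi0 S) := S.finite.finite_pi0
  Subtype.finite

/-- A choice of a point (hence of an elementary state) in each orientable component of each parity groupoid. -/
structure BasePoints where
  point : ∀ S : ParGrpd, OrComp S → S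
  mk_point : ∀ (S : ParGrpd) (c : OrComp S),
    Quotient.mk (isIsomorphicSetoid S) (point S c) = c.1

/-- The cardinality of (the slice over) a parity groupoid: the vector space with basis its
orientable components. -/
def cardObj (S : ParGrpd) : ModuleCat.{0} ℚ := ModuleCat.of ℚ (OrComp S →₀ ℚ)

namespace BasePoints

variable (b : BasePoints)

/-- The matrix entry of the cardinality of a span: the cardinality of the two-sided fibre divided
by the number of automorphisms of the target point. -/
def cardEntry {S T : ParGrpd} (M : HSpan S T) (i : OrComp S) (j : OrComp T) : ℚ :=
  scalarCard (twoSidedFibre M (b.point S i) (b.point T j)) / Nat.card (Aut (b.point T j))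

/-- The cardinality of a span: the linear map sending the basis vector of `i` to
`∑ j, cardEntry i j • (basis vector of j)`. -/
def cardMap {S T : ParGrpd} (M : HSpan S T) : cardObj S ⟶ cardObj T :=
  ModuleCat.ofHom (Finsupp.linearCombination ℚ
    fun i => Finsupp.equivFunOnFinite.symm fun j => b.cardEntry M i j)

/-- The cardinality assignment is well defined on equivalence classes of spans and functorial. -/
structure IsFunctorial : Prop where
  congr : ∀ {S T : ParGrpd} (M N : HSpan S T), M.Equivalent N → b.cardMap M = b.cardMap N
  map_id : ∀ S : ParGrpd, b.cardMap (HSpan.ident S) = 𝟙 (cardObj S)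
  map_comp : ∀ {S T V : ParGrpd} (M : HSpan S T) (N : HSpan T V),
    b.cardMap (M.comp N) = b.cardMap M ≫ b.cardMap N

/-- The cardinality functor from `lin^±` to rational vector spaces. -/
def cardFunctor (h : b.IsFunctorial) : Lin ⥤ ModuleCat.{0} ℚ where
  obj X := cardObj X.base
  map f := Quotient.lift (fun M => b.cardMap M) (fun M N e => h.congr M N e) f
  map_id X := h.map_id X.base
  map_comp f g := Quotient.inductionOn₂ f g fun M N => h.map_comp M N

end BasePoints

end

end SignedLinAlg

open SignedLinAlg

/-! The governing notion is that of an equivariant function on a parity groupoid `S`: its values at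
the two ends of an arrow differ by the parity of the arrow. Over `ℚ` such a function vanishes at
every non-orientable point, because an odd automorphism forces `w x = -w x`. It is therefore
determined freely by its values at the base points of the orientable components. Hence `cardObj S`
is the universal target of equivariant functions, the universal one being `vec` (`lift_vec`,
`linearMap_ext`).

Functoriality. A scalar has as cardinality the integral of its signs, and integrals over homotopy
pullbacks obey a Fubini rule (`gint_hpullback`). The entry of a span thus becomes an integral over
its apex of two signed kernels `shom`, one per leg (`scalarCard_twoSidedFibre`). These kernels
satisfy a Yoneda formula (`gint_shom`, `sum_shom`), and this turns composition of spans into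
multiplication of matrices (`lift_row_row`).

Preservation of sums. The homotopy sum of a diagram `D` is its Grothendieck construction `tot D`
(`isHomotopySum_sumCocone`). A compatible family of linear maps out of the spaces `cardObj (D i)` is
the same as one equivariant function on `tot D`, so cardinality turns this particular cocone into a
colimit. For an arbitrary homotopy sum, the uniqueness of factorizations exhibits its vertex as a
retract of `tot D` compatibly with the cocones, which suffices to transfer the colimit property.

Uniqueness. Every `S` is the homotopy sum, indexed by `S` itself, of copies of the unit on which
arrows act through their parities. A functor `F` preserving sums is therefore determined on objects
by its value at the unit and the action of signs, and an isomorphism at the unit extends uniquely to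
comparison maps. Their naturality is immediate for forward legs of spans. For backward legs it is
tested against elementary costates, which are jointly monic for cardinality. This reduces the matter
to costates, then to homotopy pullbacks of two points, which are groupoids with at most one arrow
between any two objects, and finally to pullbacks that are empty or equivalent to a point
(`naturalAt_of_forall_name`). -/

namespace SignedLinAlg

noncomputable section

open ParGrpd Limits

/-! ### Integration over finite groupoids -/

section Integral

variable {G : Type} [Groupoid.{0} G]

instance [FiniteGroupoid G] : Fintype (Pi0 G) :=
  have : Finite (Pi0 G) := FiniteGroupoid.finite_pi0
  Fintype.ofFinite _

instance [FiniteGroupoid G] (x y : G) : Fintype (x ⟶ y) :=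
  have : Finite (x ⟶ y) := FiniteGroupoid.finite_hom x y
  Fintype.ofFinite _

instance (S : ParGrpd) : Fintype (OrComp S) := Fintype.ofFinite _

/-- The component of a point. -/
def cls (x : G) : Pi0 G := Quotient.mk (isIsomorphicSetoid G) x

lemma cls_eq_iff {x y : G} : cls x = cls y ↔ Nonempty (x ⟶ y) :=
  Quotient.eq.trans ⟨fun ⟨e⟩ => ⟨e.hom⟩, fun ⟨a⟩ => ⟨(Groupoid.isoEquivHom x y).symm a⟩⟩

lemma cls_out (c : Pi0 G) : cls c.out = c := Quotient.out_eq c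

lemma card_aut (x : G) : Nat.card (Aut x) = Nat.card (x ⟶ x) :=
  Nat.card_congr (Groupoid.isoEquivHom x x)

lemma card_hom_of_hom {x x' y y' : G} (a : x ⟶ x') (b : y ⟶ y') :
    Nat.card (x ⟶ y) = Nat.card (x' ⟶ y') :=
  Nat.card_congr
    { toFun := fun g => inv a ≫ g ≫ b
      invFun := fun g => a ≫ g ≫ inv b
      left_inv := fun g => by simp
      right_inv := fun g => by simp }

lemma card_aut_pos [FiniteGroupoid G] (x : G) : (0 : ℚ) < Nat.card (Aut x) := by
  rw [card_aut]
  have : Nonempty (x ⟶ x) := ⟨𝟙 x⟩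
  exact_mod_cast Nat.card_pos

lemma card_aut_ne_zero [FiniteGroupoid G] (x : G) : (Nat.card (Aut x) : ℚ) ≠ 0 :=
  (card_aut_pos x).ne'

/-- The integral of a function over a finite groupoid. -/
def gint (G : Type) [Groupoid.{0} G] [FiniteGroupoid G] (w : G → ℚ) : ℚ :=
  ∑ c : Pi0 G, w c.out / Nat.card (Aut c.out)

/-- The integral may be computed from any finite family meeting every component, repetitions
allowed. If `n` indices land in a component, each of them has `n * |Aut|` arrows into the family, so
the repetitions cancel. -/
lemma gint_eq_sum [FiniteGroupoid G] {ι : Type} [Fintype ι] (X : ι → G)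
    (hX : ∀ x : G, ∃ i, Nonempty (X i ⟶ x)) (w : G → ℚ)
    (hw : ∀ {x y : G}, (x ⟶ y) → w x = w y) :
    gint G w = ∑ i, w (X i) / Nat.card (Σ i', (X i ⟶ X i')) := by
  classical
  rw [gint, ← Finset.sum_fiberwise Finset.univ (fun i => cls (X i))]
  refine Finset.sum_congr rfl fun c _ => ?_
  have hc : ∀ i, cls (X i) = c → Nonempty (X i ⟶ c.out) := fun i h =>
    cls_eq_iff.1 (h.trans (cls_out c).symm)
  have key : ∀ i ∈ Finset.univ.filter (fun i => cls (X i) = c),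
      w (X i) / Nat.card (Σ i', (X i ⟶ X i')) = w c.out /
        ((Finset.univ.filter (fun i => cls (X i) = c)).card * Nat.card (Aut c.out)) := by
    intro i hi
    have hi' := (Finset.mem_filter.1 hi).2
    obtain ⟨a⟩ := hc i hi'
    rw [hw a, Nat.card_sigma]
    congr 1
    have : ∀ i', Nat.card (X i ⟶ X i') = if cls (X i') = c then Nat.card (Aut c.out) else 0 := by
      intro i'
      split_ifs with h
      · obtain ⟨a'⟩ := hc i' h
        rw [card_aut, card_hom_of_hom a a']
      · have : IsEmpty (X i ⟶ X i') :=
          ⟨fun g => h ((cls_eq_iff.2 ⟨g⟩).symm.trans hi')⟩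
        exact Nat.card_of_isEmpty
    simp only [this]
    rw [← Finset.sum_filter, Finset.sum_const]
    simp
  rw [Finset.sum_congr rfl key, Finset.sum_const, nsmul_eq_mul]
  have h0 : ((Finset.univ.filter (fun i => cls (X i) = c)).card : ℚ) ≠ 0 := by
    obtain ⟨i, ⟨a⟩⟩ := hX c.out
    have : i ∈ Finset.univ.filter (fun i => cls (X i) = c) :=
      Finset.mem_filter.2 ⟨Finset.mem_univ _, (cls_eq_iff.2 ⟨a⟩).trans (cls_out c)⟩
    exact_mod_cast (Finset.card_pos.2 ⟨i, this⟩).ne'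
  have h1 := card_aut_ne_zero c.out
  field_simp

lemma card_sigma_out (c : Pi0 G) :
    Nat.card (Σ c' : Pi0 G, (c.out ⟶ c'.out)) = Nat.card (Aut c.out) := by
  rw [card_aut]
  refine (Nat.card_eq_of_bijective (fun g : c.out ⟶ c.out => (⟨c, g⟩ : Σ c' : Pi0 G, (c.out ⟶ c'.out)))
    ⟨fun g h e => by simpa using e, ?_⟩).symm
  rintro ⟨c', g⟩
  obtain rfl : c = c' := by rw [← cls_out c, ← cls_out c', cls_eq_iff]; exact ⟨g⟩
  exact ⟨g, rfl⟩

lemma gint_congr [FiniteGroupoid G] {w w' : G → ℚ} (h : ∀ x, w x = w' x) :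
    gint G w = gint G w' := by
  rw [funext h]

lemma gint_mul_left [FiniteGroupoid G] (r : ℚ) (w : G → ℚ) :
    gint G (fun x => r * w x) = r * gint G w := by
  simp only [gint, Finset.mul_sum, mul_div_assoc]

/-- The images of representatives of `G` meet every component of `H`, and full faithfulness
identifies the arrows among them with those in `G`. -/
lemma gint_equivalence {H : Type} [Groupoid.{0} H] [FiniteGroupoid G] [FiniteGroupoid H]
    (F : G ⥤ H) [F.IsEquivalence] (w : H → ℚ) (hw : ∀ {x y : H}, (x ⟶ y) → w x = w y) :
    gint G (fun x => w (F.obj x)) = gint H w := by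
  rw [gint_eq_sum (fun c : Pi0 G => F.obj c.out) ?_ w hw, gint]
  · refine Finset.sum_congr rfl fun c _ => ?_
    rw [← card_sigma_out]
    congr 2
    exact Nat.card_congr (Equiv.sigmaCongrRight fun c' => Functor.FullyFaithful.homEquiv
      (Functor.FullyFaithful.ofFullyFaithful F))
  · intro y
    obtain ⟨a⟩ := cls_eq_iff.1 (cls_out (cls (F.objPreimage y)))
    exact ⟨_, ⟨F.map a ≫ (F.objObjPreimageIso y).hom⟩⟩

end Integral

/-! ### Integrals over homotopy pullbacks and cardinalities of scalars -/

section

variable {A B C : ParGrpd} (f : A ⟶ C) (g : B ⟶ C)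

/-- Fubini's theorem for homotopy pullbacks. The triples formed from representatives of `A` and `B`
and an arrow in `C` meet every component, possibly several times, which is why `gint_eq_sum` allows
repetitions. -/
lemma gint_hpullback (w : CategoricalPullback f.functor g.functor → ℚ)
    (hw : ∀ {x y : CategoricalPullback f.functor g.functor}, (x ⟶ y) → w x = w y) :
    gint (hpullback f g) w = gint A (fun a => gint B (fun b =>
      ∑ φ : f.functor.obj a ⟶ g.functor.obj b, w ⟨a, b, isoOf φ⟩)) := by
  let X : (Σ p : Pi0 A × Pi0 B, (f.functor.obj p.1.out ⟶ g.functor.obj p.2.out)) →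
    CategoricalPullback f.functor g.functor := fun t => ⟨t.1.1.out, t.1.2.out, isoOf t.2⟩
  have hX : ∀ x, ∃ i, Nonempty (X i ⟶ x) := by
    intro x
    obtain ⟨i⟩ := cls_eq_iff.1 (cls_out (cls x.fst))
    obtain ⟨j⟩ := cls_eq_iff.1 (cls_out (cls x.snd))
    refine ⟨⟨(cls x.fst, cls x.snd), f.functor.map i ≫ x.iso.hom ≫ inv (g.functor.map j)⟩, ⟨⟨i, j, ?_⟩⟩⟩
    change _ = (f.functor.map i ≫ x.iso.hom ≫ inv (g.functor.map j)) ≫ g.functor.map j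
    simp
  -- An arrow out of `(a, b, φ)` is a pair `(s, t)` chosen freely: the compatibility square then
  -- forces the third coordinate of the target to be `f(s)⁻¹ φ g(t)`.
  have hdeg : ∀ t, Nat.card (Σ t', (X t ⟶ X t')) =
      Nat.card (Aut t.1.1.out) * Nat.card (Aut t.1.2.out) := by
    rintro ⟨⟨a, b⟩, φ⟩
    rw [← card_sigma_out, ← card_sigma_out, ← Nat.card_prod]
    refine Nat.card_eq_of_bijective (fun u => (⟨u.1.1.1, u.2.fst⟩, ⟨u.1.1.2, u.2.snd⟩)) ⟨?_, ?_⟩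
    · rintro ⟨⟨⟨a₁, b₁⟩, φ₁⟩, ⟨s₁, t₁, w₁⟩⟩ ⟨⟨⟨a₂, b₂⟩, φ₂⟩, ⟨s₂, t₂, w₂⟩⟩ h
      simp only [Prod.mk.injEq, Sigma.mk.injEq] at h
      obtain ⟨⟨rfl, h1⟩, rfl, h2⟩ := h
      obtain rfl := eq_of_heq h1
      obtain rfl := eq_of_heq h2
      obtain rfl : φ₁ = φ₂ := by
        have : f.functor.map s₁ ≫ φ₁ = f.functor.map s₁ ≫ φ₂ := w₁.trans w₂.symm
        exact (cancel_epi _).1 this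
      rfl
    · rintro ⟨⟨a', s⟩, ⟨b', t⟩⟩
      refine ⟨⟨⟨(a', b'), inv (f.functor.map s) ≫ φ ≫ g.functor.map t⟩, ⟨s, t, ?_⟩⟩, rfl⟩
      change f.functor.map s ≫ inv (f.functor.map s) ≫ φ ≫ g.functor.map t = φ ≫ g.functor.map t
      simp
  refine (gint_eq_sum (G := CategoricalPullback f.functor g.functor) X hX w hw).trans ?_
  rw [Fintype.sum_sigma, Fintype.sum_prod_type]
  rw [gint]
  refine Finset.sum_congr rfl fun a _ => ?_
  rw [gint, Finset.sum_div]
  refine Finset.sum_congr rfl fun b _ => ?_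
  rw [Finset.sum_div, Finset.sum_div]
  refine Finset.sum_congr rfl fun φ _ => ?_
  rw [hdeg, div_div, mul_comm]
  push_cast
  rfl

end

/-- For `P` invariant along arrows, the components of the full subgroupoid are those components of
`G` whose representative satisfies `P`, with the same automorphism groups. The representatives
chosen on the two sides may differ, hence the comparison of orders in `hcard`. -/
lemma groupoidCard_fullSubcategory {G : Type} [Groupoid.{0} G] [FiniteGroupoid G] (P : G → Prop)
    [DecidablePred P] (hP : ∀ {x y : G}, (x ⟶ y) → P x → P y) :
    groupoidCard (ObjectProperty.FullSubcategory P) = gint G (fun x => if P x then 1 else 0) := by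
  classical
  let ι : ObjectProperty.FullSubcategory P ⥤ G := ObjectProperty.ι P
  let hι : ι.FullyFaithful := ObjectProperty.fullyFaithfulι P
  let e : Pi0 (ObjectProperty.FullSubcategory P) → Pi0 G :=
    Quotient.map ι.obj (fun _ _ ⟨i⟩ => ⟨ι.mapIso i⟩)
  have he : Function.Injective e := by
    intro p q
    induction p using Quotient.inductionOn
    induction q using Quotient.inductionOn
    intro h
    obtain ⟨i⟩ := Quotient.exact h
    exact Quotient.sound ⟨hι.preimageIso i⟩
  have hcls : ∀ q, e q = cls (ι.obj q.out) := by
    intro q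
    conv_lhs => rw [← Quotient.out_eq q]
    rfl
  have hcard : ∀ q, Nat.card (Aut q.out) = Nat.card (Aut (e q).out) := by
    intro q
    obtain ⟨a⟩ := cls_eq_iff.1 ((cls_out (e q)).trans (hcls q))
    rw [card_aut (e q).out, card_hom_of_hom a a, ← card_aut]
    exact Nat.card_congr hι.isoEquiv
  have hrange : ∀ c, c ∈ Set.range e ↔ P c.out := by
    intro c
    constructor
    · rintro ⟨q, rfl⟩
      obtain ⟨a⟩ := cls_eq_iff.1 ((hcls q).symm.trans (cls_out (e q)).symm)
      exact hP a q.out.property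
    · intro h
      exact ⟨Quotient.mk _ ⟨c.out, h⟩, cls_out c⟩
  calc groupoidCard (ObjectProperty.FullSubcategory P)
      = ∑ᶠ q, (1 : ℚ) / Nat.card (Aut (e q).out) := finsum_congr fun q => by rw [hcard]
    _ = ∑ᶠ c ∈ Set.range e, (1 : ℚ) / Nat.card (Aut c.out) :=
        (finsum_mem_range (f := fun c : Pi0 G => (1 : ℚ) / Nat.card (Aut c.out)) he).symm
    _ = ∑ᶠ c : Pi0 G, (if P c.out then 1 else 0) / (Nat.card (Aut c.out) : ℚ) :=
        finsum_congr fun c => by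
          by_cases h : P c.out
          · rw [finsum_eq_if, if_pos ((hrange c).2 h), if_pos h]
          · rw [finsum_eq_if, if_neg (fun h' => h ((hrange c).1 h')), if_neg h, zero_div]
    _ = _ := finsum_eq_sum_of_fintype _

/-- The rational number given by a sign. -/
def sgnQ (t : ℤˣ) : ℚ := ((t : ℤ) : ℚ)

@[simp] lemma sgnQ_one : sgnQ 1 = 1 := by simp [sgnQ]
@[simp] lemma sgnQ_neg_one : sgnQ (-1) = -1 := by simp [sgnQ]
lemma sgnQ_mul (s t : ℤˣ) : sgnQ (s * t) = sgnQ s * sgnQ t := by simp [sgnQ]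
lemma sgnQ_inv (s : ℤˣ) : sgnQ s⁻¹ = sgnQ s := by rw [Int.units_inv_eq_self]
@[simp] lemma sgnQ_mul_self (s : ℤˣ) : sgnQ s * sgnQ s = 1 := by
  rw [← sgnQ_mul, Int.units_mul_self, sgnQ_one]

@[simp] lemma parity_unitPar {x y : unitPar} (a : x ⟶ y) : unitPar.parity a = 1 := rfl

lemma scalarSign_eq (M : HSpan unitPar unitPar) {x y : M.apex} (a : x ⟶ y) :
    scalarSign M x = scalarSign M y := by
  have h1 := M.left.sgn_nat a
  have h2 := M.right.sgn_nat a
  rw [parity_unitPar, mul_one] at h1 h2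
  rw [scalarSign, scalarSign, ← h1, ← h2, mul_inv, mul_mul_mul_comm, inv_mul_cancel, one_mul]

/-- The sign is constant on components, so it is the difference of the indicator functions of the
positive and negative parts. -/
lemma scalarCard_eq_gint (M : HSpan unitPar unitPar) :
    scalarCard M = gint M.apex (fun x => sgnQ (scalarSign M x)) := by
  classical
  rw [scalarCard, groupoidCard_fullSubcategory _ (fun a h => (scalarSign_eq M a).symm.trans h),
    groupoidCard_fullSubcategory _ (fun a h => (scalarSign_eq M a).symm.trans h), gint, gint, gint,
    ← Finset.sum_sub_distrib]
  refine Finset.sum_congr rfl fun c _ => ?_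
  rcases Int.units_eq_one_or (scalarSign M c.out) with h | h
  · rw [h]; simp
  · rw [h]; simp; ring

lemma scalarCard_congr {M N : HSpan unitPar unitPar} (h : M.Equivalent N) :
    scalarCard M = scalarCard N := by
  obtain ⟨u, hu, ⟨l⟩, ⟨r⟩⟩ := h
  rw [scalarCard_eq_gint, scalarCard_eq_gint,
    ← gint_equivalence u.functor (fun x => sgnQ (scalarSign N x))
      (fun a => congrArg sgnQ (scalarSign_eq N a))]
  refine gint_congr fun x => congrArg sgnQ ?_
  have h1 := Hom₂.sgn_eq l.hom x
  have h2 := Hom₂.sgn_eq r.hom x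
  rw [parity_unitPar, mul_one, comp_sgn] at h1 h2
  rw [scalarSign, scalarSign, ← h1, ← h2, mul_inv, mul_mul_mul_comm, inv_mul_cancel, one_mul]

/-! ### Signed counts of arrows -/

section SignedCount

variable {S T M : ParGrpd}

/-- The signed number of arrows between two points. -/
def shom (S : ParGrpd) (x y : S) : ℚ := ∑ a : x ⟶ y, sgnQ (S.parity a)

lemma shom_comp_right (x : S) {y y' : S} (b : y ⟶ y') :
    shom S x y' = sgnQ (S.parity b) * shom S x y := by
  rw [shom, shom, Finset.mul_sum]
  refine (Fintype.sum_bijective (fun a : x ⟶ y => a ≫ b) ⟨fun a a' h => (cancel_mono b).1 h,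
    fun a => ⟨a ≫ inv b, by simp⟩⟩ _ _ fun a => ?_).symm
  rw [parity_comp, sgnQ_mul, mul_comm]

lemma shom_comp_left {x x' : S} (b : x ⟶ x') (y : S) :
    shom S x' y = sgnQ (S.parity b) * shom S x y := by
  rw [shom, shom, Finset.mul_sum]
  refine Fintype.sum_bijective (fun a : x' ⟶ y => b ≫ a) ⟨fun a a' h => (cancel_epi b).1 h,
    fun a => ⟨inv b ≫ a, by simp⟩⟩ _ _ fun a => ?_
  rw [parity_comp, sgnQ_mul, ← mul_assoc, sgnQ_mul_self, one_mul]

lemma shom_eq_zero_of_isEmpty {x y : S} (h : IsEmpty (x ⟶ y)) : shom S x y = 0 :=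
  Fintype.sum_empty _

/-- Two arrows from `x` to `y` differ by an automorphism of `x`, which is even, so all of them count
with the same sign. -/
lemma shom_of_isOrientable {x y : S} (hx : IsOrientable x) (a : x ⟶ y) :
    shom S x y = sgnQ (S.parity a) * Nat.card (Aut y) := by
  have h : ∀ b : x ⟶ y, S.parity b = S.parity a := by
    intro b
    have h1 := hx (b ≫ inv a)
    rw [parity_comp, parity_inv, mul_inv_eq_one] at h1
    exact h1
  rw [shom, Finset.sum_congr rfl (fun b _ => congrArg sgnQ (h b)), Finset.sum_const, card_aut,
    card_hom_of_hom (inv a) (𝟙 y), Nat.card_eq_fintype_card, Finset.card_univ, nsmul_eq_mul,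
    mul_comm]

/-- A function on the points of a parity groupoid is equivariant if it is compatible with the
signs of the arrows. -/
def IsEquivariant {W : Type*} [AddCommGroup W] [Module ℚ W] (w : S → W) : Prop :=
  ∀ ⦃x y : S⦄ (a : x ⟶ y), w y = sgnQ (S.parity a) • w x

/-- An odd automorphism gives `w x = -w x`, and `2` is invertible. This is why only orientable
components contribute a basis vector. -/
lemma IsEquivariant.eq_zero {W : Type*} [AddCommGroup W] [Module ℚ W] {w : S → W}
    (hw : IsEquivariant w) {x : S} (hx : ¬ IsOrientable x) : w x = 0 := by
  unfold IsOrientable at hx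
  push Not at hx
  obtain ⟨g, hg⟩ := hx
  have h := hw g
  rw [(Int.units_eq_one_or _).resolve_left hg, sgnQ_neg_one, neg_one_smul] at h
  have h2 : (2 : ℚ) • w x = 0 := by rw [two_smul]; nth_rewrite 1 [h]; exact neg_add_cancel _
  exact (smul_eq_zero.1 h2).resolve_left two_ne_zero

lemma isEquivariant_shom (x : S) : IsEquivariant (shom S x) :=
  fun _ _ a => shom_comp_right x a

lemma isEquivariant_shom' (y : S) : IsEquivariant (fun x => shom S x y) :=
  fun _ _ a => shom_comp_left a y

lemma IsEquivariant.comp {W : Type*} [AddCommGroup W] [Module ℚ W] {w : S → W}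
    (hw : IsEquivariant w) (u : M ⟶ S) :
    IsEquivariant (fun m => sgnQ (u.sgn m) • w (u.functor.obj m)) := by
  intro x y a
  have h := congrArg sgnQ (u.sgn_nat a)
  rw [sgnQ_mul, sgnQ_mul] at h
  have h' : sgnQ (u.sgn y) = sgnQ (M.parity a) * sgnQ (u.sgn x) *
      sgnQ (S.parity (u.functor.map a)) := by
    rw [mul_assoc, ← h, ← mul_assoc, sgnQ_mul_self, one_mul]
  beta_reduce
  rw [hw (u.functor.map a), h', smul_smul, smul_smul, mul_assoc _ (sgnQ _) (sgnQ _), sgnQ_mul_self,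
    mul_one]

lemma IsEquivariant.mul_invariant {v w : S → ℚ} (hv : IsEquivariant v) (hw : IsEquivariant w)
    {x y : S} (a : x ⟶ y) : v x * w x = v y * w y := by
  rw [hv a, hw a, smul_eq_mul, smul_eq_mul, mul_mul_mul_comm, sgnQ_mul_self, one_mul]

/-- Expansion of an equivariant function over distinct representatives `p`. Only the representative
in the component of `x` contributes, and if `x` is not orientable both sides vanish. It is applied
both to representatives of all components and to base points of the orientable ones. -/
lemma sum_shom {W : Type*} [AddCommGroup W] [Module ℚ W] {w : S → W} (hw : IsEquivariant w)
    {J : Type} [Fintype J] (p : J → S) (hp : ∀ j j', Nonempty (p j ⟶ p j') → j = j') (x : S)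
    (hx : IsOrientable x → ∃ j, Nonempty (x ⟶ p j)) :
    ∑ j, (shom S x (p j) / Nat.card (Aut (p j))) • w (p j) = w x := by
  by_cases h : IsOrientable x
  · obtain ⟨j, ⟨a⟩⟩ := hx h
    rw [Finset.sum_eq_single j]
    · rw [shom_of_isOrientable h a, mul_div_assoc, div_self (card_aut_ne_zero _), mul_one, hw a,
        smul_smul, sgnQ_mul_self, one_smul]
    · intro j' _ hj
      rw [shom_eq_zero_of_isEmpty ⟨fun b => hj (hp _ _ ⟨inv b ≫ a⟩)⟩, zero_div, zero_smul]
    · exact fun h => absurd (Finset.mem_univ _) h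
  · rw [hw.eq_zero h]
    refine Finset.sum_eq_zero fun j _ => ?_
    rw [(isEquivariant_shom' (p j)).eq_zero h, zero_div, zero_smul]

/-- A signed Yoneda lemma: `shom S x` acts as the delta function at `x` on equivariant functions. -/
lemma gint_shom {w : S → ℚ} (hw : IsEquivariant w) (x : S) :
    gint S (fun y => shom S x y * w y) = w x := by
  rw [← sum_shom hw (fun c : Pi0 S => c.out) ?_ x ?_, gint]
  · exact Finset.sum_congr rfl fun c _ => by rw [smul_eq_mul, div_mul_eq_mul_div]
  · intro c c' h
    rw [← cls_out c, ← cls_out c']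
    exact cls_eq_iff.2 h
  · exact fun _ => ⟨cls x, cls_eq_iff.1 (cls_out (cls x)).symm⟩

/-- The signed cardinality of the two-sided fibre of a span. -/
def entry (M : HSpan S T) (s : S) (t : T) : ℚ :=
  gint M.apex (fun m => (sgnQ (M.left.sgn m) • shom S s (M.left.functor.obj m)) *
    (sgnQ (M.right.sgn m) • shom T (M.right.functor.obj m) t))

lemma gint_unitPar (w : unitPar → ℚ) : gint unitPar w = w ⟨PUnit.unit⟩ := by
  refine (gint_eq_sum (G := Discrete PUnit) (fun _ : Unit => ⟨PUnit.unit⟩)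
    (fun x => ⟨(), ⟨eqToHom (Subsingleton.elim _ _)⟩⟩) w
    (fun {x y} _ => congrArg w (Subsingleton.elim x y))).trans ?_
  have : Nat.card (Σ _ : Unit, ((⟨PUnit.unit⟩ : Discrete PUnit) ⟶ ⟨PUnit.unit⟩)) = 1 := by
    rw [Nat.card_sigma, Fintype.sum_unique]
    exact Nat.card_eq_one_iff_unique.2 ⟨inferInstance, ⟨𝟙 _⟩⟩
  rw [Fintype.sum_unique, this, Nat.cast_one, div_one]

lemma isEquivariant_shom_comp (u : M ⟶ S) (s : S) :
    IsEquivariant (fun m => sgnQ (u.sgn m) • shom S s (u.functor.obj m)) :=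
  (isEquivariant_shom s).comp u

lemma isEquivariant_comp_shom (u : M ⟶ S) (s : S) :
    IsEquivariant (fun m => sgnQ (u.sgn m) • shom S (u.functor.obj m) s) :=
  (isEquivariant_shom' s).comp u

lemma comp_left_sgn {V : ParGrpd} (M : HSpan S T) (N : HSpan T V)
    (z : CategoricalPullback M.right.functor N.left.functor) :
    (M.comp N).left.sgn z = M.left.sgn z.fst :=
  (comp_sgn (hfst M.right N.left) M.left z).trans (one_mul _)

lemma comp_right_sgn {V : ParGrpd} (M : HSpan S T) (N : HSpan T V)
    (z : CategoricalPullback M.right.functor N.left.functor) :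
    (M.comp N).right.sgn z = M.right.sgn z.fst * T.parity z.iso.hom * (N.left.sgn z.snd)⁻¹ *
      N.right.sgn z.snd :=
  comp_sgn (hsnd M.right N.left) N.right z

/-- A point of the two-sided fibre is a point `m` of the apex with an arrow `φ` from `s` to its left
image and an arrow from its right image to `t`. Its sign is the product of both parities and both
leg signs, so Fubini, applied once per end, separates the sums into two signed counts. -/
lemma scalarCard_twoSidedFibre (M : HSpan S T) (s : S) (t : T) :
    scalarCard (twoSidedFibre M s t) = entry M s t := by
  -- The integrand that remains once the arrow on the left side has been summed out; the arrow on
  -- the right side is still a coordinate of the point.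
  let v : CategoricalPullback M.right.functor (nameHom t).functor → ℚ := fun z =>
    (sgnQ (M.left.sgn z.fst) • shom S s (M.left.functor.obj z.fst)) *
      (sgnQ (M.right.sgn z.fst) * sgnQ (T.parity z.iso.hom))
  have hv : ∀ {x y : CategoricalPullback M.right.functor (nameHom t).functor},
      (x ⟶ y) → v x = v y := by
    intro x y a
    have h1 := isEquivariant_shom_comp M.left s a.fst
    have h2 : T.parity (M.right.functor.map a.fst) * T.parity y.iso.hom =
        T.parity x.iso.hom := by
      have h3 : M.right.functor.map a.fst ≫ y.iso.hom = x.iso.hom :=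
        a.w.trans (Category.comp_id _)
      exact (T.parity_comp _ _).symm.trans (congrArg T.parity h3)
    have h4 := M.right.sgn_nat a.fst
    have h5 : M.right.sgn y.fst * T.parity y.iso.hom =
        M.apex.parity a.fst * (M.right.sgn x.fst * T.parity x.iso.hom) := by
      rw [← h2, ← mul_assoc (M.right.sgn x.fst), ← h4]
      generalize M.apex.parity _ = p
      generalize M.right.sgn _ = q
      generalize T.parity _ = r
      decide +revert
    beta_reduce at h1
    simp only [v]
    rw [h1, ← sgnQ_mul, ← sgnQ_mul, h5, sgnQ_mul _ (_ * _), smul_eq_mul (sgnQ (M.apex.parity _)),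
      mul_mul_mul_comm, sgnQ_mul_self, one_mul]
  rw [scalarCard_eq_gint, twoSidedFibre]
  refine (gint_hpullback (nameHom s) (M.comp (conameSpan t)).left _
    (fun a => congrArg sgnQ (scalarSign_eq (twoSidedFibre M s t) a))).trans ?_
  rw [gint_unitPar]
  refine (gint_congr (w' := v) fun z => ?_).trans ?_
  · change CategoricalPullback M.right.functor (nameHom t).functor at z
    let L : ℤˣ := M.left.sgn z.fst
    let R : ℤˣ := M.right.sgn z.fst
    let θ : ℤˣ := T.parity z.iso.hom
    have h : ∀ φ : s ⟶ M.left.functor.obj z.fst, scalarSign (twoSidedFibre M s t)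
        (⟨⟨PUnit.unit⟩, z, isoOf φ⟩ : CategoricalPullback (nameHom s).functor
          (M.comp (conameSpan t)).left.functor) = S.parity φ * (L * (R * θ)) := by
      intro φ
      have h1 : S.parity φ * (L * (R * θ)) =
          1⁻¹ * (1 * S.parity φ * L⁻¹ * (R * θ * 1⁻¹ * 1)) := by
        simp only [inv_one, one_mul, mul_one, Int.units_inv_eq_self, mul_assoc]
      rw [h1]
      refine congrArg₂ (fun a b : ℤˣ => a⁻¹ * b) ((comp_left_sgn _ _ _).trans ?_)
        ((comp_right_sgn _ _ _).trans ?_)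
      · rfl
      · exact congrArg₂ (fun a b : ℤˣ => 1 * S.parity φ * a⁻¹ * b)
          (comp_left_sgn M (conameSpan t) z) (comp_right_sgn M (conameSpan t) z)
    have key : ∑ φ : s ⟶ M.left.functor.obj z.fst, sgnQ (S.parity φ * (L * (R * θ))) = v z := by
      simp only [sgnQ_mul, v]
      rw [← Finset.sum_mul, shom, smul_eq_mul]
      ring
    exact (Finset.sum_congr rfl fun φ _ => congrArg sgnQ (h φ)).trans key
  · refine (gint_hpullback M.right (nameHom t) v hv).trans (gint_congr fun m => ?_)
    rw [gint_unitPar]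
    simp only [v, ← Finset.mul_sum]
    rfl

/-- By Fubini the integral runs over `m`, `n` and a gluing arrow `φ` in `T`. The middle 2-cell
enters only through the parity of `φ`, and summing over `φ` produces the kernel `shom T` belonging
to the left leg of `N`. -/
lemma entry_comp {V : ParGrpd} (M : HSpan S T) (N : HSpan T V) (s : S) (v : V) :
    entry (M.comp N) s v = gint M.apex (fun m =>
      (sgnQ (M.left.sgn m) • shom S s (M.left.functor.obj m)) *
        (sgnQ (M.right.sgn m) • entry N (M.right.functor.obj m) v)) := by
  refine (gint_hpullback M.right N.left _ (fun a =>
    (isEquivariant_shom_comp (M.comp N).left s).mul_invariant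
      (isEquivariant_comp_shom (M.comp N).right v) a)).trans (gint_congr fun m => ?_)
  rw [entry, smul_eq_mul (sgnQ (M.right.sgn m)), ← mul_assoc, ← gint_mul_left]
  refine gint_congr fun n => ?_
  let A := sgnQ (M.left.sgn m) • shom S s (M.left.functor.obj m)
  let B := shom V (N.right.functor.obj n) v
  have h : ∀ φ : M.right.functor.obj m ⟶ N.left.functor.obj n,
      (sgnQ ((M.comp N).left.sgn (⟨m, n, isoOf φ⟩ : CategoricalPullback _ _)) •
        shom S s (M.left.functor.obj m)) *
      (sgnQ ((M.comp N).right.sgn (⟨m, n, isoOf φ⟩ : CategoricalPullback _ _)) • B) =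
      sgnQ (T.parity φ) * (A * (sgnQ (M.right.sgn m) * (sgnQ (N.left.sgn n) *
        (sgnQ (N.right.sgn n) * B)))) := by
    intro φ
    rw [comp_left_sgn, comp_right_sgn, sgnQ_mul, sgnQ_mul, sgnQ_mul, sgnQ_inv]
    change A * ((sgnQ (M.right.sgn m) * sgnQ (T.parity φ) * sgnQ (N.left.sgn n) *
      sgnQ (N.right.sgn n)) * B) = _
    ring
  refine (Finset.sum_congr rfl fun φ _ => h φ).trans ?_
  rw [← Finset.sum_mul]
  change shom T _ _ * _ = A * _ * ((_ * _) * (_ * B))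
  ring

end SignedCount

end
end SignedLinAlg

/-! ### Pointwise coherence of diagrams and the total groupoid -/

namespace SignedLinAlg

noncomputable section

namespace ParGrpd

/-- The component of a 2-cell at a point. -/
abbrev comp₂ {S T : ParGrpd} {u v : S ⟶ T} (α : u ⟶ v) (x : S) :
    u.functor.obj x ⟶ v.functor.obj x := (Hom₂.nat α).app x

lemma comp₂_nat {S T : ParGrpd} {u v : S ⟶ T} (α : u ⟶ v) {x y : S} (g : x ⟶ y) :
    u.functor.map g ≫ comp₂ α y = comp₂ α x ≫ v.functor.map g := (Hom₂.nat α).naturality g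

@[simp] lemma comp₂_hom_inv {S T : ParGrpd} {u v : S ⟶ T} (α : u ≅ v) (x : S) :
    comp₂ α.hom x ≫ comp₂ α.inv x = 𝟙 _ := congrArg (fun t => comp₂ t x) α.hom_inv_id

@[simp] lemma comp₂_inv_hom {S T : ParGrpd} {u v : S ⟶ T} (α : u ≅ v) (x : S) :
    comp₂ α.inv x ≫ comp₂ α.hom x = 𝟙 _ := congrArg (fun t => comp₂ t x) α.inv_hom_id

end ParGrpd

open ParGrpd

variable {I : Type} [Groupoid.{0} I]

namespace Diagram

variable (D : Pseudofunctor (LocallyDiscrete I) ParGrpd)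

/-- The transport morphism of a diagram along an arrow. -/
abbrev tr {i j : I} (a : i ⟶ j) : D.obj ⟨i⟩ ⟶ D.obj ⟨j⟩ := D.map a.toLoc

/-- The transport of a point along an arrow. -/
abbrev trO {i j : I} (a : i ⟶ j) (x : D.obj ⟨i⟩) : D.obj ⟨j⟩ := (tr D a).functor.obj x

/-- The transport of an arrow along an arrow of the index. -/
abbrev trM {i j : I} (a : i ⟶ j) {x y : D.obj ⟨i⟩} (g : x ⟶ y) : trO D a x ⟶ trO D a y :=
  (tr D a).functor.map g

lemma trM_comp {i j : I} (a : i ⟶ j) {x y z : D.obj ⟨i⟩} (g : x ⟶ y) (h : y ⟶ z) :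
    trM D a (g ≫ h) = trM D a g ≫ trM D a h := Functor.map_comp _ _ _

@[simp] lemma trM_id {i j : I} (a : i ⟶ j) (x : D.obj ⟨i⟩) : trM D a (𝟙 x) = 𝟙 _ :=
  CategoryTheory.Functor.map_id _ _

/-- The composition constraint at a point. -/
def mu {i j k : I} (a : i ⟶ j) (b : j ⟶ k) (x : D.obj ⟨i⟩) :
    trO D b (trO D a x) ⟶ trO D (a ≫ b) x := comp₂ (D.mapComp a.toLoc b.toLoc).inv x

/-- The unit constraint at a point. -/
def unit (i : I) (x : D.obj ⟨i⟩) : x ⟶ trO D (𝟙 i) x := comp₂ (D.mapId ⟨i⟩).inv x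

lemma mu_nat {i j k : I} (a : i ⟶ j) (b : j ⟶ k) {x y : D.obj ⟨i⟩} (g : x ⟶ y) :
    trM D b (trM D a g) ≫ mu D a b y = mu D a b x ≫ trM D (a ≫ b) g :=
  comp₂_nat (D.mapComp a.toLoc b.toLoc).inv g

lemma unit_nat (i : I) {x y : D.obj ⟨i⟩} (g : x ⟶ y) :
    g ≫ unit D i y = unit D i x ≫ trM D (𝟙 i) g :=
  comp₂_nat (D.mapId ⟨i⟩).inv g

/-- The index 2-category is locally discrete, so its 2-cells record only equalities of arrows.
Coherence data of the index therefore appears as `eqToHom` in the pointwise laws. -/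
lemma comp₂_map₂ {i j : I} {a b : i ⟶ j} (h : a = b)
    (θ : a.toLoc ⟶ b.toLoc) (x : D.obj ⟨i⟩) :
    comp₂ (D.map₂ θ) x = eqToHom (by rw [h]) := by
  subst h
  have : θ = 𝟙 _ := Subsingleton.elim _ _
  rw [this, D.map₂_id]
  rfl

lemma mu_assoc {i j k l : I} (a : i ⟶ j) (b : j ⟶ k) (c : k ⟶ l) (x : D.obj ⟨i⟩) :
    trM D c (mu D a b x) ≫ mu D (a ≫ b) c x =
      mu D b c (trO D a x) ≫ mu D a (b ≫ c) x ≫ eqToHom (by rw [Category.assoc]) := by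
  have h := congrArg (fun t => comp₂ t x) (D.mapComp_assoc_left_inv a.toLoc b.toLoc c.toLoc)
  have h3 := comp₂_map₂ D (Category.assoc a b c).symm (α_ a.toLoc b.toLoc c.toLoc).inv x
  -- The image of the associator is abstracted to a variable `E` with the pointwise type, so that it
  -- can be exchanged for the `eqToHom` of the statement.
  have h4 : ∀ E : trO D (a ≫ b ≫ c) x ⟶ trO D ((a ≫ b) ≫ c) x,
      E = comp₂ (D.map₂ (α_ a.toLoc b.toLoc c.toLoc).inv) x →
      trM D c (mu D a b x) ≫ mu D (a ≫ b) c x =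
        𝟙 _ ≫ mu D b c (trO D a x) ≫ mu D a (b ≫ c) x ≫ E := by
    rintro _ rfl
    exact h
  rw [h4 _ h3.symm, Category.id_comp]

lemma unit_mu {i j : I} (a : i ⟶ j) (x : D.obj ⟨i⟩) :
    trM D a (unit D i x) ≫ mu D (𝟙 i) a x = eqToHom (by rw [Category.id_comp]) := by
  have h := congrArg (fun t => comp₂ t x) (D.mapComp_id_left_inv a.toLoc)
  have h3 := comp₂_map₂ D (Category.id_comp a).symm (λ_ a.toLoc).inv x
  let c : trO D (𝟙 i) x ⟶ x := comp₂ (D.mapId ⟨i⟩).hom x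
  have h4 : ∀ E : trO D a x ⟶ trO D (𝟙 i ≫ a) x,
      E = comp₂ (D.map₂ (λ_ a.toLoc).inv) x →
      mu D (𝟙 i) a x = trM D a c ≫ 𝟙 _ ≫ E := by
    rintro _ rfl
    exact h
  have h5 : unit D i x ≫ c = 𝟙 _ := comp₂_inv_hom _ x
  have h6 : trM D a (unit D i x) ≫ trM D a c = 𝟙 _ := by
    rw [← Functor.map_comp, h5, CategoryTheory.Functor.map_id]
  rw [h4 _ h3.symm, reassoc_of% h6]
  exact Category.id_comp _

lemma mu_unit {i j : I} (a : i ⟶ j) (x : D.obj ⟨i⟩) :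
    unit D j (trO D a x) ≫ mu D a (𝟙 j) x = eqToHom (by rw [Category.comp_id]) := by
  have h := congrArg (fun t => comp₂ t x) (D.mapComp_id_right_inv a.toLoc)
  have h3 := comp₂_map₂ D (Category.comp_id a).symm (ρ_ a.toLoc).inv x
  let c : trO D (𝟙 j) (trO D a x) ⟶ trO D a x := comp₂ (D.mapId ⟨j⟩).hom (trO D a x)
  have h4 : ∀ E : trO D a x ⟶ trO D (a ≫ 𝟙 j) x,
      E = comp₂ (D.map₂ (ρ_ a.toLoc).inv) x →
      mu D a (𝟙 j) x = c ≫ 𝟙 _ ≫ E := by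
    rintro _ rfl
    exact h
  have h5 : unit D j (trO D a x) ≫ c = 𝟙 _ := comp₂_inv_hom _ _
  rw [h4 _ h3.symm, Category.id_comp, reassoc_of% h5]

lemma sgn_mu {i j k : I} (a : i ⟶ j) (b : j ⟶ k) (x : D.obj ⟨i⟩) :
    (tr D (a ≫ b)).sgn x = (tr D a).sgn x * (tr D b).sgn (trO D a x) *
      (D.obj ⟨k⟩).parity (mu D a b x) := by
  have h := Hom₂.sgn_eq (D.mapComp a.toLoc b.toLoc).inv x
  rw [comp_sgn] at h
  exact h

lemma sgn_unit (i : I) (x : D.obj ⟨i⟩) :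
    (tr D (𝟙 i)).sgn x = (D.obj ⟨i⟩).parity (unit D i x) := by
  have h := Hom₂.sgn_eq (D.mapId ⟨i⟩).inv x
  rw [id_sgn, one_mul] at h
  exact h

/-- The points of the total groupoid of a diagram. -/
structure Total where
  base : I
  pt : D.obj ⟨base⟩

variable {D} in
/-- The arrows of the total groupoid of a diagram. -/
structure Total.Arrow (y x : Total D) where
  base : x.base ⟶ y.base
  fib : y.pt ⟶ trO D base x.pt

variable {D} in
lemma Total.Arrow.ext' {y x : Total D} {f g : Total.Arrow y x} (h : f.base = g.base)
    (h' : f.fib ≫ eqToHom (by rw [h]) = g.fib) : f = g := by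
  obtain ⟨a, u⟩ := f
  obtain ⟨b, v⟩ := g
  obtain rfl : a = b := h
  simp at h'
  rw [h']

/-- An arrow from `y` to `x` lies over an index arrow from `x.base` to `y.base`. As `I` is a
groupoid this reversal is harmless; it agrees with the direction of the constraints `cnat`, so
induced functors need no inverses. -/
instance : Category.{0} (Total D) where
  Hom := Total.Arrow
  id x := ⟨𝟙 _, unit D _ _⟩
  comp {z y x} f g := ⟨g.base ≫ f.base, f.fib ≫ trM D f.base g.fib ≫ mu D g.base f.base x.pt⟩
  id_comp {y x} f := by
    refine Total.Arrow.ext' (Category.comp_id f.base) ?_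
    have h := unit_nat D y.base f.fib
    have h2 := mu_unit D f.base x.pt
    simp only [Category.assoc]
    rw [← reassoc_of% h, reassoc_of% h2]
    simp
  comp_id {y x} f := by
    refine Total.Arrow.ext' (Category.id_comp f.base) ?_
    have h2 := unit_mu D f.base x.pt
    simp only [Category.assoc]
    rw [reassoc_of% h2]
    simp
  assoc {w z y x} f g k := by
    refine Total.Arrow.ext' (Category.assoc k.base g.base f.base).symm ?_
    have h1 := mu_nat D g.base f.base k.fib
    have h2 := mu_assoc D k.base g.base f.base x.pt
    simp only [Functor.map_comp, Category.assoc]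
    rw [h2, ← reassoc_of% h1]

variable {D} in
lemma Total.hom_ext {y x : Total D} {f g : y ⟶ x} (h : f.base = g.base)
    (h' : f.fib ≫ eqToHom (by rw [h]) = g.fib) : f = g := Total.Arrow.ext' h h'

@[simp] lemma Total.id_fib (x : Total D) : Total.Arrow.fib (𝟙 x) = unit D x.base x.pt := rfl

variable {D} in
lemma Total.exists_right_inverse {y x : Total D} (f : y ⟶ x) : ∃ g : x ⟶ y, f ≫ g = 𝟙 y := by
  let b := inv f.base
  let e : trO D (𝟙 y.base) y.pt ⟶ trO D (b ≫ f.base) y.pt :=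
    eqToHom (by rw [IsIso.inv_hom_id])
  have := isEquivalence_map D f.base
  -- The base of the inverse being `b`, the fibre part must transport to the unique arrow that makes
  -- the composite equal to the unit. Transport along `f.base` is an equivalence, so fullness
  -- provides it.
  obtain ⟨g, hg⟩ := (tr D f.base).functor.map_surjective (X := x.pt) (Y := trO D b y.pt)
    (inv f.fib ≫ unit D y.base y.pt ≫ e ≫ inv (mu D b f.base y.pt))
  refine ⟨⟨b, g⟩, Total.hom_ext (IsIso.inv_hom_id f.base) ?_⟩
  change (f.fib ≫ (tr D f.base).functor.map g ≫ mu D b f.base y.pt) ≫ eqToHom _ = _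
  rw [hg]
  simp [e]

instance : Groupoid.{0} (Total D) :=
  Groupoid.ofIsIso (fun f => by
    obtain ⟨g, hg⟩ := Total.exists_right_inverse f
    obtain ⟨k, hk⟩ := Total.exists_right_inverse g
    have : f = k := by rw [← Category.comp_id f, ← hk, ← Category.assoc, hg, Category.id_comp]
    subst this
    exact ⟨g, hg, hk⟩)

instance [FiniteGroupoid I] : FiniteGroupoid (Total D) where
  finite_pi0 := by
    have := FiniteGroupoid.finite_pi0 (G := I)
    have := fun i : I => FiniteGroupoid.finite_pi0 (G := D.obj ⟨i⟩)
    let ψ : (Σ i : Pi0 I, Pi0 (D.obj ⟨i.out⟩)) → Pi0 (Total D) :=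
      fun t => Quotient.mk _ ⟨t.1.out, t.2.out⟩
    refine Finite.of_surjective ψ fun q => ?_
    induction q using Quotient.inductionOn with
    | h x =>
      obtain ⟨i⟩ := Quotient.mk_out (s := isIsomorphicSetoid I) x.base
      obtain ⟨j⟩ := Quotient.mk_out (s := isIsomorphicSetoid (D.obj ⟨_⟩)) (trO D i.inv x.pt)
      exact ⟨⟨Quotient.mk _ x.base, Quotient.mk _ (trO D i.inv x.pt)⟩,
        Quotient.sound ⟨(Groupoid.isoEquivHom _ _).symm (Total.Arrow.mk i.inv j.hom)⟩⟩
  finite_hom y x := by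
    have := FiniteGroupoid.finite_hom (G := I)
    have := fun i : I => FiniteGroupoid.finite_hom (G := D.obj ⟨i⟩)
    refine Finite.of_injective (β := Σ a : x.base ⟶ y.base, (y.pt ⟶ trO D a x.pt))
      (fun f => ⟨f.base, f.fib⟩) ?_
    rintro ⟨a, u⟩ ⟨b, v⟩ h
    simp only [Sigma.mk.injEq] at h
    obtain ⟨rfl, h⟩ := h
    obtain rfl := eq_of_heq h
    rfl

/-- The parity of a total arrow is that of its fibre part times the sign of the transport. It is
multiplicative because the parity of `mu` and the sign of the intermediate transport each enter
twice and cancel. -/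
lemma Total.parity_aux {z y x : Total D} (f : z ⟶ y) (g : y ⟶ x) :
    (D.obj ⟨z.base⟩).parity (f ≫ g).fib * (tr D (f ≫ g).base).sgn x.pt =
      ((D.obj ⟨z.base⟩).parity f.fib * (tr D f.base).sgn y.pt) *
        ((D.obj ⟨y.base⟩).parity g.fib * (tr D g.base).sgn x.pt) := by
  have h := (tr D f.base).sgn_nat g.fib
  change (D.obj ⟨z.base⟩).parity (f.fib ≫ trM D f.base g.fib ≫ mu D g.base f.base x.pt) *
    (tr D (g.base ≫ f.base)).sgn x.pt = _
  rw [sgn_mu, parity_comp, parity_comp]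
  have k := Int.units_mul_self ((D.obj ⟨z.base⟩).parity (mu D g.base f.base x.pt))
  generalize (D.obj ⟨z.base⟩).parity (mu D g.base f.base x.pt) = m at *
  generalize (D.obj ⟨z.base⟩).parity f.fib = p
  have h' : (D.obj ⟨z.base⟩).parity (trM D f.base g.fib) = (tr D f.base).sgn y.pt *
      ((D.obj ⟨y.base⟩).parity g.fib * (tr D f.base).sgn (trO D g.base x.pt)) := by
    rw [h, ← mul_assoc, Int.units_mul_self, one_mul]
  rw [h']
  generalize (tr D f.base).sgn (trO D g.base x.pt) = q
  calc _ = p * ((tr D f.base).sgn y.pt * ((D.obj ⟨y.base⟩).parity g.fib)) *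
        (tr D g.base).sgn x.pt * (m * m) * (q * q) := by
          simp only [mul_assoc, mul_comm, mul_left_comm]
    _ = _ := by
          rw [k, Int.units_mul_self]
          simp only [mul_assoc, mul_one]

/-- The total groupoid of a diagram, with its parity structure. -/
def tot [FiniteGroupoid I] : ParGrpd where
  carrier := Total D
  par :=
    { obj := fun _ => SingleObj.star ℤˣ
      map := fun {y x} f => (D.obj ⟨y.base⟩).parity f.fib * (tr D f.base).sgn x.pt
      map_id := fun x => by
        change (D.obj ⟨x.base⟩).parity (unit D x.base x.pt) * (tr D (𝟙 x.base)).sgn x.pt = 1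
        rw [sgn_unit, Int.units_mul_self]
      map_comp := fun f g => (Total.parity_aux D f g).trans (mul_comm _ _) }

variable {D} {X : ParGrpd}

/-- The components of a transformation to a constant diagram. -/
def capp (θ : D ⟶ constPF I X) (i : I) : D.obj ⟨i⟩ ⟶ X := θ.app ⟨i⟩

/-- The components of the naturality constraint of a transformation to a constant diagram. -/
def cnat (θ : D ⟶ constPF I X) {i j : I} (a : i ⟶ j) (x : D.obj ⟨i⟩) :
    (capp θ j).functor.obj (trO D a x) ⟶ (capp θ i).functor.obj x :=
  comp₂ (θ.naturality a.toLoc).hom x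

lemma cnat_nat (θ : D ⟶ constPF I X) {i j : I} (a : i ⟶ j) {x y : D.obj ⟨i⟩} (g : x ⟶ y) :
    (capp θ j).functor.map (trM D a g) ≫ cnat θ a y =
      cnat θ a x ≫ (capp θ i).functor.map g :=
  comp₂_nat (θ.naturality a.toLoc).hom g

lemma cnat_sgn (θ : D ⟶ constPF I X) {i j : I} (a : i ⟶ j) (x : D.obj ⟨i⟩) :
    (capp θ i).sgn x = (tr D a).sgn x * (capp θ j).sgn (trO D a x) *
      X.parity (cnat θ a x) := by
  have h := Hom₂.sgn_eq (θ.naturality a.toLoc).hom x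
  rw [comp_sgn, comp_sgn] at h
  exact (mul_one _).symm.trans h

/-- The unit axiom of the transformation, solved for the inverse constraint `unit`. Together with
`cnat_comp` it is exactly the functoriality of `descF`. -/
lemma cnat_id (θ : D ⟶ constPF I X) (i : I) (x : D.obj ⟨i⟩) :
    (capp θ i).functor.map (unit D i x) ≫ cnat θ (𝟙 i) x = 𝟙 _ := by
  have h := congrArg (fun t => comp₂ t x) (θ.naturality_id ⟨i⟩)
  let c : trO D (𝟙 i) x ⟶ x := comp₂ (D.mapId ⟨i⟩).hom x
  have h4 : cnat θ (𝟙 i) x ≫ 𝟙 _ = (capp θ i).functor.map c ≫ 𝟙 _ ≫ 𝟙 _ := h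
  have h5 : unit D i x ≫ c = 𝟙 _ := comp₂_inv_hom _ x
  rw [Category.comp_id, Category.comp_id, Category.comp_id] at h4
  rw [h4, ← Functor.map_comp, h5, CategoryTheory.Functor.map_id]

lemma cnat_comp (θ : D ⟶ constPF I X) {i j k : I} (a : i ⟶ j) (b : j ⟶ k) (x : D.obj ⟨i⟩) :
    (capp θ k).functor.map (mu D a b x) ≫ cnat θ (a ≫ b) x =
      cnat θ b (trO D a x) ≫ cnat θ a x := by
  have h := congrArg (fun t => comp₂ t x) (θ.naturality_comp a.toLoc b.toLoc)
  let c : trO D (a ≫ b) x ⟶ trO D b (trO D a x) := comp₂ (D.mapComp a.toLoc b.toLoc).hom x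
  have h4 : cnat θ (a ≫ b) x ≫ 𝟙 _ = (capp θ k).functor.map c ≫ 𝟙 _ ≫
      cnat θ b (trO D a x) ≫ 𝟙 _ ≫ cnat θ a x ≫ 𝟙 _ := h
  have h5 : mu D a b x ≫ c = 𝟙 _ := comp₂_inv_hom _ x
  simp only [Category.comp_id, Category.id_comp] at h4
  rw [h4, ← Functor.map_comp_assoc, h5, CategoryTheory.Functor.map_id, Category.id_comp]

/-- A transformation to a constant diagram from its components. -/
def constMk (app : ∀ i, D.obj ⟨i⟩ ⟶ X)
    (nat : ∀ {i j : I} (a : i ⟶ j) (x : D.obj ⟨i⟩),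
      (app j).functor.obj (trO D a x) ⟶ (app i).functor.obj x)
    (nat_nat : ∀ {i j : I} (a : i ⟶ j) {x y : D.obj ⟨i⟩} (g : x ⟶ y),
      (app j).functor.map (trM D a g) ≫ nat a y = nat a x ≫ (app i).functor.map g)
    (nat_sgn : ∀ {i j : I} (a : i ⟶ j) (x : D.obj ⟨i⟩),
      (app i).sgn x = (tr D a).sgn x * (app j).sgn (trO D a x) * X.parity (nat a x))
    (nat_id : ∀ (i : I) (x : D.obj ⟨i⟩), (app i).functor.map (unit D i x) ≫ nat (𝟙 i) x = 𝟙 _)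
    (nat_comp : ∀ {i j k : I} (a : i ⟶ j) (b : j ⟶ k) (x : D.obj ⟨i⟩),
      (app k).functor.map (mu D a b x) ≫ nat (a ≫ b) x = nat b (trO D a x) ≫ nat a x) :
    D ⟶ constPF I X where
  app i := app i.as
  naturality {i j} a := ParGrpd.isoMk (u := tr D a.as ≫ app j.as) (v := app i.as ≫ 𝟙 X)
    (NatIso.ofComponents (fun x => isoOf (nat a.as x)) (fun g => nat_nat a.as g)) (by
      intro x
      rw [comp_sgn, comp_sgn]
      exact (mul_one _).trans (nat_sgn a.as x))
  naturality_naturality {i j a b} η := by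
    obtain rfl : a = b := LocallyDiscrete.eq_of_hom η
    obtain rfl : η = 𝟙 _ := Subsingleton.elim _ _
    ext x
    have h := comp₂_map₂ D rfl (𝟙 a.as.toLoc) x
    have h1 : ∀ e : trO D a.as x ⟶ trO D a.as x, e = 𝟙 _ →
      (app j.as).functor.map e ≫ nat a.as x = nat a.as x ≫ 𝟙 _ := by rintro _ rfl; simp
    exact h1 _ h
  naturality_id i := by
    ext x
    let c : trO D (𝟙 i.as) x ⟶ x := comp₂ (D.mapId i).hom x
    have h5 : c ≫ unit D i.as x = 𝟙 _ := comp₂_hom_inv _ x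
    have h : nat (𝟙 i.as) x ≫ 𝟙 _ = (app i.as).functor.map c ≫ 𝟙 _ ≫ 𝟙 _ := by
      have h6 : (app i.as).functor.map c ≫ (app i.as).functor.map (unit D i.as x) = 𝟙 _ := by
        rw [← Functor.map_comp, h5, CategoryTheory.Functor.map_id]
      rw [Category.comp_id, Category.comp_id, Category.comp_id, ← Category.id_comp (nat _ _),
        ← h6, Category.assoc, nat_id, Category.comp_id]
    exact h
  naturality_comp {i j k} a b := by
    ext x
    let c : trO D (a.as ≫ b.as) x ⟶ trO D b.as (trO D a.as x) := comp₂ (D.mapComp a b).hom x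
    have h5 : c ≫ mu D a.as b.as x = 𝟙 _ := comp₂_hom_inv _ x
    have h : nat (a.as ≫ b.as) x ≫ 𝟙 _ = (app k.as).functor.map c ≫ 𝟙 _ ≫
        nat b.as (trO D a.as x) ≫ 𝟙 _ ≫ nat a.as x ≫ 𝟙 _ := by
      simp only [Category.comp_id, Category.id_comp]
      rw [← nat_comp, ← Functor.map_comp_assoc, h5, CategoryTheory.Functor.map_id,
        Category.id_comp]
    exact h

/-- An isomorphism of transformations to a constant diagram from its components. -/
def constIsoMk {η θ : D ⟶ constPF I X} (k : ∀ i, capp η i ≅ capp θ i)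
    (h : ∀ {i j : I} (a : i ⟶ j) (x : D.obj ⟨i⟩), comp₂ (k j).hom (trO D a x) ≫ cnat θ a x =
      cnat η a x ≫ comp₂ (k i).hom x) : η ≅ θ :=
  Pseudofunctor.StrongTrans.isoMk (fun i => k i.as) (fun a => by
    ext x
    exact h a.as x)

/-- The component of an isomorphism of transformations to a constant diagram. -/
def kapp {η θ : D ⟶ constPF I X} (k : η ≅ θ) (i : I) : capp η i ≅ capp θ i where
  hom := k.hom.as.app ⟨i⟩
  inv := k.inv.as.app ⟨i⟩
  hom_inv_id := congrArg (fun t => t.as.app ⟨i⟩) k.hom_inv_id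
  inv_hom_id := congrArg (fun t => t.as.app ⟨i⟩) k.inv_hom_id

lemma kapp_cnat {η θ : D ⟶ constPF I X} (k : η ≅ θ)
    {i j : I} (a : i ⟶ j) (x : D.obj ⟨i⟩) : comp₂ (kapp k j).hom (trO D a x) ≫ cnat θ a x =
      cnat η a x ≫ comp₂ (kapp k i).hom x :=
  congrArg (fun t => comp₂ t x) (k.hom.as.naturality a.toLoc)

/-- The arrow of the total groupoid given by an arrow of a member of the diagram. -/
def inclM {i : I} {x y : D.obj ⟨i⟩} (g : x ⟶ y) : (⟨i, x⟩ : Total D) ⟶ ⟨i, y⟩ :=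
  Total.Arrow.mk (𝟙 i) (g ≫ unit D i y)

lemma trM_comp_unit_mu {i j : I} (a : i ⟶ j) {x y : D.obj ⟨i⟩} (g : x ⟶ y) :
    trM D a (g ≫ unit D i y) ≫ mu D (𝟙 i) a y =
      trM D a g ≫ eqToHom (by rw [Category.id_comp]) := by
  have h1 := unit_mu D a y
  rw [trM_comp, Category.assoc, h1]

lemma inclM_id {i : I} (x : D.obj ⟨i⟩) : inclM (𝟙 x) = 𝟙 (⟨i, x⟩ : Total D) :=
  congrArg (Total.Arrow.mk (y := ⟨i, x⟩) (x := ⟨i, x⟩) (𝟙 i)) (Category.id_comp (unit D i x))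

lemma inclM_comp {i : I} {x y z : D.obj ⟨i⟩} (g : x ⟶ y) (h : y ⟶ z) :
    inclM (g ≫ h) = inclM g ≫ inclM h := by
  have h2 := unit_nat D i h
  have h4 : ((g ≫ h) ≫ unit D i z) ≫ eqToHom (by rw [Category.id_comp]) =
      (g ≫ unit D i y) ≫ trM D (𝟙 i) (h ≫ unit D i z) ≫ mu D (𝟙 i) (𝟙 i) z := by
    rw [trM_comp_unit_mu, Category.assoc g, Category.assoc, h2, Category.assoc, Category.assoc]
  exact Total.hom_ext (Category.comp_id (𝟙 i)).symm h4

/-- The canonical arrow in the total groupoid associated to an arrow of the index. -/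
def lam {i j : I} (a : i ⟶ j) (x : D.obj ⟨i⟩) : (⟨j, trO D a x⟩ : Total D) ⟶ ⟨i, x⟩ :=
  Total.Arrow.mk a (𝟙 (trO D a x))

/-- Every arrow of the total groupoid factors as an arrow inside one member of the diagram followed
by a canonical arrow `lam`. Checks on the total groupoid can thus be made on these two kinds of
arrows. -/
lemma inclM_lam {i j : I} (a : i ⟶ j) (x : D.obj ⟨i⟩) {y : D.obj ⟨j⟩} (g : y ⟶ trO D a x) :
    inclM g ≫ lam a x = (Total.Arrow.mk a g : (⟨j, y⟩ : Total D).Arrow ⟨i, x⟩) := by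
  have h1 := mu_unit D a x
  have h3 : ((g ≫ unit D j (trO D a x)) ≫ trM D (𝟙 j) (𝟙 _) ≫ mu D a (𝟙 j) x) ≫
      eqToHom (by rw [Category.comp_id]) = g := by
    rw [trM_id, Category.id_comp, Category.assoc, Category.assoc,
      reassoc_of% h1]
    simp
  exact Total.hom_ext (Category.comp_id a) h3

/-- Naturality of the canonical arrows. With `inclM_unit_lam` and `inclM_mu_lam` it supplies the
transformation axioms for `incl`. -/
lemma inclM_trM_lam {i j : I} (a : i ⟶ j) {x y : D.obj ⟨i⟩} (g : x ⟶ y) :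
    inclM (trM D a g) ≫ lam a y = lam a x ≫ inclM g := by
  have h3 : trM D a g ≫ eqToHom (by rw [Category.id_comp]) =
      𝟙 _ ≫ trM D a (g ≫ unit D i y) ≫ mu D (𝟙 i) a y := by
    rw [trM_comp_unit_mu]
    exact (Category.id_comp _).symm
  exact (inclM_lam _ _ _).trans (Total.hom_ext (Category.id_comp a).symm h3)

lemma inclM_unit_lam (i : I) (x : D.obj ⟨i⟩) :
    inclM (unit D i x) ≫ lam (𝟙 i) x = 𝟙 _ := inclM_lam _ _ _

lemma inclM_mu_lam {i j k : I} (a : i ⟶ j) (b : j ⟶ k) (x : D.obj ⟨i⟩) :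
    inclM (mu D a b x) ≫ lam (a ≫ b) x = lam b (trO D a x) ≫ lam a x := by
  have h3 : mu D a b x = 𝟙 _ ≫ trM D b (𝟙 (trO D a x)) ≫ mu D a b x := by simp
  exact (inclM_lam _ _ _).trans
    (congrArg (Total.Arrow.mk (y := ⟨k, trO D b (trO D a x)⟩) (x := ⟨i, x⟩) (a ≫ b)) h3)

variable (D) in
/-- The inclusion functor of a member of a diagram into the total groupoid. -/
def inclF (i : I) : D.obj ⟨i⟩ ⥤ Total D where
  obj x := ⟨i, x⟩
  map g := inclM g
  map_id x := inclM_id x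
  map_comp g h := inclM_comp g h

/-- The inclusion of a member of a diagram into the total groupoid. -/
def inclApp [FiniteGroupoid I] (i : I) : D.obj ⟨i⟩ ⟶ tot D :=
  Hom.mk' (S := D.obj ⟨i⟩) (T := tot D) (inclF D i)
    (fun _ => 1) (by
      intro x y g
      change _ = 1 * ((D.obj ⟨i⟩).parity (g ≫ unit D i y) * (tr D (𝟙 i)).sgn y)
      rw [parity_comp, sgn_unit, mul_assoc, Int.units_mul_self, mul_one, one_mul])

/-- The functor from the total groupoid induced by a transformation to a constant diagram. -/
def descF (θ : D ⟶ constPF I X) : Total D ⥤ X where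
  obj p := (capp θ p.base).functor.obj p.pt
  map {y x} f := (capp θ y.base).functor.map f.fib ≫ cnat θ f.base x.pt
  map_id x := cnat_id θ x.base x.pt
  map_comp {z y x} f g := by
    have h1 := cnat_nat θ f.base g.fib
    have h2 := cnat_comp θ g.base f.base x.pt
    change (capp θ z.base).functor.map (f.fib ≫ trM D f.base g.fib ≫ mu D g.base f.base x.pt) ≫
      cnat θ (g.base ≫ f.base) x.pt = _
    rw [Functor.map_comp, Functor.map_comp, Category.assoc, Category.assoc, h2,
      reassoc_of% h1, Category.assoc]

lemma capp_unit_cnat (θ : D ⟶ constPF I X) {i : I} {x y : D.obj ⟨i⟩} (g : x ⟶ y) :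
    (capp θ i).functor.map (g ≫ unit D i y) ≫ cnat θ (𝟙 i) y = (capp θ i).functor.map g := by
  rw [Functor.map_comp, Category.assoc, cnat_id, Category.comp_id]

lemma descF_incl (θ : D ⟶ constPF I X) {i : I} {x y : D.obj ⟨i⟩} (g : x ⟶ y) :
    (descF θ).map (inclM g) = (capp θ i).functor.map g := capp_unit_cnat θ g

lemma descF_lam (θ : D ⟶ constPF I X) {i j : I} (a : i ⟶ j) (x : D.obj ⟨i⟩) :
    (descF θ).map (lam a x) = cnat θ a x := by
  have : (capp θ j).functor.map (𝟙 (trO D a x)) ≫ cnat θ a x = cnat θ a x := by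
    rw [CategoryTheory.Functor.map_id, Category.id_comp]
  exact this

/-- The morphism from the total groupoid induced by a transformation to a constant diagram. -/
def desc [FiniteGroupoid I] (θ : D ⟶ constPF I X) : tot D ⟶ X :=
  Hom.mk' (S := tot D) (T := X) (descF θ)
    (fun p : Total D => (capp θ p.base).sgn p.pt) (by
      intro (y : Total D) (x : Total D) (f : y ⟶ x)
      have h1 := cnat_sgn θ f.base x.pt
      have h2 := (capp θ y.base).sgn_nat f.fib
      change (D.obj ⟨y.base⟩).parity f.fib * (tr D f.base).sgn x.pt * (capp θ x.base).sgn x.pt =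
        (capp θ y.base).sgn y.pt *
          X.parity ((capp θ y.base).functor.map f.fib ≫ cnat θ f.base x.pt)
      rw [parity_comp, ← mul_assoc ((capp θ y.base).sgn y.pt), ← h2, h1]
      generalize (tr D f.base).sgn x.pt = m
      generalize (D.obj ⟨y.base⟩).parity f.fib = n
      generalize Hom.sgn (capp θ y.base) _ = p
      generalize X.parity _ = q
      decide +revert)

variable (D) in
/-- The canonical transformation from a diagram to the constant diagram at its total groupoid. -/
def incl [FiniteGroupoid I] : D ⟶ constPF I (tot D) :=
  constMk inclApp (fun {i j} a x => lam a x) (fun a => inclM_trM_lam a)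
    (fun {i j} a x => by
      have : 1 = (tr D a).sgn x * 1 *
          ((D.obj ⟨j⟩).parity (𝟙 (trO D a x)) * (tr D a).sgn x) := by
        rw [parity_id, mul_one, one_mul, Int.units_mul_self]
      exact this) inclM_unit_lam inclM_mu_lam

lemma kapp_desc {η θ : D ⟶ constPF I X} (k : η ≅ θ) {i j : I} (a : i ⟶ j) (x : D.obj ⟨i⟩)
    {y : D.obj ⟨j⟩} (g : y ⟶ trO D a x) :
    ((capp η j).functor.map g ≫ cnat η a x) ≫ comp₂ (kapp k i).hom x =
      comp₂ (kapp k j).hom y ≫ (capp θ j).functor.map g ≫ cnat θ a x := by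
  have h := comp₂_nat (kapp k j).hom g
  rw [Category.assoc, ← kapp_cnat, reassoc_of% h]

/-- Isomorphic transformations induce isomorphic morphisms. -/
def descCongr [FiniteGroupoid I] {η θ : D ⟶ constPF I X} (k : η ≅ θ) : desc η ≅ desc θ :=
  ParGrpd.isoMk (u := desc η) (v := desc θ)
    (NatIso.ofComponents (F := descF η) (G := descF θ)
      (fun p : Total D => isoOf (comp₂ (kapp k p.base).hom p.pt))
      (fun {y x : Total D} (f : y ⟶ x) => by
        exact kapp_desc k f.base x.pt f.fib))
    (fun p : Total D => Hom₂.sgn_eq (kapp k p.base).hom p.pt)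

/-- The constraint of the composite is the image under `f` surrounded by associators and unitors,
all of whose components are identities. -/
lemma cnat_comp_constTrans (θ : D ⟶ constPF I X) {Y : ParGrpd} (f : X ⟶ Y) {i j : I} (a : i ⟶ j)
    (x : D.obj ⟨i⟩) : cnat (θ ≫ constTrans I f) a x = f.functor.map (cnat θ a x) := by
  have h : cnat (θ ≫ constTrans I f) a x = (𝟙 _ ≫ f.functor.map (cnat θ a x) ≫ 𝟙 _ ≫
    (𝟙 _ ≫ 𝟙 _) ≫ 𝟙 _) := rfl
  rw [h]
  simp
  rfl

/-- The morphism induced by a composite with a constant transformation. -/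
def descComp [FiniteGroupoid I] (θ : D ⟶ constPF I X) {Y : ParGrpd} (f : X ⟶ Y) :
    desc (θ ≫ constTrans I f) ≅ desc θ ≫ f :=
  ParGrpd.isoMk (u := desc (θ ≫ constTrans I f)) (v := desc θ ≫ f)
    (NatIso.ofComponents (F := descF (θ ≫ constTrans I f)) (G := descF θ ⋙ f.functor)
      (fun p => Iso.refl _)
      (fun {y x : Total D} (g : y ⟶ x) => by
        have h : (descF (θ ≫ constTrans I f)).map g = f.functor.map ((descF θ).map g) := by
          refine Eq.trans ?_ (f.functor.map_comp _ _).symm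
          exact congrArg (fun t => f.functor.map ((capp θ y.base).functor.map g.fib) ≫ t)
            (cnat_comp_constTrans θ f g.base x.pt)
        exact (Category.comp_id _).trans (h.trans (Category.id_comp _).symm)))
    (fun p : Total D => by
      have h : (desc θ ≫ f).sgn p = (desc (θ ≫ constTrans I f)).sgn p :=
        (comp_sgn (desc θ) f p).trans (comp_sgn (capp θ p.base) f p.pt).symm
      exact h.trans ((mul_one _).symm.trans (congrArg _ (Y.parity_id _).symm)))

/-- The restriction of an induced morphism along the inclusions. -/
def inclDesc [FiniteGroupoid I] (θ : D ⟶ constPF I X) :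
    incl D ≫ constTrans I (desc θ) ≅ θ :=
  constIsoMk (fun i => ParGrpd.isoMk (u := inclApp i ≫ desc θ) (v := capp θ i)
    (NatIso.ofComponents (F := inclF D i ⋙ descF θ) (G := (capp θ i).functor) (fun x => Iso.refl _)
      (fun {y x} g =>
        (Category.comp_id _).trans ((descF_incl θ g).trans (Category.id_comp _).symm)))
    (fun x => by
      have h : (inclApp i ≫ desc θ).sgn x = (capp θ i).sgn x :=
        (comp_sgn (inclApp i) (desc θ) x).trans (one_mul ((capp θ i).sgn x))
      exact h.symm.trans ((mul_one _).symm.trans (congrArg _ (X.parity_id _).symm))))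
    (fun {i j} a x => by
      exact (Category.id_comp _).trans (((descF_lam θ a x).symm.trans
        (cnat_comp_constTrans (incl D) (desc θ) a x).symm).trans (Category.comp_id _).symm))

end Diagram
end
end SignedLinAlg

/-! ### The total groupoid is the homotopy sum -/

namespace SignedLinAlg

noncomputable section

open ParGrpd Limits Bicategory

namespace ParGrpd

variable {A B C R : ParGrpd} {f : A ⟶ C} {g : B ⟶ C} {p : R ⟶ A} {q : R ⟶ B}
  {κ : p ≫ f ≅ q ≫ g}

lemma IsHPullback.faithful (h : IsHPullback κ) {x y : R} (a b : x ⟶ y)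
    (h1 : p.functor.map a = p.functor.map b) (h2 : q.functor.map a = q.functor.map b) : a = b :=
  have : (comparison κ).IsEquivalence := h
  (comparison κ).map_injective (CategoricalPullback.hom_ext h1 h2)

lemma IsHPullback.full (h : IsHPullback κ) {x y : R} (s : p.functor.obj x ⟶ p.functor.obj y)
    (t : q.functor.obj x ⟶ q.functor.obj y)
    (w : f.functor.map s ≫ (comp₂ κ.hom y : f.functor.obj _ ⟶ g.functor.obj _) =
      (comp₂ κ.hom x : f.functor.obj _ ⟶ g.functor.obj _) ≫ g.functor.map t) :
    ∃ a : x ⟶ y, p.functor.map a = s ∧ q.functor.map a = t := by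
  have : (comparison κ).IsEquivalence := h
  obtain ⟨a, ha⟩ := (comparison κ).map_surjective
    (⟨s, t, w⟩ : (comparison κ).obj x ⟶ (comparison κ).obj y)
  exact ⟨a, congrArg CategoricalPullback.Hom.fst ha, congrArg CategoricalPullback.Hom.snd ha⟩

lemma IsHPullback.essSurj (h : IsHPullback κ) (m : A) (n : B)
    (φ : f.functor.obj m ⟶ g.functor.obj n) :
    ∃ (x : R) (i : p.functor.obj x ⟶ m) (j : q.functor.obj x ⟶ n),
      f.functor.map i ≫ φ =
        (comp₂ κ.hom x : f.functor.obj _ ⟶ g.functor.obj _) ≫ g.functor.map j := by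
  have : (comparison κ).IsEquivalence := h
  let z : CategoricalPullback f.functor g.functor := ⟨m, n, isoOf φ⟩
  let e := (comparison κ).objObjPreimageIso z
  exact ⟨_, e.hom.fst, e.hom.snd, e.hom.w⟩

end ParGrpd

namespace Diagram

variable {I : Type} [Groupoid.{0} I] {D M : Pseudofunctor (LocallyDiscrete I) ParGrpd}
  {X T : ParGrpd}

/-- The components of the naturality constraint of a transformation. -/
def rnat (r : M ⟶ D) {i j : I} (a : i ⟶ j) (x : M.obj ⟨i⟩) :
    (r.app ⟨j⟩).functor.obj (trO M a x) ⟶ trO D a ((r.app ⟨i⟩).functor.obj x) :=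
  comp₂ (r.naturality a.toLoc).hom x

lemma rnat_id (r : M ⟶ D) {i : I} (x : M.obj ⟨i⟩) :
    (r.app ⟨i⟩).functor.map (unit M i x) ≫ rnat r (𝟙 i) x =
      unit D i ((r.app ⟨i⟩).functor.obj x) := by
  have h := congrArg (fun t => comp₂ t x) (r.naturality_id ⟨i⟩)
  let y := (r.app ⟨i⟩).functor.obj x
  let c : trO M (𝟙 i) x ⟶ x := comp₂ (M.mapId ⟨i⟩).hom x
  let c' : trO D (𝟙 i) y ⟶ y := comp₂ (D.mapId ⟨i⟩).hom y
  have h4 : rnat r (𝟙 i) x ≫ c' = (r.app ⟨i⟩).functor.map c ≫ 𝟙 _ ≫ 𝟙 _ := h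
  have h5 : unit M i x ≫ c = 𝟙 _ := comp₂_inv_hom _ x
  have h6 : c' ≫ unit D i y = 𝟙 _ := comp₂_hom_inv _ y
  have h7 : (r.app ⟨i⟩).functor.map (unit M i x) ≫ (r.app ⟨i⟩).functor.map c = 𝟙 _ := by
    rw [← Functor.map_comp, h5, CategoryTheory.Functor.map_id]
  rw [Category.comp_id, Category.comp_id] at h4
  calc _ = (r.app ⟨i⟩).functor.map (unit M i x) ≫ rnat r (𝟙 i) x ≫ c' ≫ unit D i y := by
        rw [h6, Category.comp_id]
    _ = _ := by
        rw [reassoc_of% h4, reassoc_of% h7]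

lemma inclM_injective {i : I} {x y : D.obj ⟨i⟩} {g h : x ⟶ y} (e : inclM g = inclM h) : g = h := by
  have e' : (Total.Arrow.mk (𝟙 i) (g ≫ unit D i y) : (⟨i, x⟩ : Total D).Arrow ⟨i, y⟩) =
    Total.Arrow.mk (𝟙 i) (h ≫ unit D i y) := e
  simp only [Total.Arrow.mk.injEq, heq_eq_eq, true_and] at e'
  exact (cancel_mono _).1 e'

variable [FiniteGroupoid I]

lemma cnat_comp_incl (r : M ⟶ D) {i j : I} (a : i ⟶ j) (x : M.obj ⟨i⟩) :
    cnat (r ≫ incl D) a x = inclM (rnat r a x) ≫ lam a ((r.app ⟨i⟩).functor.obj x) := by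
  have h : cnat (r ≫ incl D) a x =
    𝟙 _ ≫ inclM (rnat r a x) ≫ 𝟙 _ ≫ lam a ((r.app ⟨i⟩).functor.obj x) ≫ 𝟙 _ := rfl
  rw [h]
  exact (Category.id_comp _).trans (congrArg _ ((Category.id_comp _).trans (Category.comp_id _)))

/-- The map of total groupoids induced by `r` keeps the index part of an arrow. This makes the base
of an arrow readable after applying it. -/
lemma descF_comp_incl (r : M ⟶ D) {i j : I} (a : i ⟶ j) (x : M.obj ⟨i⟩) {y : M.obj ⟨j⟩}
    (g : y ⟶ trO M a x) :
    (descF (r ≫ incl D)).map (Total.Arrow.mk a g : (⟨j, y⟩ : Total M) ⟶ ⟨i, x⟩) =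
      (Total.Arrow.mk a ((r.app ⟨j⟩).functor.map g ≫ rnat r a x) :
        (⟨j, (r.app ⟨j⟩).functor.obj y⟩ : Total D) ⟶ ⟨i, (r.app ⟨i⟩).functor.obj x⟩) := by
  have h : (descF (r ≫ incl D)).map (Total.Arrow.mk a g : (⟨j, y⟩ : Total M) ⟶ ⟨i, x⟩) =
    inclM ((r.app ⟨j⟩).functor.map g) ≫ cnat (r ≫ incl D) a x := rfl
  rw [h, cnat_comp_incl, ← inclM_lam, inclM_comp]
  exact (Category.assoc _ _ _).symm

variable (D) in
/-- The canonical cocone under a diagram of parity groupoids. -/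
def sumCocone : HCocone D (tot D) := ⟨D, 𝟙 D, incl D⟩

/-- The span out of the total groupoid induced by a cocone. -/
def totSpan (d : HCocone D T) : HSpan (tot D) T :=
  ⟨tot d.apex, desc (d.left ≫ incl D), desc d.right⟩

/-- Every member of `M` is the pullback of `tot M` along the inclusion of the corresponding member
of `D`: an arrow from a point over `i` to the image of `(j, m)` is an index arrow `a` with a fibre
part, and transporting `m` along `a` moves the datum into the member over `i`. -/
lemma isHPullback_incl (r : M ⟶ D) (i : I)
    (κ : r.app ⟨i⟩ ≫ inclApp i ≅ inclApp (D := M) i ≫ desc (r ≫ incl D))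
    (hκ : ∀ x : M.obj ⟨i⟩, comp₂ κ.hom x = 𝟙 (⟨i, (r.app ⟨i⟩).functor.obj x⟩ : Total D)) :
    IsHPullback κ := by
  refine IsHPullback.intro κ (fun x => 𝟙 (⟨i, (r.app ⟨i⟩).functor.obj x⟩ : Total D)) hκ
    (fun x y a b _ h => inclM_injective h) ?_ ?_
  · intro x y s (t : Total.Arrow _ _) w
    obtain ⟨a, g⟩ := t
    change i ⟶ i at a
    change x ⟶ trO M a y at g
    have w1 : inclM s ≫ 𝟙 _ = 𝟙 _ ≫
      (descF (r ≫ incl D)).map (Total.Arrow.mk a g : (⟨i, x⟩ : Total M) ⟶ ⟨i, y⟩) := w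
    rw [Category.comp_id, Category.id_comp, descF_comp_incl] at w1
    -- An arrow that becomes vertical in `tot D` was already vertical in `tot M`, since the base is
    -- preserved.
    obtain rfl : 𝟙 i = a := congrArg Total.Arrow.base w1
    have w2 : (Total.Arrow.mk (𝟙 i) (s ≫ unit D i _) : (⟨i, _⟩ : Total D).Arrow ⟨i, _⟩) =
      Total.Arrow.mk (𝟙 i) ((r.app ⟨i⟩).functor.map g ≫ rnat r (𝟙 i) y) := w1
    simp only [Total.Arrow.mk.injEq, heq_eq_eq, true_and] at w2
    refine ⟨g ≫ inv (unit M i y), ?_, ?_⟩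
    · rw [← cancel_mono (unit D i _), w2, ← rnat_id, ← Functor.map_comp_assoc,
        Category.assoc, IsIso.inv_hom_id, Category.comp_id]
    · have : (Total.Arrow.mk (𝟙 i) ((g ≫ inv (unit M i y)) ≫ unit M i y) :
        (⟨i, x⟩ : Total M).Arrow ⟨i, y⟩) = Total.Arrow.mk (𝟙 i) g := by
        rw [Category.assoc, IsIso.inv_hom_id, Category.comp_id]
      exact this
  · rintro x' ⟨j, m⟩ (φ : Total.Arrow _ _)
    let a : j ⟶ i := φ.base
    let g : x' ⟶ trO D a ((r.app ⟨j⟩).functor.obj m) := φ.fib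
    refine ⟨trO M a m, rnat r a m ≫ inv g, lam a m, ?_⟩
    have h : inclM (rnat r a m ≫ inv g) ≫ (Total.Arrow.mk a g :
      (⟨i, x'⟩ : Total D) ⟶ ⟨j, (r.app ⟨j⟩).functor.obj m⟩) =
      𝟙 _ ≫ (descF (r ≫ incl D)).map (lam a m) := by
      rw [← inclM_lam, ← Category.assoc, ← inclM_comp, Category.assoc, IsIso.inv_hom_id,
        Category.comp_id, descF_lam, cnat_comp_incl]
      exact (Category.id_comp _).symm
    exact h

lemma isComposite_totSpan (d : HCocone D T) : (sumCocone D).IsComposite (totSpan d) d :=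
  ⟨d.left, incl d.apex, (inclDesc (d.left ≫ incl D)).symm, ⟨ρ_ _⟩, ⟨inclDesc d.right⟩,
    fun i => isHPullback_incl d.left i _ (fun _ => rfl)⟩

/-- Descent: a parity groupoid over `tot D` is recovered as the total groupoid of its pullbacks to
the members of `D`. It gives the uniqueness half of the universal property. -/
lemma isEquivalence_desc {P : ParGrpd} {v : P ⟶ tot D} (r : M ⟶ D) (s : M ⟶ constPF I P)
    (κ : r ≫ incl D ≅ s ≫ constTrans I v)
    (h : ∀ i : I, IsHPullback (f := inclApp i) (g := v) (p := r.app ⟨i⟩) (q := capp s i)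
      (kapp κ i)) : (desc s).functor.IsEquivalence := by
  let V : P ⥤ Total D := v.functor
  let K : ∀ (i : I) (x : M.obj ⟨i⟩), (⟨i, (r.app ⟨i⟩).functor.obj x⟩ : Total D) ⟶
    V.obj ((capp s i).functor.obj x) := fun i x => comp₂ (kapp κ i).hom x
  -- Conjugation by `K` compares the image in `tot D` of an arrow of `tot M` with the image under
  -- `V` of the induced arrow of `P`. The index part can be read off on the `tot D` side.
  have hK : ∀ {i j : I} (a : i ⟶ j) (x : M.obj ⟨i⟩) {y : M.obj ⟨j⟩} (g : y ⟶ trO M a x),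
      (Total.Arrow.mk a ((r.app ⟨j⟩).functor.map g ≫ rnat r a x) :
        (⟨j, (r.app ⟨j⟩).functor.obj y⟩ : Total D) ⟶ ⟨i, (r.app ⟨i⟩).functor.obj x⟩) ≫ K i x =
      K j y ≫ V.map ((capp s j).functor.map g ≫ cnat s a x) := by
    intro i j a x y g
    have h1 := kapp_desc κ a x g
    have h2 := descF_comp_incl r a x g
    have h3 := cnat_comp_constTrans s v a x
    have h4 : V.map ((capp s j).functor.map g ≫ cnat s a x) =
      V.map ((capp s j).functor.map g) ≫ V.map (cnat s a x) := V.map_comp _ _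
    rw [h4, ← h2]
    exact h1.trans (congrArg (fun t => comp₂ (kapp κ j).hom y ≫
      v.functor.map ((capp s j).functor.map g) ≫ t) h3)
  suffices (descF s).IsEquivalence from this
  refine @Functor.IsEquivalence.mk _ _ _ _ _ ⟨?_⟩ ⟨?_⟩ ⟨?_⟩
  · rintro ⟨j, y⟩ ⟨i, x⟩ ⟨a, g⟩ ⟨a', g'⟩ e
    change i ⟶ j at a a'
    change y ⟶ trO M a x at g
    change y ⟶ trO M a' x at g'
    have e' : (capp s j).functor.map g ≫ cnat s a x = (capp s j).functor.map g' ≫ cnat s a' x := e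
    have h1 := hK a x g
    rw [e', ← hK a' x g', cancel_mono] at h1
    obtain rfl : a = a' := congrArg Total.Arrow.base h1
    rw [cancel_mono] at e'
    have h2 : (Total.Arrow.mk a ((r.app ⟨j⟩).functor.map g ≫ rnat r a x) :
        (⟨j, _⟩ : Total D).Arrow ⟨i, _⟩) = Total.Arrow.mk a _ := h1
    simp only [Total.Arrow.mk.injEq, heq_eq_eq, true_and] at h2
    rw [cancel_mono] at h2
    rw [(h j).faithful g g' h2 e']
  · rintro ⟨j, y⟩ ⟨i, x⟩ β
    change (capp s j).functor.obj y ⟶ (capp s i).functor.obj x at β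
    -- The arrow `β`, conjugated into `tot D`, supplies the index part `a` of the required lift.
    -- Removing the constraints along `a` leaves a problem inside the member over `j`, where the
    -- pullback property applies.
    obtain ⟨⟨a, g₀⟩, hF⟩ : ∃ F : (⟨j, (r.app ⟨j⟩).functor.obj y⟩ : Total D).Arrow
      ⟨i, (r.app ⟨i⟩).functor.obj x⟩, F = K j y ≫ V.map β ≫ inv (K i x) := ⟨_, rfl⟩
    change i ⟶ j at a
    change (r.app ⟨j⟩).functor.obj y ⟶ trO D a ((r.app ⟨i⟩).functor.obj x) at g₀
    have hF' : (Total.Arrow.mk a g₀ : (⟨j, (r.app ⟨j⟩).functor.obj y⟩ : Total D) ⟶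
      ⟨i, (r.app ⟨i⟩).functor.obj x⟩) ≫ K i x = K j y ≫ V.map β := by
      have h1 : (Total.Arrow.mk a g₀ : (⟨j, (r.app ⟨j⟩).functor.obj y⟩ : Total D) ⟶
        ⟨i, (r.app ⟨i⟩).functor.obj x⟩) = K j y ≫ V.map β ≫ inv (K i x) := hF
      rw [h1, Category.assoc, Category.assoc, IsIso.inv_hom_id, Category.comp_id]
    have w : inclM (g₀ ≫ inv (rnat r a x)) ≫ K j (trO M a x) =
        K j y ≫ V.map (β ≫ inv (cnat s a x)) := by
      have h1 := hK a x (𝟙 _)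
      rw [CategoryTheory.Functor.map_id, CategoryTheory.Functor.map_id, Category.id_comp,
        Category.id_comp, ← inclM_lam] at h1
      rw [← cancel_mono (V.map (cnat s a x)), Category.assoc, ← h1, Category.assoc, Category.assoc (K j y),
        ← V.map_comp, Category.assoc, IsIso.inv_hom_id, Category.comp_id, ← hF', ← inclM_lam,
        ← Category.assoc, ← Category.assoc, ← inclM_comp, Category.assoc g₀, IsIso.inv_hom_id,
        Category.comp_id]
    obtain ⟨g, h1, h2⟩ := (h j).full (x := y) (y := trO M a x) (g₀ ≫ inv (rnat r a x))
      (β ≫ inv (cnat s a x)) w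
    refine ⟨Total.Arrow.mk a g, ?_⟩
    change (capp s j).functor.map g ≫ cnat s a x = β
    rw [h2, Category.assoc, IsIso.inv_hom_id, Category.comp_id]
  · intro n
    obtain ⟨x, -, j, -⟩ := (h (V.obj n).base).essSurj (V.obj n).pt n (𝟙 (V.obj n))
    exact ⟨⟨_, x⟩, ⟨isoOf j⟩⟩

/-- If `N` is any factorization of `d`, the square in `IsComposite` presents its apex as in
`isEquivalence_desc`, and that equivalence respects both legs. -/
lemma equivalent_totSpan (d : HCocone D T) (N : HSpan (tot D) T)
    (h : (sumCocone D).IsComposite N d) : (totSpan d).Equivalent N := by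
  obtain ⟨r, s, κ, ⟨e1⟩, ⟨e2⟩, hp⟩ := h
  refine ⟨desc s, isEquivalence_desc r s κ hp, ⟨?_⟩, ⟨?_⟩⟩
  · exact descCongr (whiskerRightIso (e1.symm ≪≫ ρ_ _) (incl D) ≪≫ κ) ≪≫ descComp s N.left
  · exact descCongr e2.symm ≪≫ descComp s N.right

theorem isHomotopySum_sumCocone : (sumCocone D).IsHomotopySum := fun T d =>
  ⟨Lin.ofSpan (totSpan d), ⟨_, rfl, isComposite_totSpan d⟩, by
    rintro _ ⟨N, rfl, h⟩
    exact (Quotient.sound (equivalent_totSpan d N h)).symm⟩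

end Diagram
end
end SignedLinAlg

/-! ### Composition of factorizations of cocones -/

namespace SignedLinAlg

noncomputable section

open ParGrpd Limits Bicategory

namespace ParGrpd

/-- Pasting: if `E` is `A ×_X F` and `E'` is `E ×_Y G`, then `E'` is `A ×_X (F ×_Y G)`. Lifts are
built first through `h` and then through `h'`. The 2-cells are only prescribed on components, so
that composites with identity coherence cells can be used. -/
lemma IsHPullback.paste {A X Y F G E E' : ParGrpd} {p : E ⟶ A} {s : E ⟶ F} {c : A ⟶ X}
    {fl : F ⟶ X} {κ : p ≫ c ≅ s ≫ fl} (h : IsHPullback κ) {fr : F ⟶ Y} {d : E ⟶ Y}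
    (e : s ≫ fr ≅ d) {p' : E' ⟶ E} {s' : E' ⟶ G} {gl : G ⟶ Y} {κ' : p' ≫ d ≅ s' ≫ gl}
    (h' : IsHPullback κ') (l : (p' ≫ s) ≫ fr ≅ s' ≫ gl)
    (hl : ∀ x, (comp₂ l.hom x : fr.functor.obj _ ⟶ gl.functor.obj _) =
      (comp₂ e.hom (p'.functor.obj x) : fr.functor.obj _ ⟶ d.functor.obj _) ≫ comp₂ κ'.hom x)
    (κ'' : (p' ≫ p) ≫ c ≅ hlift l ≫ hfst fr gl ≫ fl)
    (hκ : ∀ x, comp₂ κ''.hom x = comp₂ κ.hom (p'.functor.obj x)) : IsHPullback κ'' := by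
  let K : ∀ x : E, c.functor.obj (p.functor.obj x) ⟶ fl.functor.obj (s.functor.obj x) :=
    fun x => comp₂ κ.hom x
  let K' : ∀ x : E', d.functor.obj (p'.functor.obj x) ⟶ gl.functor.obj (s'.functor.obj x) :=
    fun x => comp₂ κ'.hom x
  let e₁ : ∀ x : E, fr.functor.obj (s.functor.obj x) ⟶ d.functor.obj x := fun x => comp₂ e.hom x
  have e₁_nat : ∀ {x y : E} (w : x ⟶ y),
      fr.functor.map (s.functor.map w) ≫ e₁ y = e₁ x ≫ d.functor.map w := fun w => comp₂_nat e.hom w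
  have K_nat : ∀ {x y : E} (w : x ⟶ y), c.functor.map (p.functor.map w) ≫ K y =
      K x ≫ fl.functor.map (s.functor.map w) := fun w => comp₂_nat κ.hom w
  refine IsHPullback.intro κ'' (fun x => K (p'.functor.obj x)) hκ ?_ ?_ ?_
  · intro x y a b h1 h2
    exact h'.faithful a b (h.faithful _ _ h1 (congrArg CategoricalPullback.Hom.fst h2))
      (congrArg CategoricalPullback.Hom.snd h2)
  · intro x y u (v : CategoricalPullback.Hom _ _) w
    obtain ⟨w₁, h1, h2⟩ := h.full u v.fst w
    let v₁ : s.functor.obj (p'.functor.obj x) ⟶ s.functor.obj (p'.functor.obj y) := v.fst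
    let v₂ : s'.functor.obj x ⟶ s'.functor.obj y := v.snd
    have h3 : fr.functor.map v₁ ≫ e₁ (p'.functor.obj y) ≫ K' y =
        (e₁ (p'.functor.obj x) ≫ K' x) ≫ gl.functor.map v₂ :=
      ((congrArg (fun t => fr.functor.map v₁ ≫ t) (hl y)).symm.trans v.w).trans
        (congrArg (fun t => t ≫ gl.functor.map v₂) (hl x))
    have h2' : s.functor.map w₁ = v₁ := h2
    have h4 : d.functor.map w₁ ≫ K' y = K' x ≫ gl.functor.map v₂ := by
      rw [← cancel_epi (e₁ (p'.functor.obj x)), ← Category.assoc, ← e₁_nat, Category.assoc,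
        h2', h3, Category.assoc]
    obtain ⟨a, h5, h6⟩ := h'.full w₁ v₂ h4
    exact ⟨a, (congrArg _ h5).trans h1,
      CategoricalPullback.hom_ext ((congrArg (fun t => s.functor.map t) h5).trans h2) h6⟩
  · intro m n φ
    change c.functor.obj m ⟶ fl.functor.obj (CategoricalPullback.fst n) at φ
    obtain ⟨x, i, j, h1⟩ := h.essSurj m (CategoricalPullback.fst n) φ
    let ψ : fr.functor.obj (CategoricalPullback.fst n) ⟶ gl.functor.obj (CategoricalPullback.snd n) :=
      (CategoricalPullback.iso n).hom
    obtain ⟨y, i', j', h2⟩ := h'.essSurj x (CategoricalPullback.snd n)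
      (inv (e₁ x) ≫ fr.functor.map j ≫ ψ)
    have h2' : d.functor.map i' ≫ inv (e₁ x) ≫ fr.functor.map j ≫ ψ =
      K' y ≫ gl.functor.map j' := h2
    have h1' : c.functor.map i ≫ φ = K x ≫ fl.functor.map j := h1
    have w : fr.functor.map (s.functor.map i' ≫ j) ≫ ψ =
        (e₁ (p'.functor.obj y) ≫ K' y) ≫ gl.functor.map j' := by
      rw [Functor.map_comp, Category.assoc, Category.assoc, ← h2', ← reassoc_of% (e₁_nat i'),
        IsIso.hom_inv_id_assoc]
    refine ⟨y, p.functor.map i' ≫ i, CategoricalPullback.Hom.mk (s.functor.map i' ≫ j) j'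
      (w.trans (congrArg (fun t => t ≫ gl.functor.map j') (hl y)).symm), ?_⟩
    have : c.functor.map (p.functor.map i' ≫ i) ≫ φ =
        K (p'.functor.obj y) ≫ fl.functor.map (s.functor.map i' ≫ j) := by
      rw [Functor.map_comp, Functor.map_comp, Category.assoc, h1', ← reassoc_of% (K_nat i')]
    exact this

end ParGrpd

namespace Diagram

variable {I : Type} [Groupoid.{0} I] {D : Pseudofunctor (LocallyDiscrete I) ParGrpd}
  {P Q X Y Z : ParGrpd}

/-- Composition with a constant identity transformation. -/
def constTransId (θ : D ⟶ constPF I X) : θ ≫ constTrans I (𝟙 X) ≅ θ :=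
  constIsoMk (fun i => ρ_ (capp θ i)) (fun a x => by
    exact (Category.id_comp _).trans
      ((cnat_comp_constTrans θ (𝟙 X) a x).symm.trans (Category.comp_id _).symm))

/-- Composition with a composite of constant transformations. -/
def constTransComp (θ : D ⟶ constPF I X) (f : X ⟶ Y) (g : Y ⟶ Z) :
    (θ ≫ constTrans I f) ≫ constTrans I g ≅ θ ≫ constTrans I (f ≫ g) :=
  constIsoMk (fun i => α_ (capp θ i) f g) (fun a x => by
    have h1 : cnat ((θ ≫ constTrans I f) ≫ constTrans I g) a x =
        g.functor.map (f.functor.map (cnat θ a x)) := by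
      rw [cnat_comp_constTrans, cnat_comp_constTrans]
      rfl
    have h2 : cnat (θ ≫ constTrans I (f ≫ g)) a x = g.functor.map (f.functor.map (cnat θ a x)) :=
      cnat_comp_constTrans θ (f ≫ g) a x
    exact (Category.id_comp _).trans ((h2.trans h1.symm).trans (Category.comp_id _).symm))

section Lift

variable {f : P ⟶ X} {g : Q ⟶ X} (s₁ : D ⟶ constPF I P) (s₂ : D ⟶ constPF I Q)
  (l : s₁ ≫ constTrans I f ≅ s₂ ≫ constTrans I g)

/-- The component of an isomorphism between composites with constant transformations. -/
def lapp (i : I) : capp s₁ i ≫ f ≅ capp s₂ i ≫ g := kapp l i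

lemma lapp_nat {i j : I} (a : i ⟶ j) (x : D.obj ⟨i⟩) :
    f.functor.map (cnat s₁ a x) ≫ comp₂ (lapp s₁ s₂ l i).hom x =
      comp₂ (lapp s₁ s₂ l j).hom (trO D a x) ≫ g.functor.map (cnat s₂ a x) := by
  have h := kapp_cnat l a x
  have h1 := cnat_comp_constTrans s₁ f a x
  have h2 := cnat_comp_constTrans s₂ g a x
  exact ((congrArg (fun t => t ≫ comp₂ (kapp l i).hom x) h1).symm.trans h.symm).trans
    (congrArg (fun t => comp₂ (kapp l j).hom (trO D a x) ≫ t) h2)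

/-- The transformation to the constant diagram at a homotopy pullback. -/
def liftTrans : D ⟶ constPF I (hpullback f g) :=
  constMk (fun i => hlift (lapp s₁ s₂ l i))
    (fun a x => CategoricalPullback.Hom.mk (cnat s₁ a x) (cnat s₂ a x) (lapp_nat s₁ s₂ l a x))
    (fun a _ _ u => CategoricalPullback.hom_ext (cnat_nat s₁ a u) (cnat_nat s₂ a u))
    (fun a x => cnat_sgn s₁ a x)
    (fun i x => CategoricalPullback.hom_ext (cnat_id s₁ i x) (cnat_id s₂ i x))
    (fun a b x => CategoricalPullback.hom_ext (cnat_comp s₁ a b x) (cnat_comp s₂ a b x))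

/-- The first projection of a lift. -/
def liftTransFst : liftTrans s₁ s₂ l ≫ constTrans I (hfst f g) ≅ s₁ :=
  constIsoMk (fun i => hlift_fst (lapp s₁ s₂ l i)) (fun a x => by
    have h := cnat_comp_constTrans (liftTrans s₁ s₂ l) (hfst f g) a x
    exact (Category.id_comp _).trans (h.symm.trans (Category.comp_id _).symm))

/-- The second projection of a lift. -/
def liftTransSnd : liftTrans s₁ s₂ l ≫ constTrans I (hsnd f g) ≅ s₂ :=
  constIsoMk (fun i => hlift_snd (lapp s₁ s₂ l i)) (fun a x => by
    have h := cnat_comp_constTrans (liftTrans s₁ s₂ l) (hsnd f g) a x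
    exact (Category.id_comp _).trans (h.symm.trans (Category.comp_id _).symm))

end Lift

lemma isComposite_ident (c : HCocone D X) : c.IsComposite (HSpan.ident X) c :=
  ⟨𝟙 _, c.right, λ_ _ ≪≫ (constTransId c.right).symm, ⟨λ_ _⟩, ⟨constTransId c.right⟩,
    fun _ => HSpan.isHPullback_of_right _ (inferInstanceAs (𝟭 _).IsEquivalence)⟩

/-- Factorizations compose. With `isComposite_ident` this permits the usual comparison of two
universal cocones, although the factorization relation only involves spans up to equivalence. -/
lemma isComposite_comp {c : HCocone D X} {F : HSpan X Y} {d : HCocone D Y} {G : HSpan Y Z}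
    {d' : HCocone D Z} (h : c.IsComposite F d) (h' : d.IsComposite G d') :
    c.IsComposite (F.comp G) d' := by
  obtain ⟨r, s, κ, ⟨e1⟩, ⟨e2⟩, hp⟩ := h
  obtain ⟨r', s', κ', ⟨e1'⟩, ⟨e2'⟩, hp'⟩ := h'
  let l : (r' ≫ s) ≫ constTrans I F.right ≅ s' ≫ constTrans I G.left :=
    α_ _ _ _ ≪≫ whiskerLeftIso r' e2 ≪≫ κ'
  let t := liftTrans (r' ≫ s) s' l
  let κ'' : (r' ≫ r) ≫ c.right ≅ t ≫ constTrans I (hfst F.right G.left ≫ F.left) :=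
    α_ _ _ _ ≪≫ whiskerLeftIso r' κ ≪≫ (α_ _ _ _).symm ≪≫
      whiskerRightIso (liftTransFst (r' ≫ s) s' l).symm (constTrans I F.left) ≪≫
      constTransComp t _ _
  refine ⟨r' ≫ r, t, κ'', ⟨α_ _ _ _ ≪≫ whiskerLeftIso r' e1 ≪≫ e1'⟩,
    ⟨(constTransComp t _ _).symm ≪≫
      whiskerRightIso (liftTransSnd (r' ≫ s) s' l) (constTrans I G.right) ≪≫ e2'⟩, fun i => ?_⟩
  refine IsHPullback.paste (hp i) (kapp e2 i) (hp' i) (lapp (r' ≫ s) s' l i) ?_ _ ?_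
  · intro x
    exact Category.id_comp _
  · intro x
    let y := (r'.app ⟨i⟩).functor.obj x
    let k : (capp c.right i).functor.obj ((r.app ⟨i⟩).functor.obj y) ⟶
      F.left.functor.obj ((capp s i).functor.obj y) := comp₂ (kapp κ i).hom y
    have : 𝟙 _ ≫ k ≫ 𝟙 _ ≫ F.left.functor.map (𝟙 _) ≫ 𝟙 _ = k := by simp
    exact this

end Diagram
end
end SignedLinAlg

namespace SignedLinAlg

noncomputable section

open ParGrpd Limits

/-! ### The cardinality functor -/

section Points

variable {S T V : ParGrpd}

lemma IsOrientable.of_hom {x y : S} (hx : IsOrientable x) (a : x ⟶ y) : IsOrientable y := by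
  intro g
  have h := hx (a ≫ g ≫ inv a)
  rw [parity_comp, parity_comp, parity_inv, mul_comm (S.parity g), ← mul_assoc, mul_inv_cancel,
    one_mul] at h
  exact h

lemma entry_def (M : HSpan S T) (s : S) (t : T) :
    entry M s t = gint M.apex (fun m =>
      (sgnQ (M.left.sgn m) • shom S s (M.left.functor.obj m)) *
        (sgnQ (M.right.sgn m) • shom T (M.right.functor.obj m) t)) := rfl

/-- For the identity span one of the two kernels is absorbed by the Yoneda formula `gint_shom`. -/
lemma entry_ident (x y : S) : entry (HSpan.ident S) x y = shom S x y := by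
  refine (gint_congr fun m => ?_).trans (gint_shom (isEquivariant_shom' y) x)
  change (sgnQ 1 • shom S x m) * (sgnQ 1 • shom S m y) = _
  rw [sgnQ_one, one_smul, one_smul]

lemma entry_graph (u : S ⟶ T) (x : S) (y : T) :
    entry (HSpan.graph u) x y = sgnQ (u.sgn x) * shom T (u.functor.obj x) y := by
  refine (gint_congr fun m => ?_).trans (gint_shom (isEquivariant_comp_shom u y) x)
  change (sgnQ 1 • shom S x m) * _ = _
  rw [sgnQ_one, one_smul]
  rfl

instance (x y : unitPar) : Subsingleton (x ⟶ y) :=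
  (Discrete.instSubsingletonDiscreteHom (α := PUnit) x y :)

lemma shom_unitPar (x y : unitPar) : shom unitPar x y = 1 := by
  let a : x ⟶ y := eqToHom (Subsingleton.elim (α := Discrete PUnit) x y)
  refine (Fintype.sum_eq_single a fun c hc => absurd
    (Subsingleton.elim c a) hc).trans ?_
  exact sgnQ_one

lemma entry_conameSpan (x t : S) (y : unitPar) : entry (conameSpan t) x y = shom S x t := by
  refine (gint_unitPar _).trans ?_
  change (sgnQ 1 • shom S x t) * (sgnQ 1 • shom unitPar _ y) = _
  rw [shom_unitPar, sgnQ_one, one_smul, one_smul, mul_one]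

lemma isEquivariant_entry (M : HSpan S T) (y : T) : IsEquivariant (fun x => entry M x y) := by
  intro x x' a
  simp only [entry, smul_eq_mul]
  rw [← gint_mul_left]
  refine gint_congr fun m => ?_
  rw [shom_comp_left a]
  ring

end Points

namespace BasePoints

variable (b : BasePoints) {S T V : ParGrpd}

lemma eq_of_hom_point {j j' : OrComp S} (h : Nonempty (b.point S j ⟶ b.point S j')) : j = j' :=
  Subtype.ext ((b.mk_point S j).symm.trans ((cls_eq_iff.2 h).trans (b.mk_point S j')))

lemma exists_hom_point {x : S} (hx : IsOrientable x) : ∃ j, Nonempty (x ⟶ b.point S j) := by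
  let j : OrComp S := ⟨cls x, fun s hs => by
    obtain ⟨a⟩ := cls_eq_iff.1 hs.symm
    exact hx.of_hom a⟩
  exact ⟨j, cls_eq_iff.1 (b.mk_point S j).symm⟩

lemma isOrientable_point (j : OrComp S) : IsOrientable (b.point S j) :=
  j.2 _ (b.mk_point S j)

lemma sum_shom_point {W : Type*} [AddCommGroup W] [Module ℚ W] {w : S → W}
    (hw : IsEquivariant w) (x : S) :
    ∑ j, (shom S x (b.point S j) / Nat.card (Aut (b.point S j))) • w (b.point S j) = w x :=
  sum_shom hw (b.point S) (fun _ _ => b.eq_of_hom_point) x b.exists_hom_point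

lemma cardEntry_eq (M : HSpan S T) (i : OrComp S) (j : OrComp T) :
    b.cardEntry M i j = entry M (b.point S i) (b.point T j) / Nat.card (Aut (b.point T j)) := by
  rw [cardEntry, scalarCard_twoSidedFibre]

/-- The vector of a span `M` and a point `x` of its source: the image under the cardinality of
`M` of the vector of `x`. -/
def row (M : HSpan S T) (x : S) : OrComp T →₀ ℚ :=
  Finsupp.equivFunOnFinite.symm fun j => entry M x (b.point T j) / Nat.card (Aut (b.point T j))

/-- The vector of a point: the cardinality of its elementary state. -/
def vec (x : S) : OrComp S →₀ ℚ :=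
  Finsupp.equivFunOnFinite.symm fun j => shom S x (b.point S j) / Nat.card (Aut (b.point S j))

@[simp] lemma row_apply (M : HSpan S T) (x : S) (j : OrComp T) :
    b.row M x j = entry M x (b.point T j) / Nat.card (Aut (b.point T j)) := rfl

@[simp] lemma vec_apply (x : S) (j : OrComp S) :
    b.vec x j = shom S x (b.point S j) / Nat.card (Aut (b.point S j)) := rfl

lemma isEquivariant_row (M : HSpan S T) : IsEquivariant (b.row M) := by
  intro x y a
  ext j
  rw [row_apply, show entry M y _ = _ from isEquivariant_entry M _ a, Finsupp.smul_apply,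
    row_apply, smul_eq_mul, smul_eq_mul, mul_div_assoc]

lemma isEquivariant_vec : IsEquivariant (b.vec (S := S)) := by
  intro x y a
  ext j
  rw [vec_apply, shom_comp_left a, Finsupp.smul_apply, vec_apply, smul_eq_mul, mul_div_assoc]

lemma vec_point (j : OrComp S) : b.vec (b.point S j) = Finsupp.single j 1 := by
  classical
  ext j'
  rw [vec_apply, Finsupp.single_apply]
  split_ifs with h
  · subst h
    rw [shom_of_isOrientable (b.isOrientable_point j) (𝟙 _), parity_id, sgnQ_one, one_mul,
      div_self (card_aut_ne_zero _)]
  · rw [shom_eq_zero_of_isEmpty ⟨fun a => h (b.eq_of_hom_point ⟨a⟩)⟩, zero_div]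

/-- The linear map induced by a function on the points of a parity groupoid. -/
def lift {W : Type*} [AddCommGroup W] [Module ℚ W] (w : S → W) : (OrComp S →₀ ℚ) →ₗ[ℚ] W :=
  Finsupp.linearCombination ℚ fun j => w (b.point S j)

lemma lift_apply {W : Type*} [AddCommGroup W] [Module ℚ W] (w : S → W) (v : OrComp S →₀ ℚ) :
    b.lift w v = ∑ j, v j • w (b.point S j) := by
  rw [lift, Finsupp.linearCombination_apply,
    Finsupp.sum_fintype _ _ fun j => zero_smul ℚ (w (b.point S j))]

/-- This is the universal property of `cardObj S`: an equivariant function extends to a linear map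
whose values on `vec` are the given ones at all points, not only at base points. -/
lemma lift_vec {W : Type*} [AddCommGroup W] [Module ℚ W] {w : S → W} (hw : IsEquivariant w)
    (x : S) : b.lift w (b.vec x) = w x := by
  rw [lift_apply]
  exact b.sum_shom_point hw x

lemma linearMap_ext {W : Type*} [AddCommGroup W] [Module ℚ W] {f g : (OrComp S →₀ ℚ) →ₗ[ℚ] W}
    (h : ∀ x, f (b.vec x) = g (b.vec x)) : f = g := by
  refine Finsupp.lhom_ext' fun j => LinearMap.ext_ring ?_
  have := h (b.point S j)
  rwa [vec_point] at this

lemma hom_ext {W : ModuleCat.{0} ℚ} {f g : cardObj S ⟶ W}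
    (h : ∀ x, f.hom (b.vec x) = g.hom (b.vec x)) : f = g :=
  ModuleCat.hom_ext (b.linearMap_ext h)

lemma cardMap_hom (M : HSpan S T) : (b.cardMap M).hom = b.lift (b.row M) := by
  refine congrArg (Finsupp.linearCombination ℚ) (funext fun i => ?_)
  ext j
  exact b.cardEntry_eq M i j

lemma cardMap_vec (M : HSpan S T) (x : S) : (b.cardMap M).hom (b.vec x) = b.row M x := by
  rw [cardMap_hom]
  exact b.lift_vec (b.isEquivariant_row M) x

lemma row_ident (x : S) : b.row (HSpan.ident S) x = b.vec x := by
  ext j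
  rw [row_apply, entry_ident, vec_apply]

lemma row_graph (u : S ⟶ T) (x : S) :
    b.row (HSpan.graph u) x = sgnQ (u.sgn x) • b.vec (u.functor.obj x) := by
  ext j
  rw [row_apply, entry_graph, Finsupp.smul_apply, vec_apply, smul_eq_mul, mul_div_assoc]

lemma row_conameSpan (x t : S) (p : unitPar) :
    b.row (conameSpan t) x = shom S x t • b.vec p := by
  ext j
  rw [row_apply, entry_conameSpan, Finsupp.smul_apply, vec_apply, shom_unitPar, smul_eq_mul,
    mul_one_div]

/-- Functoriality in matrix form. In the integral for the composite, the entry of `N` at the right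
image of `m` is equivariant and is expanded over base points of `T`; interchanging the sums gives
the matrix product. -/
lemma lift_row_row (M : HSpan S T) (N : HSpan T V) (x : S) :
    b.lift (b.row N) (b.row M x) = b.row (M.comp N) x := by
  rw [lift_apply]
  ext k
  rw [Finsupp.finsetSum_apply, row_apply, entry_comp, div_eq_mul_inv,
    mul_comm, ← gint_mul_left]
  simp only [Finsupp.smul_apply, row_apply, smul_eq_mul]
  have h : ∀ m : M.apex, entry N (M.right.functor.obj m) (b.point V k) =
      ∑ j, (shom T (M.right.functor.obj m) (b.point T j) / Nat.card (Aut (b.point T j))) *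
        entry N (b.point T j) (b.point V k) := fun m =>
    (b.sum_shom_point (isEquivariant_entry N (b.point V k)) _).symm
  simp only [h]
  simp only [entry_def M, gint, Finset.sum_div, Finset.mul_sum, Finset.sum_mul, smul_eq_mul]
  rw [Finset.sum_comm]
  refine Finset.sum_congr rfl fun c _ => Finset.sum_congr rfl fun j _ => ?_
  ring

lemma isFunctorial : b.IsFunctorial where
  congr M N h := by
    refine congrArg (fun f : OrComp _ → OrComp _ →₀ ℚ =>
      ModuleCat.ofHom (Finsupp.linearCombination ℚ f)) (funext fun i => ?_)
    ext j
    exact congrArg (· / _) (scalarCard_congr (HSpan.comp_congr (HSpan.Equivalent.refl _)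
      (HSpan.comp_congr h (HSpan.Equivalent.refl _))))
  map_id S := b.hom_ext fun x => (b.cardMap_vec _ x).trans (b.row_ident x)
  map_comp M N := b.hom_ext fun x => by
    refine (b.cardMap_vec _ x).trans ((b.lift_row_row M N x).symm.trans ?_)
    rw [← cardMap_vec, ← cardMap_hom]
    rfl

end BasePoints

end
end SignedLinAlg

/-! ### Cardinality preserves homotopy sums -/

namespace SignedLinAlg

noncomputable section

open ParGrpd Limits Bicategory Diagram

lemma HCocone.leg_comp {I : Type} [Groupoid.{0} I]
    {D : Pseudofunctor (LocallyDiscrete I) ParGrpd} {X T : ParGrpd} {c : HCocone D X}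
    {N : HSpan X T} {d : HCocone D T} (h : c.IsComposite N d) (i : I) :
    Lin.ofSpan (c.leg i) ≫ Lin.ofSpan N = Lin.ofSpan (d.leg i) := by
  obtain ⟨r, s, κ, ⟨e1⟩, ⟨e2⟩, hp⟩ := h
  let e1' : r.app ⟨i⟩ ≫ (c.leg i).left ≅ (d.leg i).left :=
    { hom := e1.hom.as.app ⟨i⟩
      inv := e1.inv.as.app ⟨i⟩
      hom_inv_id := congrArg (fun t => t.as.app ⟨i⟩) e1.hom_inv_id
      inv_hom_id := congrArg (fun t => t.as.app ⟨i⟩) e1.inv_hom_id }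
  have h := (HSpan.Equivalent.of_iso e1' (kapp e2 i)).symm.trans
    (HSpan.comp_unique (c.leg i) N (r.app ⟨i⟩) (s.app ⟨i⟩) _ (hp i))
  exact (Quotient.sound (s := HSpan.setoid _ _) h).symm

/-- A homotopy sum has the universal property of the canonical cocone on the total groupoid. -/
lemma HCocone.IsHomotopySum.exists_inverse {I : Type} [Groupoid.{0} I] [FiniteGroupoid I]
    {D : Pseudofunctor (LocallyDiscrete I) ParGrpd} {X : ParGrpd} {c : HCocone D X}
    (hc : c.IsHomotopySum) :
    ∃ N : HSpan X (tot D), c.IsComposite N (sumCocone D) ∧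
      Lin.ofSpan N ≫ Lin.ofSpan (totSpan c) = 𝟙 _ := by
  obtain ⟨f, ⟨N, rfl, hN⟩, -⟩ := hc _ (sumCocone D)
  refine ⟨N, hN, ?_⟩
  -- Both the round trip through `tot D` and the identity span factor `c` through itself, so
  -- uniqueness identifies them. Only this one-sided inverse is needed.
  obtain ⟨g, -, hg⟩ := hc _ c
  exact (hg _ ⟨_, rfl, isComposite_comp hN (isComposite_totSpan c)⟩).trans
    (hg _ ⟨_, rfl, isComposite_ident c⟩).symm

namespace BasePoints

variable (b : BasePoints) {S T : ParGrpd}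

/-- The cardinality functor. -/
abbrev card : Lin ⥤ ModuleCat.{0} ℚ := b.cardFunctor b.isFunctorial

lemma cardMap_graph_vec (u : S ⟶ T) (x : S) :
    (b.cardMap (HSpan.graph u)).hom (b.vec x) = sgnQ (u.sgn x) • b.vec (u.functor.obj x) :=
  (b.cardMap_vec _ x).trans (b.row_graph u x)

lemma vec_unitPar (p : unitPar) (j : OrComp unitPar) : b.vec p j = 1 := by
  rw [vec_apply, shom_unitPar, card_aut, Nat.card_eq_one_iff_unique.2 ⟨inferInstance, ⟨𝟙 _⟩⟩,
    Nat.cast_one, div_one]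

lemma isOrientable_unitPar (p : unitPar) : IsOrientable p := fun _ => rfl

instance : Nonempty (OrComp unitPar) :=
  ⟨⟨cls (⟨PUnit.unit⟩ : Discrete PUnit), fun s _ => isOrientable_unitPar s⟩⟩

instance : Subsingleton (OrComp unitPar) :=
  ⟨fun i j => Subtype.ext ((cls_out i.1).symm.trans ((cls_eq_iff.2
    ⟨eqToHom (Subsingleton.elim (α := Discrete PUnit) _ _)⟩).trans (cls_out j.1)))⟩

/-- The elementary costates are jointly monic on cardinalities. -/
lemma hom_ext_coname {W : ModuleCat.{0} ℚ} {f g : W ⟶ cardObj T}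
    (h : ∀ t, f ≫ b.cardMap (conameSpan t) = g ≫ b.cardMap (conameSpan t)) : f = g := by
  obtain ⟨j₀⟩ := (inferInstance : Nonempty (OrComp unitPar))
  -- The costate at base point `j` reads off the `j`-th coordinate, scaled by the nonzero order of
  -- the automorphism group. This yields joint injectivity.
  have key : ∀ (j : OrComp T) (v : OrComp T →₀ ℚ),
      b.lift (b.row (conameSpan (b.point T j))) v =
        (v j * Nat.card (Aut (b.point T j))) • b.vec (b.point unitPar j₀) := by
    intro j v
    have := LinearMap.congr_fun (b.linearMap_ext (f := b.lift (b.row (conameSpan (b.point T j))))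
      (g := ((Nat.card (Aut (b.point T j)) : ℚ) • Finsupp.lapply (R := ℚ) j).smulRight
        (b.vec (b.point unitPar j₀))) fun x => ?_) v
    · rw [this, mul_comm]
      rfl
    · rw [b.lift_vec (b.isEquivariant_row _), b.row_conameSpan _ _ (b.point unitPar j₀)]
      change _ = ((Nat.card (Aut (b.point T j)) : ℚ) * b.vec x j) • b.vec (b.point unitPar j₀)
      rw [vec_apply, mul_div_cancel₀ _ (card_aut_ne_zero (b.point T j))]
  let coord {S : ParGrpd} (j : OrComp S) (v : OrComp S →₀ ℚ) : ℚ := v j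
  ext w
  refine Finsupp.ext fun j => ?_
  have h1 : coord j₀ ((f ≫ b.cardMap (conameSpan (b.point T j))).hom w) =
    coord j₀ ((g ≫ b.cardMap (conameSpan (b.point T j))).hom w) := by rw [h]
  have h2 : ∀ k : W ⟶ cardObj T, coord j₀ ((k ≫ b.cardMap (conameSpan (b.point T j))).hom w) =
      coord j (k.hom w) * Nat.card (Aut (b.point T j)) := by
    intro k
    refine (congrArg (fun l : cardObj T →ₗ[ℚ] cardObj unitPar => coord j₀ (l (k.hom w)))
      (b.cardMap_hom (conameSpan (b.point T j)))).trans ?_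
    refine (congrArg (coord j₀) (key j (k.hom w))).trans ?_
    change coord j (k.hom w) * _ * b.vec (b.point unitPar j₀) j₀ = _
    rw [vec_unitPar, mul_one]
  exact mul_right_cancel₀ (card_aut_ne_zero (b.point T j)) (((h2 f).symm.trans h1).trans (h2 g))

/-- The cardinality of the unit is one-dimensional. -/
def unitIso : cardObj unitPar ≅ ModuleCat.of ℚ ℚ :=
  (Finsupp.uniqueLinearEquiv ℚ ℚ (Classical.arbitrary (OrComp unitPar))).toModuleIso

lemma cardMap_signHom (t : ℤˣ) :
    b.cardMap (HSpan.graph (signHom t)) = ModuleCat.ofHom (((t : ℤ) : ℚ) • LinearMap.id) :=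
  b.hom_ext fun x => b.cardMap_graph_vec (signHom t) x

/-- The restriction of the cardinality functor to `BO(1)` is the sign representation. -/
def restrictIso : parityToLin ⋙ b.card ≅ parityToVect :=
  NatIso.ofComponents (fun _ => unitIso) fun {_ _} t => by
    have key : b.cardMap (HSpan.graph (signHom t)) ≫ unitIso.hom =
        unitIso.hom ≫ signScalar t := by
      refine (congrArg (· ≫ unitIso.hom) (b.cardMap_signHom t)).trans ?_
      ext v
      exact LinearMap.map_smul (unitIso.hom.hom) (((show ℤˣ from t : ℤˣ) : ℤ) : ℚ) _
    exact key

variable {I : Type} [Groupoid.{0} I] [FiniteGroupoid I]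
  (D : Pseudofunctor (LocallyDiscrete I) ParGrpd)

lemma cardMap_leg_sumCocone (i : I) (x : D.obj ⟨i⟩) :
    (b.cardMap ((sumCocone D).leg i)).hom (b.vec x) =
      b.vec (S := tot D) (⟨i, x⟩ : Total D) := by
  refine (b.cardMap_graph_vec (Diagram.inclApp (D := D) i) x).trans ?_
  change sgnQ 1 • b.vec (S := tot D) (⟨i, x⟩ : Total D) = _
  rw [sgnQ_one, one_smul]

/-- The cocone identity along the base of an arrow contributes the sign of the transport, and
equivariance of `vec` contributes the parity of the fibre part. Their product is the parity of the
arrow in `tot D`. -/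
lemma isEquivariant_cocone (s : Cocone (linDiagram D ⋙ b.card)) :
    IsEquivariant (S := tot D) (W := s.pt)
      (fun p : Total D => (s.ι.app p.base).hom (b.vec p.pt)) := by
  intro (x : Total D) (y : Total D) (a : x ⟶ y)
  have h1 : (s.ι.app x.base).hom ((b.cardMap (HSpan.graph (tr D a.base))).hom (b.vec y.pt)) =
      (s.ι.app y.base).hom (b.vec y.pt) :=
    congrArg (fun k => k.hom (b.vec y.pt)) (s.w a.base)
  rw [cardMap_graph_vec, b.isEquivariant_vec a.fib, smul_smul, ← sgnQ_mul, mul_comm] at h1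
  exact h1.symm.trans (LinearMap.map_smul _ _ _)

/-- The cardinality functor sends the canonical cocone on the total groupoid to a colimit. -/
def isColimitSumCocone : IsColimit (b.card.mapCocone (sumCocone D).toCocone) where
  desc s := ModuleCat.ofHom (b.lift (S := tot D) (W := s.pt)
    fun p : Total D => (s.ι.app p.base).hom (b.vec p.pt))
  fac s i := b.hom_ext fun x =>
    (congrArg _ (b.cardMap_leg_sumCocone D i x)).trans
      (b.lift_vec (b.isEquivariant_cocone D s) (⟨i, x⟩ : Total D))
  uniq s m hm := b.hom_ext (S := tot D) fun (p : Total D) => by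
    refine Eq.trans ?_ (b.lift_vec (b.isEquivariant_cocone D s) p).symm
    refine Eq.trans ?_ (congrArg (fun k => k.hom (b.vec p.pt)) (hm p.base))
    exact (congrArg m.hom (b.cardMap_leg_sumCocone D p.base p.pt)).symm

/-- The span `N` and the induced `totSpan c` make `X` a retract of `tot D` compatibly with all legs.
Descent maps are those of `tot D` precomposed with `N`; the retraction identity shows that they are
unique. -/
theorem preservesFiniteHomotopySums : PreservesFiniteHomotopySums b.card := by
  intro I _ _ D X c hc
  obtain ⟨N, hN, h⟩ := hc.exists_inverse
  have h1 : ∀ i, b.cardMap (c.leg i) ≫ b.cardMap N = b.cardMap ((sumCocone D).leg i) := fun i =>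
    (b.card.map_comp _ _).symm.trans (congrArg b.card.map (HCocone.leg_comp hN i))
  have h2 : ∀ i, b.cardMap ((sumCocone D).leg i) ≫ b.cardMap (totSpan c) = b.cardMap (c.leg i) :=
    fun i => (b.card.map_comp _ _).symm.trans
      (congrArg b.card.map (HCocone.leg_comp (isComposite_totSpan c) i))
  have h3 : b.cardMap N ≫ b.cardMap (totSpan c) = 𝟙 (cardObj X) :=
    (b.card.map_comp _ _).symm.trans ((congrArg b.card.map h).trans (b.card.map_id _))
  have hl := b.isColimitSumCocone D
  refine ⟨{ desc := fun s => b.cardMap N ≫ hl.desc s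
            fac := fun s i => ?_
            uniq := fun s m hm => ?_ }⟩
  · refine (Category.assoc _ _ _).symm.trans ?_
    refine (congrArg (· ≫ hl.desc s) (h1 i)).trans (hl.fac s i)
  · have h4 : b.cardMap (totSpan c) ≫ m = hl.desc s := by
      refine hl.uniq s _ fun i => ?_
      refine (Category.assoc _ _ _).symm.trans ?_
      exact (congrArg (· ≫ m) (h2 i)).trans (hm i)
    refine (Category.id_comp m).symm.trans ((congrArg (· ≫ m) h3).symm.trans ?_)
    exact (Category.assoc _ _ _).trans (congrArg (b.cardMap N ≫ ·) h4)

end BasePoints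

end
end SignedLinAlg

namespace SignedLinAlg

noncomputable section

open ParGrpd Limits Bicategory Diagram

/-! ### A parity groupoid as a homotopy sum of its points -/

/-- Since 2-cells into the unit are unique, all coherence laws of `pointDiagram` hold automatically.
-/
instance {R : ParGrpd} (u v : R ⟶ unitPar) : Subsingleton (u ⟶ v) :=
  ⟨fun α β => hom₂_ext fun x => Subsingleton.elim ((Hom₂.nat α).app x) ((Hom₂.nat β).app x)⟩

/-- The endomorphisms of the unit given by signs compose as signs do. -/
def signHomComp (t t' : ℤˣ) : signHom (t * t') ≅ signHom t ≫ signHom t' :=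
  isoMk (u := signHom (t * t')) (v := signHom t ≫ signHom t') (Iso.refl _) (by
    intro x
    rw [comp_sgn]
    change t * t' = t * t' * 1
    rw [mul_one])

/-- The endomorphism of the unit of sign `1` is the identity. -/
def signHomOne : signHom 1 ≅ 𝟙 unitPar := isoMk (u := signHom 1) (v := 𝟙 unitPar) (Iso.refl _)
  (fun _ => (mul_one (1 : ℤˣ)).symm)

variable (S : ParGrpd)

/-- The diagram indexed by a parity groupoid with all values the unit, on which the arrows act by
their parities. -/
def pointDiagram : Pseudofunctor (LocallyDiscrete S) ParGrpd where
  obj _ := unitPar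
  map a := signHom (S.parity a.as)
  map₂ η := eqToHom (by rw [LocallyDiscrete.eq_of_hom η])
  mapId i := eqToIso (congrArg signHom (S.parity_id i.as)) ≪≫ signHomOne
  mapComp a b := eqToIso (congrArg signHom (S.parity_comp a.as b.as)) ≪≫ signHomComp _ _
  map₂_id _ := Subsingleton.elim _ _
  map₂_comp _ _ := Subsingleton.elim _ _
  map₂_whisker_left _ _ _ _ := Subsingleton.elim _ _
  map₂_whisker_right _ _ := Subsingleton.elim _ _
  map₂_associator _ _ _ := Subsingleton.elim _ _
  map₂_left_unitor _ := Subsingleton.elim _ _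
  map₂_right_unitor _ := Subsingleton.elim _ _

/-- The names of the points form a transformation to the constant diagram. -/
def pointTrans : pointDiagram S ⟶ constPF S S :=
  constMk (I := S) (D := pointDiagram S) (X := S) (fun s => nameHom s)
    -- The inverse occurs because the constraint along `a` goes from the point over the target `j`
    -- to the one over the source `i`.
    (fun {i j : S} (a : i ⟶ j) _ => (inv a :))
    (fun {i j : S} (a : i ⟶ j) {_ _} _ =>
      (Category.id_comp (inv a)).trans (Category.comp_id (inv a)).symm)
    (fun a _ => by
      change 1 = S.parity a * 1 * S.parity (inv a)
      rw [mul_one, parity_inv, mul_inv_cancel])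
    (fun i _ => by
      change 𝟙 i ≫ inv (𝟙 i) = 𝟙 i
      simp)
    (fun {i j k} a b _ => by
      change 𝟙 k ≫ inv (a ≫ b) = inv b ≫ inv a
      simp)

/-- All fibres are the one-point groupoid, so an arrow of the total groupoid is just its index
arrow, which is sent to its inverse. -/
lemma isEquivalence_desc_pointTrans : (desc (pointTrans S)).functor.IsEquivalence := by
  have hm : ∀ {y x : Total (pointDiagram S)} (f : y ⟶ x),
      (descF (pointTrans S)).map f = inv f.base := fun f => Category.id_comp (inv f.base)
  have : (descF (pointTrans S)).IsEquivalence := by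
    refine @Functor.IsEquivalence.mk _ _ _ _ _ ⟨?_⟩ ⟨?_⟩ ⟨?_⟩
    · intro y x f g h
      rw [hm, hm] at h
      refine Total.hom_ext (IsIso.inv_eq_inv.1 h)
        (Subsingleton.elim (α := @Quiver.Hom unitPar _ _ _) _ _)
    · intro y x a
      change y.base ⟶ x.base at a
      let e : (y.pt : unitPar) ⟶ x.pt := eqToHom (Subsingleton.elim (α := Discrete PUnit) _ _)
      exact ⟨(⟨inv a, e⟩ : Total.Arrow y x), (hm _).trans IsIso.inv_inv⟩
    · intro s
      exact ⟨⟨s, (⟨PUnit.unit⟩ : Discrete PUnit)⟩, ⟨Iso.refl s⟩⟩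
  exact this

end
end SignedLinAlg

namespace SignedLinAlg

noncomputable section

open ParGrpd Limits Bicategory Diagram

/-! ### Spans with an identity leg -/

namespace Lin

variable {R S T V : ParGrpd}

/-- The morphism of `lin^±` given by a morphism of parity structures `u : S ⟶ T` read backwards,
namely the span `T ← S = S`. -/
def backHom (u : S ⟶ T) : slice T ⟶ slice S := ofSpan ⟨S, u, 𝟙 S⟩

lemma backHom_congr {u v : S ⟶ T} (e : u ≅ v) : backHom u = backHom v :=
  Quotient.sound (HSpan.Equivalent.of_iso e (Iso.refl _))

lemma backHom_comp (v : R ⟶ S) (u : S ⟶ T) : backHom (v ≫ u) = backHom u ≫ backHom v := by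
  let κ : v ≫ 𝟙 S ≅ 𝟙 R ≫ v := ρ_ _ ≪≫ (λ_ _).symm
  have h := HSpan.comp_unique (⟨S, u, 𝟙 S⟩ : HSpan T S) (⟨R, v, 𝟙 R⟩ : HSpan S R) v (𝟙 R) κ
    (HSpan.isHPullback_of_left κ (inferInstanceAs (𝟭 _).IsEquivalence)
      (inferInstanceAs (𝟭 _).IsEquivalence))
  exact Quotient.sound (s := HSpan.setoid _ _)
    ((HSpan.Equivalent.of_iso (Iso.refl _) (λ_ _).symm).trans h)

/-- A span is its backward leg followed by its forward leg. Naturality can thus be checked on the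
two kinds of morphisms separately. -/
lemma ofSpan_eq (M : HSpan S T) : ofSpan M = backHom M.left ≫ ofHom M.right := by
  let κ : 𝟙 M.apex ≫ 𝟙 M.apex ≅ 𝟙 M.apex ≫ 𝟙 M.apex := Iso.refl _
  have h := HSpan.comp_unique (⟨M.apex, M.left, 𝟙 _⟩ : HSpan S M.apex)
    (⟨M.apex, 𝟙 _, M.right⟩ : HSpan M.apex T) (𝟙 _) (𝟙 _) κ
    (HSpan.isHPullback_of_left κ (inferInstanceAs (𝟭 _).IsEquivalence)
      (inferInstanceAs (𝟭 _).IsEquivalence))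
  exact Quotient.sound (s := HSpan.setoid _ _)
    ((HSpan.Equivalent.of_iso (λ_ _).symm (λ_ _).symm).trans h)

/-- An equivalence of parity groupoids gives an isomorphism in `lin^±`. -/
def isoOfEquivalence (u : S ⟶ T) (hu : u.functor.IsEquivalence) : slice S ≅ slice T where
  hom := ofHom u
  inv := backHom u
  hom_inv_id := by
    let κ : 𝟙 S ≫ u ≅ 𝟙 S ≫ u := Iso.refl _
    have h := HSpan.comp_unique (⟨S, 𝟙 S, u⟩ : HSpan S T) (⟨S, u, 𝟙 S⟩ : HSpan T S) (𝟙 _) (𝟙 _) κ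
      (HSpan.isHPullback_of_left κ hu (inferInstanceAs (𝟭 _).IsEquivalence))
    exact (Quotient.sound (s := HSpan.setoid _ _)
      ((HSpan.Equivalent.of_iso (λ_ _).symm (λ_ _).symm).trans h)).symm
  inv_hom_id := (ofSpan_eq (⟨S, u, u⟩ : HSpan T T)).symm.trans
    (Quotient.sound (s := HSpan.setoid _ _) ⟨u, hu, ⟨(ρ_ u).symm⟩, ⟨(ρ_ u).symm⟩⟩)

/-- The name of a point, followed by a morphism of parity structures. -/
def nameHomComp (u : S ⟶ T) (s : S) :
    nameHom s ≫ u ≅ signHom (u.sgn s) ≫ nameHom (u.functor.obj s) :=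
  isoMk (u := nameHom s ≫ u) (v := signHom (u.sgn s) ≫ nameHom (u.functor.obj s))
    (NatIso.ofComponents (fun _ => Iso.refl _) (fun _ => by
      change u.functor.map (𝟙 s) ≫ 𝟙 _ = 𝟙 _ ≫ 𝟙 _
      rw [u.functor.map_id])) (by
    intro x
    rw [comp_sgn, comp_sgn]
    change u.sgn s * 1 = 1 * u.sgn s * T.parity (𝟙 _)
    rw [parity_id, mul_one, one_mul, mul_one])

lemma name_comp_ofHom (u : S ⟶ T) (s : S) : ofHom (nameHom s) ≫ ofHom u =
    ofHom (signHom (u.sgn s)) ≫ ofHom (nameHom (u.functor.obj s)) :=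
  (ofHom_comp _ _).symm.trans ((ofHom_congr (nameHomComp u s)).trans (ofHom_comp _ _))

lemma backHom_comp_coname (u : S ⟶ T) (s : S) : backHom u ≫ backHom (nameHom s) =
    backHom (nameHom (u.functor.obj s)) ≫ backHom (signHom (u.sgn s)) :=
  (backHom_comp _ _).symm.trans ((backHom_congr (nameHomComp u s)).trans (backHom_comp _ _))

lemma ofHom_nameHom_unit (p : unitPar) : ofHom (nameHom p) = 𝟙 (slice unitPar) := by
  refine ofHom_congr (isoMk (u := nameHom p) (v := 𝟙 unitPar)
    (NatIso.ofComponents (F := (Functor.const _).obj p) (G := 𝟭 (unitPar))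
      (fun x => eqToIso (Subsingleton.elim (α := Discrete PUnit) _ _))
      (fun _ => Subsingleton.elim _ _)) fun x => ?_)
  rfl

/-- The composite of a name and a coname, as a span through the discrete groupoid of arrows. -/
lemma name_comp_coname (s t : S) : ofHom (nameHom s) ≫ backHom (nameHom t) =
    backHom (hfst (nameHom s) (nameHom t)) ≫ ofHom (hsnd (nameHom s) (nameHom t)) := by
  refine Eq.trans ?_ (ofSpan_eq ⟨hpullback (nameHom s) (nameHom t), hfst _ _, hsnd _ _⟩)
  exact Quotient.sound (s := HSpan.setoid _ _) (HSpan.Equivalent.of_iso (ρ_ _) (ρ_ _))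

/-- The names of points are equivariant in `lin^±`; this is the constraint of `pointTrans`, and the
reason that maps out of `F S` must satisfy the sign condition. -/
lemma ofHom_nameHom_arrow {s t : S} (a : s ⟶ t) :
    ofHom (signHom (S.parity a)) ≫ ofHom (nameHom t) = ofHom (nameHom s) := by
  have h := (pointTrans S).naturality a.toLoc
  exact (ofHom_comp _ _).symm.trans (ofHom_congr (h ≪≫ ρ_ (nameHom s)))

end Lin

/-! ### Functors preserving finite homotopy sums -/

section Preserving

variable {F G : Lin ⥤ ModuleCat.{0} ℚ}

/-- A functor that preserves finite homotopy sums is determined on objects by its value at the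
unit. -/
lemma PreservesFiniteHomotopySums.existsUnique_desc (hF : PreservesFiniteHomotopySums F)
    {S : ParGrpd} {W : ModuleCat.{0} ℚ} (w : S → (F.obj (Lin.slice unitPar) ⟶ W))
    (hw : ∀ {s t : S} (a : s ⟶ t), F.map (Lin.ofHom (signHom (S.parity a))) ≫ w t = w s) :
    ∃! f : F.obj (Lin.slice S) ⟶ W, ∀ s, F.map (Lin.ofHom (nameHom s)) ≫ f = w s := by
  let D := pointDiagram S
  obtain ⟨hl⟩ := hF S D (tot D) (sumCocone D) isHomotopySum_sumCocone
  -- The colimit delivered by `hF` has the total groupoid of `pointDiagram S` as vertex; this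
  -- isomorphism replaces it by `S` and the legs by the names of points.
  let e := F.mapIso (Lin.isoOfEquivalence (desc (pointTrans S)) (isEquivalence_desc_pointTrans S))
  have he : ∀ s : S, F.map (Lin.ofSpan ((sumCocone D).leg s)) ≫ e.hom =
      F.map (Lin.ofHom (nameHom s)) := by
    intro s
    have h1 : Lin.ofHom (inclApp (D := D) s) ≫ Lin.ofHom (desc (pointTrans S)) =
        Lin.ofHom (nameHom s) := (Lin.ofHom_comp _ _).symm.trans
      (Lin.ofHom_congr (kapp (inclDesc (pointTrans S)) s))
    exact (F.map_comp _ _).symm.trans (congrArg F.map h1)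
  let c : Cocone (linDiagram D ⋙ F) :=
    { pt := W
      ι := { app := fun s => w s
             naturality := fun s t a => (hw a).trans (Category.comp_id _).symm } }
  refine ⟨e.inv ≫ hl.desc c, fun s => ?_, fun f hf => ?_⟩
  · refine (congrArg (· ≫ e.inv ≫ hl.desc c) (he s)).symm.trans ((Category.assoc _ _ _).trans ?_)
    exact (congrArg (F.map (Lin.ofSpan ((sumCocone D).leg s)) ≫ ·)
      (Iso.hom_inv_id_assoc e _)).trans (hl.fac c s)
  · refine (Iso.eq_inv_comp e).2 (hl.uniq c _ fun s => ?_)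
    refine (Category.assoc _ _ _).symm.trans ?_
    exact (congrArg (· ≫ f) (he s)).trans (hf s)

lemma PreservesFiniteHomotopySums.hom_ext (hF : PreservesFiniteHomotopySums F)
    {S : ParGrpd} {W : ModuleCat.{0} ℚ} {f g : F.obj (Lin.slice S) ⟶ W}
    (h : ∀ s : S, F.map (Lin.ofHom (nameHom s)) ≫ f = F.map (Lin.ofHom (nameHom s)) ≫ g) :
    f = g := by
  refine (hF.existsUnique_desc (fun s => F.map (Lin.ofHom (nameHom s)) ≫ g) ?_).unique h
    fun _ => rfl
  intro s t a
  rw [← Category.assoc, ← F.map_comp, Lin.ofHom_nameHom_arrow]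

end Preserving

end
end SignedLinAlg

namespace SignedLinAlg

noncomputable section

open ParGrpd Limits

/-! ### Naturality -/

section Naturality

variable {F G : Lin ⥤ ModuleCat.{0} ℚ} (φ : ∀ S, F.obj (Lin.slice S) ⟶ G.obj (Lin.slice S))
  {R S T : ParGrpd}

/-- The homotopy pullback of two points is the set of arrows between them. When that set is a
singleton, the projection to the point is an equivalence. -/
lemma isEquivalence_hfst_of_subsingleton (s t : S) (hS : ∀ x y : S, Subsingleton (x ⟶ y))
    (hst : Nonempty (s ⟶ t)) : (hfst (nameHom s) (nameHom t)).functor.IsEquivalence := by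
  obtain ⟨a⟩ := hst
  refine @Functor.IsEquivalence.mk _ _ _ _ _ ⟨?_⟩ ⟨?_⟩ ⟨?_⟩
  · intro x y f g _
    exact CategoricalPullback.hom_ext
      (Subsingleton.elim (α := @Quiver.Hom unitPar _ _ _) _ _)
      (Subsingleton.elim (α := @Quiver.Hom unitPar _ _ _) _ _)
  · intro (x : CategoricalPullback (nameHom s).functor (nameHom t).functor)
      (y : CategoricalPullback (nameHom s).functor (nameHom t).functor) f
    exact ⟨⟨f, eqToHom (Subsingleton.elim (α := Discrete PUnit) _ _), (hS _ _).elim _ _⟩,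
      Subsingleton.elim _ _⟩
  · intro p
    exact ⟨(⟨p, p, isoOf a⟩ : CategoricalPullback (nameHom s).functor (nameHom t).functor),
      ⟨Iso.refl _⟩⟩

/-- A family of maps is natural at a morphism of `lin^±`. -/
def NaturalAt (f : Lin.slice S ⟶ Lin.slice T) : Prop := F.map f ≫ φ T = φ S ≫ G.map f

variable {φ}

lemma NaturalAt.comp {f : Lin.slice R ⟶ Lin.slice S} {g : Lin.slice S ⟶ Lin.slice T}
    (hf : NaturalAt φ f) (hg : NaturalAt φ g) : NaturalAt φ (f ≫ g) := by
  unfold NaturalAt at *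
  rw [F.map_comp, Category.assoc, hg, ← Category.assoc, hf, Category.assoc, ← G.map_comp]

lemma NaturalAt.inv {e : Lin.slice S ≅ Lin.slice T} (h : NaturalAt φ e.hom) :
    NaturalAt φ e.inv := by
  unfold NaturalAt at *
  rw [← cancel_mono (G.map e.hom), Category.assoc, ← h, ← Category.assoc, ← F.map_comp,
    Category.assoc, ← G.map_comp, Iso.inv_hom_id, F.map_id, G.map_id, Category.id_comp,
    Category.comp_id]

/-- Names of points are jointly epic after `F`, by `hF.hom_ext`. -/
lemma naturalAt_of_name (hF : PreservesFiniteHomotopySums F)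
    (hφ : ∀ {S : ParGrpd} (s : S), NaturalAt φ (Lin.ofHom (nameHom s)))
    {f : Lin.slice S ⟶ Lin.slice T}
    (h : ∀ s : S, NaturalAt φ (Lin.ofHom (nameHom s) ≫ f)) : NaturalAt φ f := by
  refine hF.hom_ext fun s => ?_
  have h1 := h s
  have h2 := hφ s
  unfold NaturalAt at h1 h2
  rw [F.map_comp, G.map_comp, Category.assoc, ← Category.assoc (φ _), ← h2, Category.assoc] at h1
  exact h1

/-- Dual test, available when elementary costates are jointly monic after `G`. Joint monicity is an
assumption on `G` only, which is why the target of the comparison is the cardinality functor. -/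
lemma naturalAt_of_coname
    (hG : ∀ {T : ParGrpd} {W : ModuleCat.{0} ℚ} {f g : W ⟶ G.obj (Lin.slice T)},
      (∀ t : T, f ≫ G.map (Lin.backHom (nameHom t)) = g ≫ G.map (Lin.backHom (nameHom t))) → f = g)
    {f : Lin.slice S ⟶ Lin.slice T}
    (hT : ∀ t : T, NaturalAt φ (Lin.backHom (nameHom t)))
    (h : ∀ t : T, NaturalAt φ (f ≫ Lin.backHom (nameHom t))) : NaturalAt φ f := by
  refine hG fun t => ?_
  have h1 := h t
  have h2 := hT t
  unfold NaturalAt at h1 h2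
  rw [F.map_comp, G.map_comp, Category.assoc, h2] at h1
  simpa only [Category.assoc] using h1

/-- A family that is natural at the names of points and at the signs is natural. -/
theorem naturalAt_of_forall_name (hF : PreservesFiniteHomotopySums F)
    (hG : ∀ {T : ParGrpd} {W : ModuleCat.{0} ℚ} {f g : W ⟶ G.obj (Lin.slice T)},
      (∀ t : T, f ≫ G.map (Lin.backHom (nameHom t)) = g ≫ G.map (Lin.backHom (nameHom t))) → f = g)
    (hφ : ∀ {S : ParGrpd} (s : S), NaturalAt φ (Lin.ofHom (nameHom s)))
    (hs : ∀ t : ℤˣ, NaturalAt φ (Lin.ofHom (signHom t)))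
    (f : Lin.slice S ⟶ Lin.slice T) : NaturalAt φ f := by
  have h_ofHom : ∀ {S T : ParGrpd} (u : S ⟶ T), NaturalAt φ (Lin.ofHom u) := fun u =>
    naturalAt_of_name hF hφ fun s => by
      rw [Lin.name_comp_ofHom]
      exact (hs _).comp (hφ _)
  have h_equiv : ∀ {S T : ParGrpd} (u : S ⟶ T), u.functor.IsEquivalence →
      NaturalAt φ (Lin.backHom u) := fun u hu =>
    NaturalAt.inv (e := Lin.isoOfEquivalence u hu) (h_ofHom u)
  have h_sign : ∀ t, NaturalAt φ (Lin.backHom (signHom t)) := fun t =>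
    h_equiv _ (inferInstanceAs (𝟭 _).IsEquivalence)
  -- A backward morphism followed by a costate is a costate of its source groupoid followed by a
  -- sign, so naturality at costates of both ends suffices.
  have h_back : ∀ {S T : ParGrpd} (u : S ⟶ T),
      (∀ s : S, NaturalAt φ (Lin.backHom (nameHom s))) →
      (∀ t : T, NaturalAt φ (Lin.backHom (nameHom t))) → NaturalAt φ (Lin.backHom u) :=
    fun u h1 h2 => naturalAt_of_coname hG h1 fun s => by
      rw [Lin.backHom_comp_coname]
      exact (h2 _).comp (h_sign _)
  -- A name followed by a costate is the span through the groupoid of arrows from `s` to `t`.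
  -- Naturality at a costate thereby reduces to the backward projection from that groupoid to the
  -- unit.
  have h_coname : ∀ {S : ParGrpd}
      (_ : ∀ s t : S, NaturalAt φ (Lin.backHom (hfst (nameHom s) (nameHom t)))) (t : S),
      NaturalAt φ (Lin.backHom (nameHom t)) := fun h t =>
    naturalAt_of_name hF hφ fun s => by
      rw [Lin.name_comp_coname]
      exact (h s t).comp (h_ofHom _)
  have h_thin : ∀ {S : ParGrpd} (_ : ∀ x y : S, Subsingleton (x ⟶ y)) (t : S),
      NaturalAt φ (Lin.backHom (nameHom t)) := by
    intro S hS
    refine h_coname fun s t => ?_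
    by_cases hst : Nonempty (s ⟶ t)
    · exact h_equiv _ (isEquivalence_hfst_of_subsingleton s t hS hst)
    -- Without an arrow from `s` to `t` the pullback is empty, and joint monicity over its empty set
    -- of points makes the condition vacuous.
    · refine naturalAt_of_coname hG ?_ ?_
      all_goals
        intro (p : CategoricalPullback (nameHom s).functor (nameHom t).functor)
        exact absurd ⟨p.iso.hom⟩ hst
  -- The groupoid of arrows between two points is thin because the unit has only identity arrows,
  -- and the unit is thin too. The thin case therefore covers both ends of the projection for
  -- arbitrary `S`.
  have h_all : ∀ {S : ParGrpd} (t : S), NaturalAt φ (Lin.backHom (nameHom t)) := fun {S} =>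
    h_coname fun s t => h_back _ (h_thin fun x y => ⟨fun a b => CategoricalPullback.hom_ext
      (Subsingleton.elim (α := @Quiver.Hom unitPar _ _ _) _ _)
      (Subsingleton.elim (α := @Quiver.Hom unitPar _ _ _) _ _)⟩)
      (h_thin fun x y => inferInstance)
  induction f using Quotient.inductionOn with
  | h M =>
    have h := (h_back M.left h_all h_all).comp (h_ofHom M.right)
    rw [← Lin.ofSpan_eq] at h
    exact h

/-- Two functors preserving finite homotopy sums that agree on the unit, the second of which has
jointly monic elementary costates, are isomorphic in exactly one way. -/
theorem existsUnique_iso (hF : PreservesFiniteHomotopySums F) (hG : PreservesFiniteHomotopySums G)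
    (hm : ∀ {T : ParGrpd} {W : ModuleCat.{0} ℚ} {f g : W ⟶ G.obj (Lin.slice T)},
      (∀ t : T, f ≫ G.map (Lin.backHom (nameHom t)) = g ≫ G.map (Lin.backHom (nameHom t))) → f = g)
    (β : F.obj (Lin.slice unitPar) ≅ G.obj (Lin.slice unitPar))
    (hβ : ∀ t : ℤˣ, F.map (Lin.ofHom (signHom t)) ≫ β.hom =
      β.hom ≫ G.map (Lin.ofHom (signHom t))) :
    ∃! φ : F ≅ G, φ.app (Lin.slice unitPar) = β := by
  have hβ' : ∀ t : ℤˣ, G.map (Lin.ofHom (signHom t)) ≫ β.inv =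
      β.inv ≫ F.map (Lin.ofHom (signHom t)) := fun t => by
    rw [Iso.comp_inv_eq, Category.assoc, hβ, Iso.inv_hom_id_assoc]
  choose φ hφ _ using fun S : ParGrpd => hF.existsUnique_desc (S := S)
    (fun s => β.hom ≫ G.map (Lin.ofHom (nameHom s))) fun {s t} a => by
      rw [← Category.assoc, hβ, Category.assoc, ← G.map_comp, Lin.ofHom_nameHom_arrow]
  choose ψ hψ _ using fun S : ParGrpd => hG.existsUnique_desc (S := S)
    (fun s => β.inv ≫ F.map (Lin.ofHom (nameHom s))) fun {s t} a => by
      rw [← Category.assoc, hβ', Category.assoc, ← F.map_comp, Lin.ofHom_nameHom_arrow]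
  -- The name of the point of the unit is the identity morphism, so the extension restricts to the
  -- prescribed isomorphism.
  have hφ₁ : φ unitPar = β.hom := by
    let p : unitPar := (⟨PUnit.unit⟩ : Discrete PUnit)
    have h : F.map (Lin.ofHom (nameHom p)) ≫ φ unitPar = β.hom ≫ G.map (Lin.ofHom (nameHom p)) :=
      hφ unitPar p
    rwa [Lin.ofHom_nameHom_unit p, F.map_id, G.map_id, Category.id_comp, Category.comp_id] at h
  let e : ∀ X : Lin, F.obj X ≅ G.obj X := fun X =>
    { hom := φ X.base
      inv := ψ X.base
      hom_inv_id := hF.hom_ext fun s => by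
        rw [← Category.assoc, hφ, Category.assoc, hψ, Iso.hom_inv_id_assoc, Category.comp_id]
      inv_hom_id := hG.hom_ext fun s => by
        rw [← Category.assoc, hψ, Category.assoc, hφ, Iso.inv_hom_id_assoc, Category.comp_id] }
  have hname : ∀ {S : ParGrpd} (s : S), NaturalAt φ (Lin.ofHom (nameHom s)) := fun s =>
    (hφ _ s).trans (congrArg (· ≫ _) hφ₁.symm)
  have hsign : ∀ t, NaturalAt φ (Lin.ofHom (signHom t)) := fun t => by
    unfold NaturalAt
    rw [hφ₁, hβ]
  refine ⟨NatIso.ofComponents e fun f => naturalAt_of_forall_name hF hm hname hsign f,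
    Iso.ext hφ₁, fun χ hχ => ?_⟩
  ext X : 3
  refine hF.hom_ext fun s => (χ.hom.naturality _).trans ?_
  refine (congrArg (fun k : F.obj (Lin.slice unitPar) ≅ G.obj (Lin.slice unitPar) =>
    k.hom ≫ G.map (Lin.ofHom (nameHom s))) hχ).trans (hφ _ s).symm

end Naturality

namespace BasePoints

variable (b : BasePoints)

theorem existsUnique_iso_card {F : Lin ⥤ ModuleCat.{0} ℚ} (hF : PreservesFiniteHomotopySums F)
    (α : parityToLin ⋙ F ≅ parityToVect) (γ : parityToLin ⋙ b.card ≅ parityToVect) :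
    ∃! φ : F ≅ b.card, Functor.isoWhiskerLeft parityToLin φ ≪≫ γ = α := by
  -- Since `BO(1)` has a single object, the condition on `φ` only concerns its component at the
  -- unit, which must be this one; naturality of `β` is its compatibility with signs.
  let β := α ≪≫ γ.symm
  have key := existsUnique_iso hF b.preservesFiniteHomotopySums (fun h => b.hom_ext_coname h)
    (β.app (SingleObj.star ℤˣ)) fun t => β.hom.naturality (X := SingleObj.star ℤˣ)
      (Y := SingleObj.star ℤˣ) t
  have h : ∀ φ : F ≅ b.card, Functor.isoWhiskerLeft parityToLin φ ≪≫ γ = α ↔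
      φ.app (Lin.slice unitPar) = β.app (SingleObj.star ℤˣ) := by
    intro φ
    have h1 : Functor.isoWhiskerLeft parityToLin φ ≪≫ γ = α ↔
        φ.hom.app (Lin.slice unitPar) ≫ γ.hom.app (SingleObj.star ℤˣ) =
          α.hom.app (SingleObj.star ℤˣ) :=
      ⟨fun h => congrArg (fun k => k.hom.app (SingleObj.star ℤˣ)) h,
        fun h => Iso.ext (NatTrans.ext (funext fun _ => h))⟩
    have h2 : φ.app (Lin.slice unitPar) = β.app (SingleObj.star ℤˣ) ↔
        φ.hom.app (Lin.slice unitPar) =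
          α.hom.app (SingleObj.star ℤˣ) ≫ (γ.app (SingleObj.star ℤˣ)).inv :=
      ⟨fun h => congrArg Iso.hom h, fun h => Iso.ext h⟩
    exact h1.trans ((Iso.eq_comp_inv (γ.app (SingleObj.star ℤˣ))).symm.trans h2.symm)
  simpa only [h] using key

end BasePoints

end
end SignedLinAlg

theorem mainTheorem5 (b : BasePoints) :
    ∃ h : b.IsFunctorial,
      PreservesFiniteHomotopySums (b.cardFunctor h) ∧
      Nonempty (parityToLin ⋙ b.cardFunctor h ≅ parityToVect) ∧
      ∀ F : Lin ⥤ ModuleCat.{0} ℚ, PreservesFiniteHomotopySums F →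
        ∀ (α : parityToLin ⋙ F ≅ parityToVect)
          (γ : parityToLin ⋙ b.cardFunctor h ≅ parityToVect),
          ∃! φ : F ≅ b.cardFunctor h, Functor.isoWhiskerLeft parityToLin φ ≪≫ γ = α :=
  ⟨b.isFunctorial, b.preservesFiniteHomotopySums, ⟨b.restrictIso⟩,
    fun _ hF α γ => b.existsUnique_iso_card hF α γ⟩
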